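/- **Conventions.** Let $x:M^n\to\mathbb R^{n+1}$ be a smooth nondegenerate immersed hypersurface with a chosen side (co-orientation), local coordinates $u^1,\dots,u^n$, and $\partial_i=\partial/\partial u^i$. Put $h_{ij}=\pm\det(\partial_1x,\dots,\partial_nx,\partial_i\partial_jx)$, the sign being that of $\det(\partial_1x,\dots,\partial_nx,\eta)$ for a vector $\eta$ pointing to the chosen side, and $H=|\det(h_{ij})|\neq0$. The affine metric is $g_{ij}=H^{-1/(n+2)}h_{ij}$ (the side being chosen so that $g$ is positive definite whenever it is definite), the affine normal is $\xi=\frac1n\Delta_gx$, the affine shape operator $B=(B_i^k)$ is given by the tangential part $-\sum_kB_i^k\,\partial_kx$ of $\partial_i\xi$, and $L_1=\frac1n\operatorname{tr}B$ is the affine mean curvature. With $e_{n+1}=H^{-1/(n+2)}\xi$ and the connection forms $\omega^k_i,\ \omega^{n+1}_{n+1}$ of the frame $(\partial_1x,\dots,\partial_nx,e_{n+1})$, define $h_{ijk}$ by $\sum_kh_{ijk}du^k=dh_{ij}+h_{ij}\omega^{n+1}_{n+1}-\sum_kh_{kj}\omega^k_i-\sum_kh_{ik}\omega^k_j$; the Fubini–Pick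 form is $A_{ijk}=-\frac12H^{-1/(n+2)}h_{ijk}$. The hypersurface is a hyperbolic affine hypersphere if $B=L_1\,\mathrm{id}$ with a negative constant $L_1$; its affine center is the common point of all affine normal lines. **The composition.** Let $r,s\ge0$ be integers with $K:=r+s\ge2$. For $1\le\alpha\le s$ let $x_\alpha:M_\alpha\to\mathbb R^{n_\alpha+1}$ be a hyperbolic affine hypersphere of dimension $n_\alpha\ge1$ with the origin as affine center, with affine mean curvature $\overset{(\alpha)}{L}_1$, affine metric $\overset{(\alpha)}g$ and Fubini–Pick form $\overset{(\alpha)}A$. Let $c_1,\dots,c_K>0$. Write $\tilde\alpha=r+\alpha$ and $f_a=a$ for $1\le a\le r$, $f_{\tilde\alpha}=\sum_{\beta\le\alpha}n_\beta+\tilde\alpha$. With $d_a=0$ for $a\le r$, $d_{\tilde\alpha}=n_\alpha$, set, for $t\in\mathbb R^{K-1}$, $$e_a=\exp\Big(-\frac{t_{a-1}}{d_a+1}+\sum_{\lambda=a}^{K-1}\frac{t_\lambda}{f_\lambda}\Big)\quad(\text{no term }t_0\text{ for }a=1).$$ Let $n=\sum_\alpha n_\alpha+K-1$, $M=\mathbb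 R^{K-1}\times M_1\times\dots\times M_s$, $$x(t,p_1,\dots,p_s)=(c_1e_1,\dots,c_re_r,\;c_{r+1}e_{r+1}x_1(p_1),\dots,c_Ke_Kx_s(p_s))\in\mathbb R^{n+1},$$ $$C=\Big(\frac1{n+1}\prod_{a=1}^rc_a^2\prod_{\alpha=1}^s\frac{c_{r+\alpha}^{2(n_\alpha+1)}}{(n_\alpha+1)^{n_\alpha+1}(-\overset{(\alpha)}L_1)^{n_\alpha+2}}\Big)^{\frac1{n+2}}.$$ **Statement.** The Calabi composition $x$ of $r$ points and the $s$ hyperspheres $x_\alpha$, co-oriented by its position vector, is a hyperbolic affine hypersphere with affine mean curvature $L_1=-\frac1{(n+1)C}$. In the coordinates $(t^\lambda)_{1\le\lambda\le K-1}$ on $\mathbb R^{K-1}$ and any local coordinates $(v_\alpha^{i})_{1\le i\le n_\alpha}$ on $M_\alpha$ (the index of $v_\alpha^{i}$ being written $\bar i_{\tilde\alpha}$), its affine metric and Fubini–Pick form are as follows. Affine metric: $g_{\lambda\mu}=0$ for $\lambda\ne\mu$, and $$g_{\lambda\lambda}=\begin{cases}\frac{\lambda+1}{\lambda}C,&1\le\lambda\le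 r-1,\\[2pt] \frac{n_1+r+1}{r(n_1+1)}C,&\lambda=r\ (1\le r\le K-1),\\[2pt] \frac{f_{\tilde\alpha+1}}{(n_{\alpha+1}+1)f_{\tilde\alpha}}C,&r+1\le\lambda=\tilde\alpha\le K-1,\end{cases}$$ $$g_{\bar i_{\tilde\alpha}\bar j_{\tilde\beta}}=(n_\alpha+1)(-\overset{(\alpha)}L_1)\,C\,\overset{(\alpha)}g_{ij}\,\delta_{\alpha\beta},\qquad g_{\lambda\bar i_{\tilde\alpha}}=0,$$ so that $g$ is block diagonal, with constant coefficients (hence flat) on $\mathbb R^{K-1}$. Fubini–Pick form: $A$ is totally symmetric, and, up to permutation of the indices, its only possibly nonzero components are $$A_{\lambda\lambda\lambda}=\begin{cases}\frac{1-\lambda^2}{\lambda^2}C,&1\le\lambda\le r-1,\\[2pt] \big(\frac1{r^2}-\frac1{(n_1+1)^2}\big)C,&\lambda=r,\\[2pt] \frac{f_{\tilde\alpha+1}C}{(n_{\alpha+1}+1)f_{\tilde\alpha}}\big(\frac1{f_{\tilde\alpha}}-\frac1{n_{\alpha+1}+1}\big),&r+1\le\lambda=\tilde\alpha\le K-1,\end{cases}$$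 $$A_{\lambda\lambda\mu}=\begin{cases}\frac{\lambda+1}{\lambda\mu}C,&1\le\lambda<\mu\le r,\\[2pt] \frac{(\lambda+1)C}{\lambda f_{\tilde\alpha}},&1\le\lambda\le r-1,\ \mu=\tilde\alpha,\\[2pt] \frac{(n_1+r+1)C}{r(n_1+1)f_{\tilde\alpha}},&\lambda=r,\ \mu=\tilde\alpha,\\[2pt] \frac{f_{\tilde\alpha+1}C}{(n_{\alpha+1}+1)f_{\tilde\alpha}f_{\tilde\beta}},&r+1\le\lambda=\tilde\alpha<\mu=\tilde\beta\le K-1,\end{cases}$$ (where $\mu\le K-1$ throughout), and $$A_{\bar i_{\tilde\alpha}\bar j_{\tilde\alpha}\,\tilde\alpha-1}=-\tfrac1{n_\alpha+1}g_{\bar i_{\tilde\alpha}\bar j_{\tilde\alpha}}=\overset{(\alpha)}L_1C\,\overset{(\alpha)}g_{ij}\quad(\tilde\alpha\ge2),$$ $$A_{\bar i_{\tilde\alpha}\bar j_{\tilde\alpha}\tilde\beta}=\tfrac1{f_{\tilde\beta}}g_{\bar i_{\tilde\alpha}\bar j_{\tilde\alpha}}=\frac{(n_\alpha+1)(-\overset{(\alpha)}L_1)C}{f_{\tilde\beta}}\overset{(\alpha)}g_{ij}\quad(\alpha\le\beta\le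 s-1),$$ $$A_{\bar i_{\tilde\alpha}\bar j_{\tilde\alpha}\bar k_{\tilde\alpha}}=(n_\alpha+1)(-\overset{(\alpha)}L_1)C\,\overset{(\alpha)}A_{ijk}.$$ -/

import Mathlib

open scoped ContDiff Manifold

noncomputable section

namespace AffineHypersurface

/-! ### Equiaffine invariants of a parametrized hypersurface

Here `f : (ι → ℝ) → (κ → ℝ)` is the expression of a hypersurface of dimension `n = card ι` in
local coordinates `u = (u^i)_{i ∈ ι}`. A bijection `e : κ ≃ Option ι` (so `card κ = n + 1`) labels
the coordinates of the ambient space, so that `n + 1` vectors have a determinant; the index `none`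
plays the role of `n + 1`. The sign of this determinant is irrelevant: the side of the
hypersurface on which the affine normal lies is fixed by a transversal field `η`
(a co-orientation), of which only the side of the hypersurface it points to matters. -/

section Local

variable {ι κ : Type*} [Fintype ι] [DecidableEq ι] [Fintype κ] [DecidableEq κ]

/-- The partial derivative `∂F/∂u^i` at `u`. -/
def pd {E : Type*} [NormedAddCommGroup E] [NormedSpace ℝ E]
    (i : ι) (F : (ι → ℝ) → E) (u : ι → ℝ) : E :=
  fderiv ℝ F u (Pi.single i 1)

/-- The family `(∂f/∂u^i (i ∈ ι), w)` of `n + 1` vectors at `u`. -/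
def frame (f : (ι → ℝ) → κ → ℝ) (u : ι → ℝ) (w : κ → ℝ) : Option ι → κ → ℝ
  | none => w
  | some i => pd i f u

/-- The matrix whose rows are the vectors `v a`. -/
def frameMatrix (e : κ ≃ Option ι) (v : Option ι → κ → ℝ) : Matrix (Option ι) (Option ι) ℝ :=
  Matrix.of fun a b => v a (e.symm b)

/-- The determinant of `n + 1` vectors of `ℝ^{n+1}`. -/
def frameDet (e : κ ≃ Option ι) (v : Option ι → κ → ℝ) : ℝ :=
  (frameMatrix e v).det

/-- The coefficients `(c_a)` in `w = ∑ a, c_a • v a`, for a basis `v`. -/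
def frameCoord (e : κ ≃ Option ι) (v : Option ι → κ → ℝ) (w : κ → ℝ) : Option ι → ℝ :=
  Matrix.vecMul (fun b => w (e.symm b)) (frameMatrix e v)⁻¹

/-- `h_{ij} = det(∂_1 f, …, ∂_n f, ∂_i ∂_j f)`, with the sign that makes
`det(∂_1 f, …, ∂_n f, η)` positive. -/
def hForm (e : κ ≃ Option ι) (f η : (ι → ℝ) → κ → ℝ) (u : ι → ℝ) : Matrix ι ι ℝ :=
  Matrix.of fun i j =>
    Real.sign (frameDet e (frame f u (η u))) * frameDet e (frame f u (pd i (pd j f) u))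

/-- `H = |det (h_{ij})|`. -/
def absH (e : κ ≃ Option ι) (f η : (ι → ℝ) → κ → ℝ) (u : ι → ℝ) : ℝ :=
  |(hForm e f η u).det|

/-- The affine (Berwald–Blaschke) metric `g_{ij} = H^{-1/(n+2)} h_{ij}`. -/
def affineMetric (e : κ ≃ Option ι) (f η : (ι → ℝ) → κ → ℝ) (u : ι → ℝ) : Matrix ι ι ℝ :=
  (absH e f η u) ^ (-(1 : ℝ) / ((Fintype.card ι : ℝ) + 2)) • hForm e f η u

/-- The Laplacian of `F` with respect to a (pseudo-)Riemannian metric `(g_{ij})`: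
`|G|^{-1/2} ∑_{i,j} ∂_i (|G|^{1/2} g^{ij} ∂_j F)`, `G = det (g_{ij})`. -/
def laplacian {E : Type*} [NormedAddCommGroup E] [NormedSpace ℝ E]
    (g : (ι → ℝ) → Matrix ι ι ℝ) (F : (ι → ℝ) → E) (u : ι → ℝ) : E :=
  (Real.sqrt |(g u).det|)⁻¹ •
    ∑ i, ∑ j, pd i (fun v => (Real.sqrt |(g v).det| * (g v)⁻¹ i j) • pd j F v) u

/-- The affine normal `ξ = (1/n) Δ_g f`. -/
def affineNormal (e : κ ≃ Option ι) (f η : (ι → ℝ) → κ → ℝ) (u : ι → ℝ) : κ → ℝ :=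
  (1 / (Fintype.card ι : ℝ)) • laplacian (affineMetric e f η) f u

/-- The affine shape operator `B = (B^k_i)`, the tangential part of `∂_i ξ` being
`-∑_k B^k_i ∂_k f`. -/
def shapeOperator (e : κ ≃ Option ι) (f η : (ι → ℝ) → κ → ℝ) (u : ι → ℝ) : Matrix ι ι ℝ :=
  Matrix.of fun k i =>
    -frameCoord e (frame f u (affineNormal e f η u)) (pd i (affineNormal e f η) u) (some k)

/-- The affine mean curvature `L₁ = (1/n) tr B`. -/
def affineMeanCurvature (e : κ ≃ Option ι) (f η : (ι → ℝ) → κ → ℝ) (u : ι → ℝ) : ℝ :=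
  (1 / (Fintype.card ι : ℝ)) * (shapeOperator e f η u).trace

/-- The vector field `e_{n+1} = H^{-1/(n+2)} ξ`, which completes `(∂_i f)` to a unimodular frame. -/
def unimodularNormal (e : κ ≃ Option ι) (f η : (ι → ℝ) → κ → ℝ) (u : ι → ℝ) : κ → ℝ :=
  (absH e f η u) ^ (-(1 : ℝ) / ((Fintype.card ι : ℝ) + 2)) • affineNormal e f η u

/-- The induced affine connection, `ω^k_i = ∑_j Γ^k_{ij} du^j`:
`Γ^k_{ij}` is the `∂_k f`-coefficient of `∂_i ∂_j f` in the frame `(∂_1 f, …, ∂_n f, e_{n+1})`. -/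
def connectionCoeff (e : κ ≃ Option ι) (f η : (ι → ℝ) → κ → ℝ) (u : ι → ℝ) (k i j : ι) : ℝ :=
  frameCoord e (frame f u (unimodularNormal e f η u)) (pd i (pd j f) u) (some k)

/-- The connection form `ω^{n+1}_{n+1}`: the `e_{n+1}`-coefficient of `∂_k e_{n+1}` in the frame
`(∂_1 f, …, ∂_n f, e_{n+1})`. -/
def normalConnection (e : κ ≃ Option ι) (f η : (ι → ℝ) → κ → ℝ) (u : ι → ℝ) (k : ι) : ℝ :=
  frameCoord e (frame f u (unimodularNormal e f η u)) (pd k (unimodularNormal e f η) u) none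

/-- `∑_k h_{ijk} ω^k = dh_{ij} + h_{ij} ω^{n+1}_{n+1} - ∑_l h_{lj} ω^l_i - ∑_l h_{il} ω^l_j`. -/
def hDeriv (e : κ ≃ Option ι) (f η : (ι → ℝ) → κ → ℝ) (u : ι → ℝ) (i j k : ι) : ℝ :=
  pd k (fun v => hForm e f η v i j) u + hForm e f η u i j * normalConnection e f η u k
    - ∑ l, hForm e f η u l j * connectionCoeff e f η u l i k
    - ∑ l, hForm e f η u i l * connectionCoeff e f η u l j k

/-- The Fubini–Pick form `A_{ijk} = -(1/2) H^{-1/(n+2)} h_{ijk}`. -/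
def fubiniPick (e : κ ≃ Option ι) (f η : (ι → ℝ) → κ → ℝ) (u : ι → ℝ) (i j k : ι) : ℝ :=
  -(1 / 2) * (absH e f η u) ^ (-(1 : ℝ) / ((Fintype.card ι : ℝ) + 2)) * hDeriv e f η u i j k

end Local

/-! ### Hypersurfaces `x : M → ℝ^{n+1}`

`𝒜` is the set of admissible coordinate systems of the manifold `M`, `η` a co-orientation. -/

section Manifold

variable {ι κ : Type*} [Fintype ι] [DecidableEq ι] [Fintype κ] [DecidableEq κ]
variable {M : Type*} [TopologicalSpace M]

/-- Components of the affine metric of `x` at `p` in the coordinates `φ`. -/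
def metricAt (e : κ ≃ Option ι) (φ : OpenPartialHomeomorph M (ι → ℝ)) (x η : M → κ → ℝ) (p : M) :
    Matrix ι ι ℝ :=
  affineMetric e (x ∘ φ.symm) (η ∘ φ.symm) (φ p)

/-- The affine normal of `x` at `p`. -/
def normalAt (e : κ ≃ Option ι) (φ : OpenPartialHomeomorph M (ι → ℝ)) (x η : M → κ → ℝ) (p : M) :
    κ → ℝ :=
  affineNormal e (x ∘ φ.symm) (η ∘ φ.symm) (φ p)

/-- Components of the affine shape operator of `x` at `p` in the coordinates `φ`. -/
def shapeAt (e : κ ≃ Option ι) (φ : OpenPartialHomeomorph M (ι → ℝ)) (x η : M → κ → ℝ) (p : M) :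
    Matrix ι ι ℝ :=
  shapeOperator e (x ∘ φ.symm) (η ∘ φ.symm) (φ p)

/-- The affine mean curvature of `x` at `p`. -/
def meanCurvatureAt (e : κ ≃ Option ι) (φ : OpenPartialHomeomorph M (ι → ℝ)) (x η : M → κ → ℝ)
    (p : M) : ℝ :=
  affineMeanCurvature e (x ∘ φ.symm) (η ∘ φ.symm) (φ p)

/-- Components of the Fubini–Pick form of `x` at `p` in the coordinates `φ`. -/
def fubiniPickAt (e : κ ≃ Option ι) (φ : OpenPartialHomeomorph M (ι → ℝ)) (x η : M → κ → ℝ)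
    (p : M) (i j k : ι) : ℝ :=
  fubiniPick e (x ∘ φ.symm) (η ∘ φ.symm) (φ p) i j k

/-- `x` is a smooth nondegenerate hypersurface, co-oriented by the continuous transversal field
`η`. (`transversal` contains that `x` is an immersion.) The last field is the usual convention on
the side of the affine normal: a definite affine metric is positive definite. -/
structure IsNondegenerateHypersurface (e : κ ≃ Option ι)
    (𝒜 : Set (OpenPartialHomeomorph M (ι → ℝ))) (x η : M → κ → ℝ) : Prop where
  smooth : ∀ φ ∈ 𝒜, ContDiffOn ℝ ∞ (x ∘ φ.symm) φ.target
  continuous_coorientation : Continuous η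
  transversal : ∀ φ ∈ 𝒜, ∀ p ∈ φ.source, frameDet e (frame (x ∘ φ.symm) (φ p) (η p)) ≠ 0
  nondegenerate : ∀ φ ∈ 𝒜, ∀ p ∈ φ.source,
    (hForm e (x ∘ φ.symm) (η ∘ φ.symm) (φ p)).det ≠ 0
  not_negDef : ∀ φ ∈ 𝒜, ∀ p ∈ φ.source, ¬ (-metricAt e φ x η p).PosDef

/-- `x` is a hyperbolic affine hypersphere with affine mean curvature `L`:
`B = L • id` with a negative constant `L`. -/
structure IsHyperbolicAffineHypersphere (e : κ ≃ Option ι)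
    (𝒜 : Set (OpenPartialHomeomorph M (ι → ℝ))) (x η : M → κ → ℝ) (L : ℝ) : Prop
    extends IsNondegenerateHypersurface e 𝒜 x η where
  neg : L < 0
  shape : ∀ φ ∈ 𝒜, ∀ p ∈ φ.source, shapeAt e φ x η p = L • (1 : Matrix ι ι ℝ)

/-- All affine lines `{x p + s • ξ p | s ∈ ℝ}` pass through the point `o`. -/
def IsAffineCenter (e : κ ≃ Option ι) (𝒜 : Set (OpenPartialHomeomorph M (ι → ℝ)))
    (x η : M → κ → ℝ) (o : κ → ℝ) : Prop :=
  ∀ φ ∈ 𝒜, ∀ p ∈ φ.source, ∃ s : ℝ, x p + s • normalAt e φ x η p = o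

end Manifold

/-! ### The Calabi composition of `r` points and `s` hypersurfaces

`r` points and `s` hypersurfaces `x_α : M_α → ℝ^{n_α+1}`. Indices are zero-based in the code:
`α : Fin s` stands for the factor number `α + 1` and `i : Fin (r + s - 1)` for the variable
`t^λ` with `λ = i + 1`. -/

section Composition

/-- `f_a = a + (sum of the dimensions of the factors number 1, …, a)`, for `1 ≤ a ≤ r + s`;
the first `r` factors are points, and `x_α` is factor number `r + (α + 1)`. -/
def fNum (r : ℕ) {s : ℕ} (n : Fin s → ℕ) (a : ℕ) : ℕ :=
  a + ∑ β : Fin s, if r + (β : ℕ) + 1 ≤ a then n β else 0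

/-- `e_a = exp(-t_{a-1}/(d+1) + t_a/f_a + ⋯ + t_{K-1}/f_{K-1})`, `K = r + s`, where `d` is the
dimension of the factor number `a` (no term `t_0` for `a = 1`). -/
def eFun (r : ℕ) {s : ℕ} (n : Fin s → ℕ) (t : Fin (r + s - 1) → ℝ) (a d : ℕ) : ℝ :=
  Real.exp (∑ i : Fin (r + s - 1),
    if (i : ℕ) + 2 = a then -(t i / ((d : ℝ) + 1))
    else if a ≤ (i : ℕ) + 1 then t i / (fNum r n ((i : ℕ) + 1) : ℝ)
    else 0)

/-- Coordinate indices on `ℝ^{K-1} × M_1 × ⋯ × M_s`. -/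
abbrev CompIdx (r : ℕ) {s : ℕ} (n : Fin s → ℕ) : Type :=
  Fin (r + s - 1) ⊕ (Σ α : Fin s, Fin (n α))

/-- Coordinate indices on the ambient space `ℝ^r × ℝ^{n_1+1} × ⋯ × ℝ^{n_s+1}`. -/
abbrev AmbIdx (r : ℕ) {s : ℕ} (n : Fin s → ℕ) : Type :=
  Fin r ⊕ (Σ α : Fin s, Fin (n α + 1))

/-- The Calabi composition
`(t, p) ↦ (c_1 e_1, …, c_r e_r, c_{r+1} e_{r+1} x_1(p_1), …, c_K e_K x_s(p_s))`. -/
def calabiComp {r s : ℕ} (n : Fin s → ℕ) {M : Fin s → Type*}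
    (x : ∀ α, M α → Fin (n α + 1) → ℝ) (c : Fin r ⊕ Fin s → ℝ)
    (q : (Fin (r + s - 1) → ℝ) × (∀ α, M α)) : AmbIdx r n → ℝ
  | Sum.inl i => c (Sum.inl i) * eFun r n q.1 ((i : ℕ) + 1) 0
  | Sum.inr ⟨α, k⟩ => c (Sum.inr α) * eFun r n q.1 (r + (α : ℕ) + 1) (n α) * x α (q.2 α) k

/-- The dimension `n = ∑ n_α + K - 1` of the composition. -/
def compDim (r : ℕ) {s : ℕ} (n : Fin s → ℕ) : ℕ := ∑ α, n α + (r + s - 1)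

/-- The constant
`C = ((1/(n+1)) ∏_a c_a² ∏_α c_{r+α}^{2(n_α+1)} / ((n_α+1)^{n_α+1} (-L_α)^{n_α+2}))^{1/(n+2)}`. -/
def calabiC {r s : ℕ} (n : Fin s → ℕ) (L : Fin s → ℝ) (c : Fin r ⊕ Fin s → ℝ) : ℝ :=
  (1 / ((compDim r n : ℝ) + 1) * (∏ a : Fin r, c (Sum.inl a) ^ 2) *
    ∏ α : Fin s, c (Sum.inr α) ^ (2 * (n α + 1)) /
      (((n α : ℝ) + 1) ^ (n α + 1) * (-L α) ^ (n α + 2))) ^ (1 / ((compDim r n : ℝ) + 2))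

/-- `ℝ^{K-1} × ∏ ℝ^{n_α} ≃ ℝ^{K-1+∑ n_α}`. -/
def combine (r : ℕ) {s : ℕ} (n : Fin s → ℕ) :
    ((Fin (r + s - 1) → ℝ) × (∀ α, Fin (n α) → ℝ)) ≃ₜ (CompIdx r n → ℝ) where
  toFun q := Sum.elim q.1 fun k => q.2 k.1 k.2
  invFun u := (fun i => u (Sum.inl i), fun α k => u (Sum.inr ⟨α, k⟩))
  left_inv _ := rfl
  right_inv u := by
    funext k
    rcases k with i | ⟨α, k⟩ <;> rfl
  continuous_toFun := by
    refine continuous_pi fun k => ?_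
    rcases k with i | ⟨α, k⟩
    · exact (continuous_apply i).comp continuous_fst
    · exact (continuous_apply k).comp ((continuous_apply α).comp continuous_snd)
  continuous_invFun := by fun_prop

/-- The product coordinates `(t, v_1, …, v_s)` on `ℝ^{K-1} × M_1 × ⋯ × M_s`, where
`v_α` are the coordinates `φ α` on `M_α`. -/
def prodChart (r : ℕ) {s : ℕ} (n : Fin s → ℕ) {M : Fin s → Type*}
    [∀ α, TopologicalSpace (M α)] (φ : ∀ α, OpenPartialHomeomorph (M α) (Fin (n α) → ℝ)) :
    OpenPartialHomeomorph ((Fin (r + s - 1) → ℝ) × (∀ α, M α)) (CompIdx r n → ℝ) :=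
  ((OpenPartialHomeomorph.refl (Fin (r + s - 1) → ℝ)).prod
    (OpenPartialHomeomorph.pi φ)).transHomeomorph (combine r n)

/-- The smooth coordinate systems of a manifold modelled on `ℝ^m`. -/
def smoothCharts (m : ℕ) (M : Type*) [TopologicalSpace M] [ChartedSpace (Fin m → ℝ) M] :
    Set (OpenPartialHomeomorph M (Fin m → ℝ)) :=
  IsManifold.maximalAtlas (modelWithCornersSelf ℝ (Fin m → ℝ)) ∞ M

/-- The product coordinate systems of `ℝ^{K-1} × M_1 × ⋯ × M_s`. -/
def prodCharts (r : ℕ) {s : ℕ} (n : Fin s → ℕ) (M : Fin s → Type*)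
    [∀ α, TopologicalSpace (M α)] [∀ α, ChartedSpace (Fin (n α) → ℝ) (M α)] :
    Set (OpenPartialHomeomorph ((Fin (r + s - 1) → ℝ) × (∀ α, M α)) (CompIdx r n → ℝ)) :=
  {ψ | ∃ φ : ∀ α, OpenPartialHomeomorph (M α) (Fin (n α) → ℝ),
    (∀ α, φ α ∈ smoothCharts (n α) (M α)) ∧ ψ = prodChart r n φ}

/-- With `α̃ = r + α`, the number `∑_{β ≤ α} n_β + α̃` (recall that `α : Fin s` is zero-based). -/
def partialSum (r : ℕ) {s : ℕ} (n : Fin s → ℕ) (α : Fin s) : ℝ :=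
  (∑ β ∈ Finset.Iic α, (n β : ℝ)) + ((r : ℝ) + (α : ℕ) + 1)

end Composition

end AffineHypersurface

end

noncomputable section

namespace AffineHypersurface

set_option linter.unusedSectionVars false

section PartialDerivatives

variable {ι : Type*} [Fintype ι] [DecidableEq ι]
variable {E : Type*} [NormedAddCommGroup E] [NormedSpace ℝ E]
variable {U : Set (ι → ℝ)} {u : ι → ℝ}

theorem pd_congr {F F' : (ι → ℝ) → E} (h : F =ᶠ[nhds u] F') (i : ι) : pd i F u = pd i F' u := by
  unfold pd; rw [h.fderiv_eq]

theorem pd_congr_on (hU : IsOpen U) (hu : u ∈ U) {F F' : (ι → ℝ) → E} (h : ∀ v ∈ U, F v = F' v)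
    (i : ι) : pd i F u = pd i F' u :=
  pd_congr (Filter.eventuallyEq_of_mem (hU.mem_nhds hu) h) i

theorem pd_const (i : ι) (c : E) : pd i (fun _ => c) u = 0 := by
  simp [pd]

theorem pd_add {F F' : (ι → ℝ) → E} (hF : DifferentiableAt ℝ F u) (hF' : DifferentiableAt ℝ F' u)
    (i : ι) : pd i (fun v => F v + F' v) u = pd i F u + pd i F' u := by
  unfold pd; rw [fderiv_fun_add hF hF']; rfl

theorem pd_sum {m : Type*} (t : Finset m) {F : m → (ι → ℝ) → E}
    (hF : ∀ a ∈ t, DifferentiableAt ℝ (F a) u) (i : ι) :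
    pd i (fun v => ∑ a ∈ t, F a v) u = ∑ a ∈ t, pd i (F a) u := by
  unfold pd; rw [fderiv_fun_sum hF]; simp

theorem pd_smul {c : (ι → ℝ) → ℝ} {F : (ι → ℝ) → E} (hc : DifferentiableAt ℝ c u)
    (hF : DifferentiableAt ℝ F u) (i : ι) :
    pd i (fun v => c v • F v) u = c u • pd i F u + pd i c u • F u := by
  unfold pd; rw [fderiv_fun_smul hc hF]; simp

theorem pd_const_smul {F : (ι → ℝ) → E} (hF : DifferentiableAt ℝ F u) (c : ℝ) (i : ι) :
    pd i (fun v => c • F v) u = c • pd i F u := by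
  rw [pd_smul (differentiableAt_const c) hF, pd_const]; simp

theorem pd_mul {c F : (ι → ℝ) → ℝ} (hc : DifferentiableAt ℝ c u)
    (hF : DifferentiableAt ℝ F u) (i : ι) :
    pd i (fun v => c v * F v) u = c u * pd i F u + pd i c u * F u := by
  simpa using pd_smul hc hF i

theorem pd_const_mul {F : (ι → ℝ) → ℝ} (hF : DifferentiableAt ℝ F u) (c : ℝ) (i : ι) :
    pd i (fun v => c * F v) u = c * pd i F u := by
  simpa using pd_const_smul hF c i

theorem pd_apply {κ : Type*} [Fintype κ] {F : (ι → ℝ) → κ → ℝ} (hF : DifferentiableAt ℝ F u)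
    (i : ι) (k : κ) : pd i F u k = pd i (fun v => F v k) u := by
  unfold pd
  rw [(hasFDerivAt_pi'.1 hF.hasFDerivAt k).fderiv]
  rfl

theorem pd_comp_real {d : ℝ → ℝ} {d' : ℝ} {F : (ι → ℝ) → ℝ} (hF : DifferentiableAt ℝ F u)
    (hd : HasDerivAt d d' (F u)) (i : ι) : pd i (fun v => d (F v)) u = d' * pd i F u := by
  unfold pd
  have := (hd.comp_hasFDerivAt u hF.hasFDerivAt).fderiv
  rw [Function.comp_def] at this
  rw [this]; simp

theorem contDiffOn_pd (hU : IsOpen U) {F : (ι → ℝ) → E} (hF : ContDiffOn ℝ ∞ F U) (i : ι) :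
    ContDiffOn ℝ ∞ (pd i F) U :=
  (hF.fderiv_of_isOpen hU (by simp)).clm_apply contDiffOn_const

theorem differentiableAt_of_contDiffOn (hU : IsOpen U) (hu : u ∈ U) {F : (ι → ℝ) → E}
    (hF : ContDiffOn ℝ ∞ F U) : DifferentiableAt ℝ F u :=
  (hF.contDiffAt (hU.mem_nhds hu)).differentiableAt (by simp)

theorem pd_comm (hU : IsOpen U) (hu : u ∈ U) {F : (ι → ℝ) → E} (hF : ContDiffOn ℝ ∞ F U)
    (i j : ι) : pd i (pd j F) u = pd j (pd i F) u := by
  have hsymm : IsSymmSndFDerivAt ℝ F u :=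
    (hF.contDiffAt (hU.mem_nhds hu)).isSymmSndFDerivAt
      (by simpa using WithTop.coe_le_coe.2 (le_top : (2 : ℕ∞) ≤ ⊤))
  have hd : DifferentiableAt ℝ (fderiv ℝ F) u :=
    differentiableAt_of_contDiffOn hU hu (hF.fderiv_of_isOpen hU (by simp))
  have key : ∀ i j : ι, pd i (pd j F) u
      = fderiv ℝ (fderiv ℝ F) u (Pi.single i 1) (Pi.single j 1) := by
    intro i j
    unfold pd
    rw [fderiv_clm_apply hd (differentiableAt_const _)]
    simp
  rw [key, key, hsymm.eq]

end PartialDerivatives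

section Determinants

variable {ι m : Type*} [Fintype ι] [DecidableEq ι] [Fintype m] [DecidableEq m]
variable {U : Set (ι → ℝ)} {u : ι → ℝ}

theorem contDiffOn_det {M : (ι → ℝ) → Matrix m m ℝ}
    (hM : ∀ i j, ContDiffOn ℝ ∞ (fun v => M v i j) U) :
    ContDiffOn ℝ ∞ (fun v => (M v).det) U := by
  simp only [Matrix.det_apply']
  exact ContDiffOn.sum fun σ _ => contDiffOn_const.mul (contDiffOn_prod fun i _ => hM _ _)

theorem inv_apply_eq_div (M : Matrix m m ℝ) (i j : m) :
    M⁻¹ i j = (M.updateRow j (Pi.single i 1)).det / M.det := by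
  rw [Matrix.inv_def, Matrix.smul_apply, Matrix.adjugate_apply, Ring.inverse_eq_inv']
  simp [div_eq_inv_mul]

theorem contDiffOn_inv_apply {M : (ι → ℝ) → Matrix m m ℝ}
    (hM : ∀ i j, ContDiffOn ℝ ∞ (fun v => M v i j) U) (hdet : ∀ v ∈ U, (M v).det ≠ 0) (i j : m) :
    ContDiffOn ℝ ∞ (fun v => (M v)⁻¹ i j) U := by
  simp only [inv_apply_eq_div]
  refine ContDiffOn.div (contDiffOn_det fun a b => ?_) (contDiffOn_det hM) hdet
  by_cases h : a = j
  · subst h; simpa using contDiffOn_const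
  · simpa [Matrix.updateRow_ne h] using hM a b

theorem det_updateRow_eq (M : Matrix m m ℝ) (hdet : M.det ≠ 0) (i : m) (w : m → ℝ) :
    (M.updateRow i w).det = M.det * ∑ j, M⁻¹ j i * w j := by
  rw [← Matrix.cramer_transpose_apply, Matrix.cramer_eq_adjugate_mulVec,
    ← Matrix.adjugate_transpose, Matrix.inv_def, Finset.mul_sum]
  refine Finset.sum_congr rfl fun j _ => ?_
  change M.adjugate j i * w j = M.det * (Ring.inverse M.det * M.adjugate j i * w j)
  rw [Ring.inverse_eq_inv']
  field_simp

/-- Jacobi's formula. -/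
theorem pd_det {M : (ι → ℝ) → Matrix m m ℝ}
    (hM : ∀ i j, DifferentiableAt ℝ (fun v => M v i j) u) (hdet : (M u).det ≠ 0) (k : ι) :
    pd k (fun v => (M v).det) u
      = (M u).det * ∑ i, ∑ j, (M u)⁻¹ j i * pd k (fun v => M v i j) u := by
  have hrow : ∀ i, DifferentiableAt ℝ (fun (v : ι → ℝ) (j : m) => M v i j) u :=
    fun i => differentiableAt_pi.2 (hM i)
  let D : ContinuousMultilinearMap ℝ (fun _ : m => m → ℝ) ℝ :=
    ⟨(Matrix.detRowAlternating (n := m) (R := ℝ)).toMultilinearMap,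
      Continuous.matrix_det continuous_id⟩
  have hD : ∀ v, (M v).det = D (fun i j => M v i j) := fun v => rfl
  have h1 := HasFDerivAt.multilinear_comp (f := D) (g := fun i v j => M v i j)
    (g' := fun i => fderiv ℝ (fun (v : ι → ℝ) (j : m) => M v i j) u) (x := u)
    fun i => (hrow i).hasFDerivAt
  unfold pd
  simp only [hD]
  rw [h1.fderiv, Finset.mul_sum, sum_apply]
  refine Finset.sum_congr rfl fun i _ => ?_
  rw [← hD, ← det_updateRow_eq _ hdet]
  have h2 : (fun j => fderiv ℝ (fun v => M v i j) u (Pi.single k 1))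
      = fderiv ℝ (fun (v : ι → ℝ) (j : m) => M v i j) u (Pi.single k 1) :=
    funext fun j => (pd_apply (hrow i) k j).symm
  rw [h2]
  rfl

theorem pd_inv {M : (ι → ℝ) → Matrix m m ℝ} (hU : IsOpen U) (hu : u ∈ U)
    (hM : ∀ i j, ContDiffOn ℝ ∞ (fun v => M v i j) U) (hdet : ∀ v ∈ U, (M v).det ≠ 0)
    (k : ι) (i j : m) :
    pd k (fun v => (M v)⁻¹ i j) u
      = -∑ a, ∑ b, (M u)⁻¹ i a * pd k (fun v => M v a b) u * (M u)⁻¹ b j := by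
  have hd : ∀ i j, DifferentiableAt ℝ (fun v => M v i j) u :=
    fun i j => differentiableAt_of_contDiffOn hU hu (hM i j)
  have hd' : ∀ i j, DifferentiableAt ℝ (fun v => (M v)⁻¹ i j) u :=
    fun i j => differentiableAt_of_contDiffOn hU hu (contDiffOn_inv_apply hM hdet i j)
  have hunit : ∀ v ∈ U, IsUnit (M v).det := fun v hv => isUnit_iff_ne_zero.2 (hdet v hv)
  have key : ∀ b, ∑ a, (M u)⁻¹ i a * pd k (fun v => M v a b) u
      = -∑ a, pd k (fun v => (M v)⁻¹ i a) u * M u a b := by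
    intro b
    have h0 : pd k (fun v => ∑ a, (M v)⁻¹ i a * M v a b) u = 0 := by
      rw [pd_congr_on hU hu (F' := fun _ => (1 : Matrix m m ℝ) i b), pd_const]
      intro v hv
      rw [← Matrix.mul_apply, Matrix.nonsing_inv_mul _ (hunit v hv)]
    rw [pd_sum Finset.univ (F := fun a v => (M v)⁻¹ i a * M v a b)
      fun a _ => (hd' i a).fun_mul (hd a b)] at h0
    simp only [pd_mul (hd' i _) (hd _ b)] at h0
    rw [Finset.sum_add_distrib] at h0
    linarith
  rw [Finset.sum_comm]
  simp only [← Finset.sum_mul, key, neg_mul, Finset.sum_neg_distrib, neg_neg]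
  simp only [Finset.sum_mul]
  rw [Finset.sum_comm]
  simp only [mul_assoc, ← Finset.mul_sum, ← Matrix.mul_apply,
    Matrix.mul_nonsing_inv _ (hunit u hu)]
  simp [Matrix.one_apply]

end Determinants

section Frames

variable {ι κ : Type*} [Fintype ι] [DecidableEq ι] [Fintype κ] [DecidableEq κ]
variable {U : Set (ι → ℝ)} {u : ι → ℝ} (e : κ ≃ Option ι)

theorem frameCoord_apply (v : Option ι → κ → ℝ) (w : κ → ℝ) (a : Option ι) :
    frameCoord e v w a = ∑ b, w (e.symm b) * (frameMatrix e v)⁻¹ b a := rfl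

theorem frameCoord_add (v : Option ι → κ → ℝ) (w w' : κ → ℝ) (a : Option ι) :
    frameCoord e v (w + w') a = frameCoord e v w a + frameCoord e v w' a := by
  simp [frameCoord_apply, add_mul, Finset.sum_add_distrib]

theorem frameCoord_smul (v : Option ι → κ → ℝ) (r : ℝ) (w : κ → ℝ) (a : Option ι) :
    frameCoord e v (r • w) a = r * frameCoord e v w a := by
  simp only [frameCoord_apply, Pi.smul_apply, smul_eq_mul, mul_assoc, Finset.mul_sum]

theorem frameCoord_sum {m : Type*} (t : Finset m) (v : Option ι → κ → ℝ) (w : m → κ → ℝ)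
    (a : Option ι) : frameCoord e v (∑ i ∈ t, w i) a = ∑ i ∈ t, frameCoord e v (w i) a := by
  simp only [frameCoord_apply, Finset.sum_apply, Finset.sum_mul]
  exact Finset.sum_comm

theorem frameCoord_self {v : Option ι → κ → ℝ} (hv : frameDet e v ≠ 0) (a b : Option ι) :
    frameCoord e v (v a) b = if a = b then 1 else 0 := by
  have h : frameMatrix e v * (frameMatrix e v)⁻¹ = 1 :=
    Matrix.mul_nonsing_inv _ (isUnit_iff_ne_zero.2 hv)
  have := congrFun (congrFun h a) b
  rw [Matrix.mul_apply, Matrix.one_apply] at this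
  exact this

theorem frameCoord_of_eq_sum {v : Option ι → κ → ℝ} (hv : frameDet e v ≠ 0) {w : κ → ℝ}
    {c : Option ι → ℝ} (hw : w = ∑ a, c a • v a) : frameCoord e v w = c := by
  funext b
  rw [hw, frameCoord_sum]
  simp [frameCoord_smul, frameCoord_self e hv]

theorem sum_frameCoord {v : Option ι → κ → ℝ} (hv : frameDet e v ≠ 0) (w : κ → ℝ) :
    w = ∑ a, frameCoord e v w a • v a := by
  funext k
  have h : (frameMatrix e v)⁻¹ * frameMatrix e v = 1 :=
    Matrix.nonsing_inv_mul _ (isUnit_iff_ne_zero.2 hv)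
  have h2 : Matrix.vecMul (Matrix.vecMul (fun b => w (e.symm b)) (frameMatrix e v)⁻¹)
      (frameMatrix e v) = fun b => w (e.symm b) := by
    rw [Matrix.vecMul_vecMul, h, Matrix.vecMul_one]
  have h3 := congrFun h2 (e k)
  simp only [Equiv.symm_apply_apply] at h3
  rw [Finset.sum_apply, ← h3]
  refine Finset.sum_congr rfl fun a _ => ?_
  simp [frameMatrix, frameCoord]

theorem frameDet_frame {f : (ι → ℝ) → κ → ℝ} {z : κ → ℝ} (hz : frameDet e (frame f u z) ≠ 0)
    (w : κ → ℝ) :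
    frameDet e (frame f u w) = frameDet e (frame f u z) * frameCoord e (frame f u z) w none := by
  have h : frameMatrix e (frame f u w)
      = (frameMatrix e (frame f u z)).updateRow none fun b => w (e.symm b) := by
    ext a b
    cases a <;> simp [frameMatrix, frame, Matrix.updateRow_apply]
  rw [frameDet, h, det_updateRow_eq _ hz, frameCoord_apply]
  simp only [mul_comm, frameDet]

theorem frameCoord_pd {f : (ι → ℝ) → κ → ℝ} {z : κ → ℝ} (hz : frameDet e (frame f u z) ≠ 0)
    (i : ι) (a : Option ι) :
    frameCoord e (frame f u z) (pd i f u) a = if some i = a then 1 else 0 :=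
  frameCoord_self e hz (some i) a

theorem frameCoord_last {f : (ι → ℝ) → κ → ℝ} {z : κ → ℝ} (hz : frameDet e (frame f u z) ≠ 0)
    (a : Option ι) : frameCoord e (frame f u z) z a = if none = a then 1 else 0 :=
  frameCoord_self e hz none a

theorem frame_ne_zero {f : (ι → ℝ) → κ → ℝ} {z : κ → ℝ} (hz : frameDet e (frame f u z) ≠ 0) :
    z ≠ 0 := by
  rintro rfl
  have := frameCoord_self e hz none none
  simp [frame, frameCoord_apply] at this

theorem contDiffOn_frameDet {V : (ι → ℝ) → Option ι → κ → ℝ}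
    (hV : ∀ a, ContDiffOn ℝ ∞ (fun v => V v a) U) :
    ContDiffOn ℝ ∞ (fun v => frameDet e (V v)) U :=
  contDiffOn_det fun a b => contDiffOn_pi.1 (hV a) (e.symm b)

theorem contDiffOn_frameCoord {V : (ι → ℝ) → Option ι → κ → ℝ} {W : (ι → ℝ) → κ → ℝ}
    (hV : ∀ a, ContDiffOn ℝ ∞ (fun v => V v a) U) (hW : ContDiffOn ℝ ∞ W U)
    (hD : ∀ v ∈ U, frameDet e (V v) ≠ 0) (a : Option ι) :
    ContDiffOn ℝ ∞ (fun v => frameCoord e (V v) (W v) a) U := by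
  simp only [frameCoord_apply]
  refine ContDiffOn.sum fun b _ => (contDiffOn_pi.1 hW _).mul
    (contDiffOn_inv_apply (fun a b => ?_) hD b a)
  exact contDiffOn_pi.1 (hV a) (e.symm b)

theorem contDiffOn_frame (hU : IsOpen U) {f W : (ι → ℝ) → κ → ℝ} (hf : ContDiffOn ℝ ∞ f U)
    (hW : ContDiffOn ℝ ∞ W U) (a : Option ι) :
    ContDiffOn ℝ ∞ (fun v => frame f v (W v) a) U := by
  cases a with
  | none => exact hW
  | some i => exact contDiffOn_pd hU hf i

theorem pd_frameDet {V : (ι → ℝ) → Option ι → κ → ℝ} (hU : IsOpen U) (hu : u ∈ U)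
    (hV : ∀ a, ContDiffOn ℝ ∞ (fun v => V v a) U) (hD : frameDet e (V u) ≠ 0) (k : ι) :
    pd k (fun v => frameDet e (V v)) u
      = frameDet e (V u) * ∑ a, frameCoord e (V u) (pd k (fun v => V v a) u) a := by
  have hd : ∀ a, DifferentiableAt ℝ (fun v => V v a) u :=
    fun a => differentiableAt_of_contDiffOn hU hu (hV a)
  unfold frameDet
  rw [pd_det (M := fun v => frameMatrix e (V v))
    (fun a b => differentiableAt_pi.1 (hd a) (e.symm b)) hD]
  congr 1
  refine Finset.sum_congr rfl fun a _ => Finset.sum_congr rfl fun b _ => ?_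
  rw [frameMatrix, mul_comm]
  exact congrArg (· * _) (pd_apply (hd a) k (e.symm b)).symm

end Frames

/-! ### Centroaffine invariants -/

section Centroaffine

variable {ι κ : Type*} [Fintype ι] [DecidableEq ι] [Fintype κ] [DecidableEq κ]

/-- `det(∂_1 f, …, ∂_n f, f)`. -/
def centroDet (e : κ ≃ Option ι) (f : (ι → ℝ) → κ → ℝ) (u : ι → ℝ) : ℝ :=
  frameDet e (frame f u (f u))

/-- The centroaffine metric: the `f`-coefficient of `∂_i ∂_j f` in the frame `(∂_k f, f)`. -/
def centroMetric (e : κ ≃ Option ι) (f : (ι → ℝ) → κ → ℝ) (u : ι → ℝ) : Matrix ι ι ℝ :=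
  Matrix.of fun i j => frameCoord e (frame f u (f u)) (pd i (pd j f) u) none

/-- The centroaffine connection: the `∂_k f`-coefficient of `∂_i ∂_j f` in the frame
`(∂_k f, f)`. -/
def centroConn (e : κ ≃ Option ι) (f : (ι → ℝ) → κ → ℝ) (u : ι → ℝ) (k i j : ι) : ℝ :=
  frameCoord e (frame f u (f u)) (pd i (pd j f) u) (some k)

/-- The covariant derivative of the centroaffine metric with respect to the centroaffine
connection. -/
def centroCubic (e : κ ≃ Option ι) (f : (ι → ℝ) → κ → ℝ) (u : ι → ℝ) (i j k : ι) : ℝ :=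
  pd k (fun v => centroMetric e f v i j) u
    - ∑ l, centroMetric e f u l j * centroConn e f u l i k
    - ∑ l, centroMetric e f u i l * centroConn e f u l j k

variable {U : Set (ι → ℝ)} {u : ι → ℝ} {e : κ ≃ Option ι} {f : (ι → ℝ) → κ → ℝ}

theorem centro_gauss (hD : centroDet e f u ≠ 0) (i j : ι) :
    pd i (pd j f) u
      = ∑ k, centroConn e f u k i j • pd k f u + centroMetric e f u i j • f u := by
  have := sum_frameCoord e hD (pd i (pd j f) u)
  rw [Fintype.sum_option, add_comm] at this
  exact this

theorem centro_unique (hD : centroDet e f u ≠ 0) {w : κ → ℝ} {c : ι → ℝ} {b : ℝ}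
    (hw : w = ∑ k, c k • pd k f u + b • f u) :
    (∀ k, frameCoord e (frame f u (f u)) w (some k) = c k) ∧
      frameCoord e (frame f u (f u)) w none = b := by
  have := frameCoord_of_eq_sum e hD (w := w) (c := fun a => a.elim b c)
    (by rw [Fintype.sum_option, add_comm]; exact hw)
  rw [this]
  exact ⟨fun _ => rfl, rfl⟩

theorem centroMetric_comm (hU : IsOpen U) (hf : ContDiffOn ℝ ∞ f U) (hu : u ∈ U) (i j : ι) :
    centroMetric e f u i j = centroMetric e f u j i := by
  simp only [centroMetric, Matrix.of_apply, pd_comm hU hu hf i j]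

theorem centroConn_comm (hU : IsOpen U) (hf : ContDiffOn ℝ ∞ f U) (hu : u ∈ U) (k i j : ι) :
    centroConn e f u k i j = centroConn e f u k j i := by
  simp only [centroConn, pd_comm hU hu hf i j]

theorem contDiffOn_centroDet (hU : IsOpen U) (hf : ContDiffOn ℝ ∞ f U) :
    ContDiffOn ℝ ∞ (centroDet e f) U :=
  contDiffOn_frameDet e (contDiffOn_frame hU hf hf)

theorem contDiffOn_centroMetric (hU : IsOpen U) (hf : ContDiffOn ℝ ∞ f U)
    (hD : ∀ v ∈ U, centroDet e f v ≠ 0) (i j : ι) :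
    ContDiffOn ℝ ∞ (fun v => centroMetric e f v i j) U :=
  contDiffOn_frameCoord e (contDiffOn_frame hU hf hf) (contDiffOn_pd hU (contDiffOn_pd hU hf j) i)
    hD none

theorem contDiffOn_centroConn (hU : IsOpen U) (hf : ContDiffOn ℝ ∞ f U)
    (hD : ∀ v ∈ U, centroDet e f v ≠ 0) (k i j : ι) :
    ContDiffOn ℝ ∞ (fun v => centroConn e f v k i j) U :=
  contDiffOn_frameCoord e (contDiffOn_frame hU hf hf) (contDiffOn_pd hU (contDiffOn_pd hU hf j) i)
    hD (some k)

theorem pd_centroDet (hU : IsOpen U) (hf : ContDiffOn ℝ ∞ f U) (hu : u ∈ U)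
    (hD : centroDet e f u ≠ 0) (k : ι) :
    pd k (centroDet e f) u = centroDet e f u * ∑ l, centroConn e f u l l k := by
  have h := pd_frameDet e (V := fun v => frame f v (f v)) hU hu (contDiffOn_frame hU hf hf) hD k
  unfold centroDet at hD ⊢
  rw [h]
  congr 1
  rw [Fintype.sum_option]
  have h1 : frameCoord e (frame f u (f u)) (pd k (fun v => frame f v (f v) none) u) none = 0 :=
    (frameCoord_pd e hD k none).trans (by simp)
  rw [h1, zero_add]
  refine Finset.sum_congr rfl fun l _ => ?_
  rw [centroConn_comm hU hf hu]
  rfl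

theorem centroCubic_symm_left (hU : IsOpen U) (hf : ContDiffOn ℝ ∞ f U) (hu : u ∈ U)
    (i j k : ι) : centroCubic e f u i j k = centroCubic e f u j i k := by
  unfold centroCubic
  rw [pd_congr_on hU hu (fun v hv => centroMetric_comm hU hf hv i j)]
  simp only [centroMetric_comm hU hf hu i, centroMetric_comm hU hf hu _ j]
  ring

/-- The Codazzi equation. -/
theorem centroCubic_symm_outer (hU : IsOpen U) (hf : ContDiffOn ℝ ∞ f U) (hu : u ∈ U)
    (hD : ∀ v ∈ U, centroDet e f v ≠ 0) (i j k : ι) :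
    centroCubic e f u i j k = centroCubic e f u k j i := by
  have hG := fun i j => differentiableAt_of_contDiffOn hU hu (contDiffOn_centroMetric hU hf hD i j)
  have hΓ := fun k i j =>
    differentiableAt_of_contDiffOn hU hu (contDiffOn_centroConn hU hf hD k i j)
  have h1 := fun i => differentiableAt_of_contDiffOn hU hu (contDiffOn_pd hU hf i)
  have h0 := differentiableAt_of_contDiffOn hU hu hf
  have key : ∀ i j k : ι, frameCoord e (frame f u (f u)) (pd k (pd i (pd j f)) u) none
      = ∑ l, centroConn e f u l i j * centroMetric e f u k l
        + pd k (fun v => centroMetric e f v i j) u := by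
    intro i j k
    have hs : ∀ l, frameCoord e (frame f u (f u)) (pd l f u) none = 0 := fun l =>
      (frameCoord_pd e (hD u hu) l none).trans (by simp)
    have hn : frameCoord e (frame f u (f u)) (f u) none = 1 :=
      (frameCoord_last e (hD u hu) none).trans (by simp)
    rw [pd_congr_on hU hu (fun v hv => centro_gauss (hD v hv) i j),
      pd_add (DifferentiableAt.fun_sum fun l _ => (hΓ l i j).fun_smul (h1 l))
        ((hG i j).fun_smul h0),
      pd_sum Finset.univ (F := fun l v => centroConn e f v l i j • pd l f v)
        fun l _ => (hΓ l i j).fun_smul (h1 l), pd_smul (hG i j) h0]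
    simp only [pd_smul (hΓ _ i j) (h1 _), frameCoord_add, frameCoord_sum, frameCoord_smul, hs, hn]
    simp [centroMetric]
  have h2 : pd k (pd i (pd j f)) u = pd i (pd k (pd j f)) u :=
    pd_comm hU hu (contDiffOn_pd hU hf j) k i
  have h3 := key i j k
  rw [h2, key k j i] at h3
  unfold centroCubic
  have e1 : ∑ l, centroMetric e f u l j * centroConn e f u l i k
      = ∑ l, centroMetric e f u l j * centroConn e f u l k i :=
    Finset.sum_congr rfl fun l _ => by rw [centroConn_comm hU hf hu l i k]
  have e2 : ∑ l, centroMetric e f u i l * centroConn e f u l j k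
      = ∑ l, centroConn e f u l k j * centroMetric e f u i l :=
    Finset.sum_congr rfl fun l _ => by rw [centroConn_comm hU hf hu l k j, mul_comm]
  have e3 : ∑ l, centroMetric e f u k l * centroConn e f u l j i
      = ∑ l, centroConn e f u l i j * centroMetric e f u k l :=
    Finset.sum_congr rfl fun l _ => by rw [centroConn_comm hU hf hu l i j, mul_comm]
  rw [e1, e2, e3]
  linarith

theorem centroCubic_symm_right (hU : IsOpen U) (hf : ContDiffOn ℝ ∞ f U) (hu : u ∈ U)
    (hD : ∀ v ∈ U, centroDet e f v ≠ 0) (i j k : ι) :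
    centroCubic e f u i j k = centroCubic e f u i k j := by
  rw [centroCubic_symm_left hU hf hu, centroCubic_symm_outer hU hf hu hD,
    centroCubic_symm_left hU hf hu]

end Centroaffine

section Laplacian

variable {ι : Type*} [Fintype ι] [DecidableEq ι]
variable {E : Type*} [NormedAddCommGroup E] [NormedSpace ℝ E]
variable {U : Set (ι → ℝ)} {u : ι → ℝ}

theorem hasDerivAt_sqrt_abs {d : ℝ} (hd : d ≠ 0) :
    HasDerivAt (fun x => √|x|) (√|d| / (2 * d)) d := by
  have h1 := (hasDerivAt_abs hd).sqrt (abs_ne_zero.2 hd)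
  convert h1 using 1
  have h2 : √|d| * √|d| = |d| := Real.mul_self_sqrt (abs_nonneg d)
  have h3 : √|d| ≠ 0 := Real.sqrt_ne_zero'.2 (abs_pos.2 hd)
  have h4 : (SignType.sign d : ℝ) * d = |d| := by
    rcases lt_or_gt_of_ne hd with h | h
    · simp [h, abs_of_neg h]
    · simp [h, abs_of_pos h]
  rw [div_eq_div_iff (by positivity) (by positivity)]
  linear_combination 2 * h2 - 2 * h4

/-- The `j`-th coefficient of the first-order part of the Laplacian, in terms of the inverse metric
`P` and the derivatives `dg i a b = ∂_i g_{ab}`. -/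
def laplacianDrift (P : Matrix ι ι ℝ) (dg : ι → ι → ι → ℝ) (j : ι) : ℝ :=
  ∑ i, (1 / 2 * (∑ a, ∑ b, P b a * dg i a b) * P i j - ∑ a, ∑ b, P i a * dg i a b * P b j)

theorem contDiffOn_sqrt_abs_det {g : (ι → ℝ) → Matrix ι ι ℝ}
    (hg : ∀ i j, ContDiffOn ℝ ∞ (fun v => g v i j) U) (hdet : ∀ v ∈ U, (g v).det ≠ 0) :
    ContDiffOn ℝ ∞ (fun v => √|(g v).det|) U :=
  ((contDiffOn_det hg).abs hdet).sqrt fun v hv => abs_ne_zero.2 (hdet v hv)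

theorem laplacian_eq {g : (ι → ℝ) → Matrix ι ι ℝ} (hU : IsOpen U) (hu : u ∈ U)
    (hg : ∀ i j, ContDiffOn ℝ ∞ (fun v => g v i j) U) (hdet : ∀ v ∈ U, (g v).det ≠ 0)
    {F : (ι → ℝ) → E} (hF : ContDiffOn ℝ ∞ F U) :
    laplacian g F u = ∑ i, ∑ j, (g u)⁻¹ i j • pd i (pd j F) u
      + ∑ j, laplacianDrift (g u)⁻¹ (fun i a b => pd i (fun v => g v a b) u) j • pd j F u := by
  have hd := differentiableAt_of_contDiffOn hU hu (contDiffOn_sqrt_abs_det hg hdet)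
  have hP := fun i j =>
    differentiableAt_of_contDiffOn hU hu (contDiffOn_inv_apply hg hdet i j)
  have hF1 := fun j => differentiableAt_of_contDiffOn hU hu (contDiffOn_pd hU hF j)
  have hdd := differentiableAt_of_contDiffOn hU hu (contDiffOn_det hg)
  have hgd := fun i j => differentiableAt_of_contDiffOn hU hu (hg i j)
  have hs : √|(g u).det| ≠ 0 := Real.sqrt_ne_zero'.2 (abs_pos.2 (hdet u hu))
  have h1 : ∀ i, pd i (fun v => √|(g v).det|) u = √|(g u).det| *
      (1 / 2 * ∑ a, ∑ b, (g u)⁻¹ b a * pd i (fun v => g v a b) u) := by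
    intro i
    rw [pd_comp_real hdd (hasDerivAt_sqrt_abs (hdet u hu)), pd_det hgd (hdet u hu)]
    have := hdet u hu
    field_simp
  have h2 : ∀ i j, pd i (fun v => (√|(g v).det| * (g v)⁻¹ i j) • pd j F v) u
      = √|(g u).det| • ((g u)⁻¹ i j • pd i (pd j F) u +
        (1 / 2 * (∑ a, ∑ b, (g u)⁻¹ b a * pd i (fun v => g v a b) u) * (g u)⁻¹ i j
          - ∑ a, ∑ b, (g u)⁻¹ i a * pd i (fun v => g v a b) u * (g u)⁻¹ b j) • pd j F u) := by
    intro i j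
    rw [pd_smul (hd.fun_mul (hP i j)) (hF1 j), pd_mul hd (hP i j), h1, pd_inv hU hu hg hdet]
    module
  unfold laplacian
  simp only [h2, ← Finset.smul_sum]
  rw [smul_smul, inv_mul_cancel₀ hs, one_smul]
  simp only [Finset.sum_add_distrib, laplacianDrift, Finset.sum_smul]
  congr 1
  exact Finset.sum_comm

/-- If the cubic form `C = ∇g` of a torsion-free connection `∇` with coefficients `Γ` is symmetric
and `∇` preserves the volume of `g`, the first-order part of the Laplacian of `g` is
`-g^{kl} Γ^j_{kl} ∂_j`. -/
theorem laplacianDrift_eq {g P : Matrix ι ι ℝ} (hP : P * g = 1) (hg : ∀ a b, g a b = g b a)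
    {dg Γ : ι → ι → ι → ℝ} (hΓ : ∀ l i j, Γ l i j = Γ l j i)
    (hC : ∀ a b k, dg k a b - ∑ l, g l b * Γ l a k - ∑ l, g a l * Γ l b k
      = dg a b k - ∑ l, g l k * Γ l b a - ∑ l, g b l * Γ l k a)
    (htr : ∀ k, ∑ a, ∑ b, P b a * dg k a b = 2 * ∑ a, Γ a a k) (j : ι) :
    laplacianDrift P dg j = -∑ k, ∑ l, P k l * Γ j k l := by
  have hgP : g * P = 1 := mul_eq_one_comm.1 hP
  have hgs : g.transpose = g := by ext a b; exact hg b a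
  have hPs : ∀ a b, P a b = P b a := by
    have h1 : g * P.transpose = 1 := by
      rw [← hgs, ← Matrix.transpose_mul, hP, Matrix.transpose_one]
    have : P.transpose = P := by
      calc P.transpose = P * g * P.transpose := by rw [hP, one_mul]
        _ = P := by rw [mul_assoc, h1, mul_one]
    intro a b
    exact congrFun (congrFun this b) a
  have hPg : ∀ (b : ι) (x : ι → ℝ), ∑ a, P b a * ∑ l, g a l * x l = x b := by
    intro b x
    have : P.mulVec (g.mulVec x) = x := by rw [Matrix.mulVec_mulVec, hP, Matrix.one_mulVec]
    exact congrFun this b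
  set Q : ι → ℝ := fun l => ∑ i, ∑ a, P i a * Γ l i a with hQ
  have h1 : ∀ b, ∑ i, ∑ a, P i a * dg i a b = ∑ l, g b l * Q l + ∑ a, Γ a a b := by
    intro b
    have h2 : ∀ i a, P i a * dg i a b = P i a * dg b i a
        - P i a * (∑ l, g a l * Γ l i b) - P i a * (∑ l, g i l * Γ l a b)
        + P i a * (∑ l, g b l * Γ l i a) + P i a * (∑ l, g a l * Γ l i b) := by
      intro i a
      have h3 := hC i a b
      have e1 : ∑ l, g l a * Γ l i b = ∑ l, g a l * Γ l i b :=
        Finset.sum_congr rfl fun l _ => by rw [hg l a]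
      have e2 : ∑ l, g l b * Γ l a i = ∑ l, g b l * Γ l i a :=
        Finset.sum_congr rfl fun l _ => by rw [hg l b, hΓ]
      have e3 : ∑ l, g a l * Γ l b i = ∑ l, g a l * Γ l i b :=
        Finset.sum_congr rfl fun l _ => by rw [hΓ]
      rw [e1, e2, e3] at h3
      linear_combination (-P i a) * h3
    simp only [h2, Finset.sum_add_distrib, Finset.sum_sub_distrib]
    have t1 : ∑ i, ∑ a, P i a * dg b i a = 2 * ∑ a, Γ a a b := by
      rw [← htr b]
      exact Finset.sum_congr rfl fun i _ => Finset.sum_congr rfl fun a _ => by rw [hPs]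
    have t2 : ∑ i, ∑ a, P i a * ∑ l, g a l * Γ l i b = ∑ a, Γ a a b :=
      Finset.sum_congr rfl fun i _ => hPg i fun l => Γ l i b
    have t3 : ∑ i, ∑ a, P i a * ∑ l, g i l * Γ l a b = ∑ a, Γ a a b := by
      rw [Finset.sum_comm]
      refine Finset.sum_congr rfl fun a _ => ?_
      rw [← hPg a fun l => Γ l a b]
      exact Finset.sum_congr rfl fun i _ => by rw [hPs]
    have t4 : ∑ i, ∑ a, P i a * ∑ l, g b l * Γ l i a = ∑ l, g b l * Q l := by
      simp only [hQ, Finset.mul_sum]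
      rw [Finset.sum_comm (s := Finset.univ) (t := Finset.univ)
        (f := fun l i => ∑ a, g b l * (P i a * Γ l i a))]
      refine Finset.sum_congr rfl fun i _ => ?_
      rw [Finset.sum_comm]
      exact Finset.sum_congr rfl fun l _ => Finset.sum_congr rfl fun a _ => by ring
    rw [t1, t2, t3, t4]
    ring
  unfold laplacianDrift
  rw [Finset.sum_sub_distrib]
  have h4 : ∑ i, ∑ a, ∑ b, P i a * dg i a b * P b j = ∑ b, (∑ i, ∑ a, P i a * dg i a b) * P b j := by
    simp only [Finset.sum_mul]
    rw [Finset.sum_comm (s := Finset.univ) (t := Finset.univ)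
      (f := fun b i => ∑ a, P i a * dg i a b * P b j)]
    exact Finset.sum_congr rfl fun i _ => Finset.sum_comm
  have h5 : ∑ b, (∑ l, g b l * Q l) * P b j = Q j := by
    rw [← hPg j Q]
    exact Finset.sum_congr rfl fun b _ => by rw [hPs j b, mul_comm]
  simp only [h4, h1, htr, add_mul, Finset.sum_add_distrib, h5]
  have h6 : ∀ i, 1 / 2 * (2 * ∑ a, Γ a a i) * P i j = (∑ a, Γ a a i) * P i j := fun i => by ring
  simp only [h6]
  ring

end Laplacian

section CentroaffineLaplacian

variable {ι κ : Type*} [Fintype ι] [DecidableEq ι] [Fintype κ] [DecidableEq κ]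
variable {U : Set (ι → ℝ)} {u : ι → ℝ} {e : κ ≃ Option ι} {f : (ι → ℝ) → κ → ℝ}

/-- If `D² = R |det G|` with a constant `R`, the Laplacian of a constant multiple of the
centroaffine metric maps `f` to a constant multiple of `f`. -/
theorem laplacian_centro (hU : IsOpen U) (hf : ContDiffOn ℝ ∞ f U) (hu : u ∈ U)
    (hD : ∀ v ∈ U, centroDet e f v ≠ 0) {R ρ : ℝ} (hρ : ρ ≠ 0)
    (hR : ∀ v ∈ U, centroDet e f v ^ 2 = R * |(centroMetric e f v).det|)
    {g : (ι → ℝ) → Matrix ι ι ℝ} (hg : ∀ v ∈ U, g v = ρ • centroMetric e f v) :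
    laplacian g f u = (Fintype.card ι / ρ) • f u := by
  have hdG : ∀ v ∈ U, (centroMetric e f v).det ≠ 0 := by
    intro v hv h0
    have := hR v hv
    rw [h0, abs_zero, mul_zero] at this
    exact hD v hv (pow_eq_zero_iff two_ne_zero |>.1 this)
  have hgG : ∀ i j, ∀ v ∈ U, g v i j = ρ * centroMetric e f v i j := fun i j v hv => by
    rw [hg v hv]; rfl
  have hGs := contDiffOn_centroMetric hU hf hD
  have hgs : ∀ i j, ContDiffOn ℝ ∞ (fun v => g v i j) U := fun i j =>
    (contDiffOn_const.mul (hGs i j)).congr (hgG i j)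
  have hdg : ∀ v ∈ U, (g v).det ≠ 0 := fun v hv => by
    rw [hg v hv, Matrix.det_smul]
    exact mul_ne_zero (pow_ne_zero _ hρ) (hdG v hv)
  have hGd := fun i j => differentiableAt_of_contDiffOn hU hu (hGs i j)
  have hpd : ∀ i a b, pd i (fun v => g v a b) u = ρ * pd i (fun v => centroMetric e f v a b) u :=
    fun i a b => by rw [pd_congr_on hU hu (hgG a b), pd_const_mul (hGd a b)]
  have hinv : (g u)⁻¹ * g u = 1 :=
    Matrix.nonsing_inv_mul _ (isUnit_iff_ne_zero.2 (hdg u hu))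
  have htr : ∀ k, ∑ a, ∑ b, (g u)⁻¹ b a * pd k (fun v => g v a b) u
      = 2 * ∑ a, centroConn e f u a a k := by
    intro k
    have hgd := fun i j => differentiableAt_of_contDiffOn hU hu (hgs i j)
    have hDd := differentiableAt_of_contDiffOn hU hu (contDiffOn_centroDet (e := e) hU hf)
    have hdd := differentiableAt_of_contDiffOn hU hu (contDiffOn_det hgs)
    set S : ℝ := R / |ρ ^ Fintype.card ι| with hS
    have hρ' : |ρ ^ Fintype.card ι| ≠ 0 := abs_ne_zero.2 (pow_ne_zero _ hρ)
    have h1 : ∀ v ∈ U, (centroDet e f v * centroDet e f v) * (centroDet e f v * centroDet e f v)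
        = S ^ 2 * ((g v).det * (g v).det) := by
      intro v hv
      have h2 : centroDet e f v ^ 2 = S * |(g v).det| := by
        rw [hR v hv, hg v hv, Matrix.det_smul, abs_mul, hS]
        field_simp
      calc _ = (centroDet e f v ^ 2) ^ 2 := by ring
        _ = S ^ 2 * |(g v).det| ^ 2 := by rw [h2]; ring
        _ = _ := by rw [sq_abs]; ring
    have h3 := pd_congr_on hU hu h1 k
    have hDD := hDd.fun_mul hDd
    rw [pd_mul hDD hDD, pd_mul hDd hDd, pd_const_mul (hdd.fun_mul hdd), pd_mul hdd hdd,
      pd_det hgd (hdg u hu)] at h3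
    have h4 := pd_centroDet hU hf hu (hD u hu) k
    change pd k (fun v => centroDet e f v) u = _ at h4
    rw [h4] at h3
    have h5 := h1 u hu
    have h6 : centroDet e f u ≠ 0 := hD u hu
    have h7 : centroDet e f u ^ 4 ≠ 0 := pow_ne_zero _ h6
    apply mul_left_cancel₀ h7
    linear_combination (-1 / 2) * h3 + (∑ a, ∑ b, (g u)⁻¹ b a * pd k (fun v => g v a b) u) * h5
  have hdrift := laplacianDrift_eq (g := g u) (P := (g u)⁻¹) hinv
    (fun a b => by rw [hgG _ _ u hu, hgG _ _ u hu, centroMetric_comm hU hf hu])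
    (dg := fun i a b => pd i (fun v => g v a b) u) (Γ := centroConn e f u)
    (centroConn_comm hU hf hu)
    (fun a b k => by
      have h1 : ∀ i j k, pd k (fun v => g v i j) u - ∑ l, g u l j * centroConn e f u l i k
          - ∑ l, g u i l * centroConn e f u l j k = ρ * centroCubic e f u i j k := by
        intro i j k
        simp only [hpd, hgG _ _ u hu, centroCubic, mul_sub, Finset.mul_sum, mul_assoc]
      rw [h1, h1, centroCubic_symm_left hU hf hu, centroCubic_symm_right hU hf hu hD])
    htr
  rw [laplacian_eq hU hu hgs hdg hf]
  simp only [hdrift]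
  simp only [centro_gauss (hD u hu), smul_add, Finset.smul_sum, Finset.sum_add_distrib]
  have hcard : ∑ i, ∑ j, (g u)⁻¹ i j * centroMetric e f u i j = Fintype.card ι / ρ := by
    have h1 : ∑ i, ∑ j, (g u)⁻¹ i j * g u j i = Fintype.card ι := by
      simp only [← Matrix.mul_apply, hinv]
      simp
    rw [← h1, Finset.sum_div]
    refine Finset.sum_congr rfl fun i _ => ?_
    rw [Finset.sum_div]
    refine Finset.sum_congr rfl fun j _ => ?_
    rw [hgG _ _ u hu, centroMetric_comm hU hf hu j i]
    field_simp
  have h8 : ∑ i, ∑ j, ∑ k, (g u)⁻¹ i j • centroConn e f u k i j • pd k f u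
      = ∑ k, (∑ i, ∑ j, (g u)⁻¹ i j * centroConn e f u k i j) • pd k f u := by
    simp only [Finset.sum_smul, smul_smul]
    rw [Finset.sum_comm (s := Finset.univ) (t := Finset.univ)
      (f := fun k i => ∑ j, ((g u)⁻¹ i j * centroConn e f u k i j) • pd k f u)]
    exact Finset.sum_congr rfl fun i _ => Finset.sum_comm
  rw [h8]
  simp only [smul_smul, ← Finset.sum_smul, hcard, neg_smul, Finset.sum_neg_distrib]
  abel

end CentroaffineLaplacian

section Hypersphere

variable {ι κ : Type*} [Fintype ι] [DecidableEq ι] [Fintype κ] [DecidableEq κ]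
variable {U : Set (ι → ℝ)} {u : ι → ℝ} {e : κ ≃ Option ι} {f η : (ι → ℝ) → κ → ℝ}

theorem sign_mul_self_eq_abs (x : ℝ) : Real.sign x * x = |x| := by
  rcases lt_trichotomy x 0 with h | h | h
  · rw [Real.sign_of_neg h, abs_of_neg h]; ring
  · simp [h]
  · rw [Real.sign_of_pos h, abs_of_pos h, one_mul]

/-- A hypersurface with a constant ratio `ρ^{n+2} = D² / |det G|`, co-oriented by a field on the
side of its position vector. -/
structure IsCentroSphere (e : κ ≃ Option ι) (f η : (ι → ℝ) → κ → ℝ) (U : Set (ι → ℝ)) (ρ : ℝ) :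
    Prop where
  isOpen : IsOpen U
  smooth : ContDiffOn ℝ ∞ f U
  pos : 0 < ρ
  centroDet_ne : ∀ v ∈ U, centroDet e f v ≠ 0
  sign : ∀ v ∈ U, Real.sign (frameDet e (frame f v (η v))) = Real.sign (centroDet e f v)
  ratio : ∀ v ∈ U,
    centroDet e f v ^ 2 = ρ ^ (Fintype.card ι + 2) * |(centroMetric e f v).det|

theorem hForm_eq_centro (hD : centroDet e f u ≠ 0)
    (hs : Real.sign (frameDet e (frame f u (η u))) = Real.sign (centroDet e f u)) :
    hForm e f η u = |centroDet e f u| • centroMetric e f u := by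
  ext i j
  simp only [hForm, Matrix.of_apply, hs, Matrix.smul_apply, smul_eq_mul]
  rw [frameDet_frame e (z := f u) hD, ← sign_mul_self_eq_abs]
  simp only [centroDet, centroMetric, Matrix.of_apply]
  ring

theorem absH_eq_centro (hD : centroDet e f u ≠ 0)
    (hs : Real.sign (frameDet e (frame f u (η u))) = Real.sign (centroDet e f u)) :
    absH e f η u = |centroDet e f u| ^ Fintype.card ι * |(centroMetric e f u).det| := by
  rw [absH, hForm_eq_centro hD hs, Matrix.det_smul, abs_mul, abs_pow, abs_abs]

theorem frameCoord_smul_last (hD : centroDet e f u ≠ 0) {c : ℝ} (hc : c ≠ 0) (w : κ → ℝ) :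
    (∀ k, frameCoord e (frame f u (c • f u)) w (some k)
        = frameCoord e (frame f u (f u)) w (some k)) ∧
      frameCoord e (frame f u (c • f u)) w none
        = c⁻¹ * frameCoord e (frame f u (f u)) w none := by
  have h0 : frameDet e (frame f u (c • f u)) ≠ 0 := by
    rw [frameDet_frame e (z := f u) hD, frameCoord_smul, frameCoord_last e hD]
    simpa using ⟨hD, hc⟩
  have := frameCoord_of_eq_sum e h0 (w := w)
    (c := fun a => a.elim (c⁻¹ * frameCoord e (frame f u (f u)) w none)
      fun k => frameCoord e (frame f u (f u)) w (some k)) (by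
      conv_lhs => rw [sum_frameCoord e hD w]
      rw [Fintype.sum_option, Fintype.sum_option]
      congr 1
      simp only [frame, Option.elim, smul_smul]
      congr 1
      field_simp)
  rw [this]
  exact ⟨fun _ => rfl, rfl⟩

theorem IsCentroSphere.absH_rpow {ρ : ℝ} (h : IsCentroSphere e f η U ρ) (hu : u ∈ U) :
    absH e f η u ^ (-(1 : ℝ) / ((Fintype.card ι : ℝ) + 2)) = ρ / |centroDet e f u| := by
  have hD := h.centroDet_ne u hu
  have hρ := h.pos
  have hD' : 0 < |centroDet e f u| := abs_pos.2 hD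
  have h1 : absH e f η u = (|centroDet e f u| / ρ) ^ (Fintype.card ι + 2) := by
    rw [absH_eq_centro hD (h.sign u hu), div_pow, eq_div_iff (by positivity),
      pow_add |centroDet e f u|, sq_abs, h.ratio u hu]
    ring
  have h2 : ((Fintype.card ι : ℝ) + 2) ≠ 0 := by positivity
  rw [h1, ← Real.rpow_natCast, ← Real.rpow_mul (by positivity)]
  push_cast
  rw [mul_div_cancel₀ _ h2, Real.rpow_neg_one, inv_div]

theorem IsCentroSphere.affineMetric_eq {ρ : ℝ} (h : IsCentroSphere e f η U ρ) (hu : u ∈ U) :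
    affineMetric e f η u = ρ • centroMetric e f u := by
  have hD := h.centroDet_ne u hu
  rw [affineMetric, h.absH_rpow hu, hForm_eq_centro hD (h.sign u hu), smul_smul,
    div_mul_cancel₀ _ (abs_ne_zero.2 hD)]

theorem IsCentroSphere.centroMetric_det_ne {ρ : ℝ} (h : IsCentroSphere e f η U ρ) (hu : u ∈ U) :
    (centroMetric e f u).det ≠ 0 := by
  intro h0
  have := h.ratio u hu
  rw [h0, abs_zero, mul_zero] at this
  exact h.centroDet_ne u hu (pow_eq_zero_iff two_ne_zero |>.1 this)

theorem IsCentroSphere.hForm_det_ne {ρ : ℝ} (h : IsCentroSphere e f η U ρ) (hu : u ∈ U) :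
    (hForm e f η u).det ≠ 0 := by
  have hD := h.centroDet_ne u hu
  rw [hForm_eq_centro hD (h.sign u hu), Matrix.det_smul]
  exact mul_ne_zero (pow_ne_zero _ (abs_ne_zero.2 hD)) (h.centroMetric_det_ne hu)

theorem IsCentroSphere.affineNormal_eq [Nonempty ι] {ρ : ℝ} (h : IsCentroSphere e f η U ρ)
    (hu : u ∈ U) : affineNormal e f η u = ρ⁻¹ • f u := by
  have hn : (Fintype.card ι : ℝ) ≠ 0 := by exact_mod_cast Fintype.card_ne_zero
  rw [affineNormal, laplacian_centro h.isOpen h.smooth hu h.centroDet_ne h.pos.ne' h.ratio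
    (fun v hv => h.affineMetric_eq hv), smul_smul]
  congr 1
  field_simp

theorem IsCentroSphere.shapeOperator_eq [Nonempty ι] {ρ : ℝ} (h : IsCentroSphere e f η U ρ)
    (hu : u ∈ U) : shapeOperator e f η u = (-ρ⁻¹) • (1 : Matrix ι ι ℝ) := by
  have hD := h.centroDet_ne u hu
  have hρ : ρ⁻¹ ≠ 0 := inv_ne_zero h.pos.ne'
  ext k i
  rw [shapeOperator, Matrix.of_apply, h.affineNormal_eq hu,
    pd_congr_on h.isOpen hu (fun v hv => h.affineNormal_eq hv),
    pd_const_smul (differentiableAt_of_contDiffOn h.isOpen hu h.smooth),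
    (frameCoord_smul_last hD hρ _).1, frameCoord_smul, frameCoord_pd e hD]
  by_cases hik : i = k
  · simp [hik]
  · simp [hik, Ne.symm hik]

theorem IsCentroSphere.affineMeanCurvature_eq [Nonempty ι] {ρ : ℝ}
    (h : IsCentroSphere e f η U ρ) (hu : u ∈ U) : affineMeanCurvature e f η u = -ρ⁻¹ := by
  have hn : (Fintype.card ι : ℝ) ≠ 0 := by exact_mod_cast Fintype.card_ne_zero
  rw [affineMeanCurvature, h.shapeOperator_eq hu, Matrix.trace_smul, Matrix.trace_one]
  simp only [smul_eq_mul]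
  field_simp

theorem IsCentroSphere.fubiniPick_eq [Nonempty ι] {ρ : ℝ} (h : IsCentroSphere e f η U ρ)
    (hu : u ∈ U) (i j k : ι) :
    fubiniPick e f η u i j k = -(ρ / 2) * centroCubic e f u i j k := by
  have hD := h.centroDet_ne u hu
  have hD' : |centroDet e f u| ≠ 0 := abs_ne_zero.2 hD
  have hρ := h.pos.ne'
  have hun : ∀ v ∈ U, unimodularNormal e f η v = |centroDet e f v|⁻¹ • f v := by
    intro v hv
    rw [unimodularNormal, h.absH_rpow hv, h.affineNormal_eq hv, smul_smul]
    congr 1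
    have := h.pos.ne'
    field_simp
  have hDs := contDiffOn_centroDet (e := e) h.isOpen h.smooth
  have habs : ContDiffOn ℝ ∞ (fun v => |centroDet e f v|) U := hDs.abs h.centroDet_ne
  have hda := differentiableAt_of_contDiffOn h.isOpen hu habs
  have hdi : DifferentiableAt ℝ (fun v => |centroDet e f v|⁻¹) u :=
    differentiableAt_of_contDiffOn h.isOpen hu
    (habs.inv fun v hv => abs_ne_zero.2 (h.centroDet_ne v hv))
  have hfd := differentiableAt_of_contDiffOn h.isOpen hu h.smooth
  have hGd := fun i j => differentiableAt_of_contDiffOn h.isOpen hu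
    (contDiffOn_centroMetric h.isOpen h.smooth h.centroDet_ne i j)
  have h1 : |centroDet e f u| * pd k (fun v => |centroDet e f v|⁻¹) u
      + pd k (fun v => |centroDet e f v|) u * |centroDet e f u|⁻¹ = 0 := by
    rw [← pd_mul hda hdi, pd_congr_on h.isOpen hu (F' := fun _ => (1 : ℝ)), pd_const]
    intro v hv
    exact mul_inv_cancel₀ (abs_ne_zero.2 (h.centroDet_ne v hv))
  have hnc : normalConnection e f η u k
      = |centroDet e f u| * pd k (fun v => |centroDet e f v|⁻¹) u := by
    rw [normalConnection, hun u hu, pd_congr_on h.isOpen hu hun, pd_smul hdi hfd,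
      (frameCoord_smul_last hD (inv_ne_zero hD') _).2, frameCoord_add, frameCoord_smul,
      frameCoord_smul, frameCoord_pd e hD, frameCoord_last e hD]
    simp
  have hconn : ∀ l a b, connectionCoeff e f η u l a b = centroConn e f u l a b := by
    intro l a b
    rw [connectionCoeff, hun u hu, (frameCoord_smul_last hD (inv_ne_zero hD') _).1]
    rfl
  have hh : ∀ v ∈ U, ∀ a b, hForm e f η v a b = |centroDet e f v| * centroMetric e f v a b := by
    intro v hv a b
    rw [hForm_eq_centro (h.centroDet_ne v hv) (h.sign v hv)]
    rfl
  have hhd : hDeriv e f η u i j k = |centroDet e f u| * centroCubic e f u i j k := by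
    unfold hDeriv centroCubic
    rw [pd_congr_on h.isOpen hu (fun v hv => hh v hv i j), pd_mul hda (hGd i j), hnc]
    simp only [hh u hu, hconn, mul_assoc, ← Finset.mul_sum]
    have h2 : pd k (fun v => |centroDet e f v|) u
        = -|centroDet e f u| * (|centroDet e f u| * pd k (fun v => |centroDet e f v|⁻¹) u) := by
      have : |centroDet e f u| * |centroDet e f u|⁻¹ = 1 := mul_inv_cancel₀ hD'
      linear_combination |centroDet e f u| * h1 - pd k (fun v => |centroDet e f v|) u * this
    rw [h2]
    ring
  rw [fubiniPick, hhd, h.absH_rpow hu]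
  field_simp

end Hypersphere

section HypersphereWithCenter

variable {ι κ : Type*} [Fintype ι] [DecidableEq ι] [Fintype κ] [DecidableEq κ]
variable {U : Set (ι → ℝ)} {u : ι → ℝ} {e : κ ≃ Option ι} {f η : (ι → ℝ) → κ → ℝ}

theorem abs_sign {x : ℝ} (hx : x ≠ 0) : |Real.sign x| = 1 := by
  rcases Real.sign_apply_eq_of_ne_zero x hx with h | h <;> simp [h]

theorem hForm_comm (hU : IsOpen U) (hf : ContDiffOn ℝ ∞ f U) (hu : u ∈ U) (i j : ι) :
    hForm e f η u i j = hForm e f η u j i := by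
  simp only [hForm, Matrix.of_apply, pd_comm hU hu hf i j]

/-- The affine normal is transversal. -/
theorem frameDet_affineNormal [Nonempty ι] (hU : IsOpen U) (hf : ContDiffOn ℝ ∞ f U)
    (hη : ContinuousOn η U) (ht : ∀ v ∈ U, frameDet e (frame f v (η v)) ≠ 0)
    (hnd : ∀ v ∈ U, (hForm e f η v).det ≠ 0) (hu : u ∈ U) :
    frameDet e (frame f u (affineNormal e f η u))
      = Real.sign (frameDet e (frame f u (η u)))
        * absH e f η u ^ ((1 : ℝ) / ((Fintype.card ι : ℝ) + 2)) := by
  set φ : (ι → ℝ) → ℝ := fun v => frameDet e (frame f v (η v)) with hφ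
  have hφc : ContinuousOn φ U := by
    refine Continuous.comp_continuousOn (g := Matrix.det)
      (Continuous.matrix_det continuous_id) ?_
    refine continuousOn_pi.2 fun a => continuousOn_pi.2 fun b => ?_
    cases a with
    | none => exact continuousOn_pi.1 hη (e.symm b)
    | some i => exact continuousOn_pi.1 (contDiffOn_pd hU hf i).continuousOn (e.symm b)
  set V : Set (ι → ℝ) := U ∩ (fun v => φ v * φ u) ⁻¹' Set.Ioi 0 with hV
  have hVo : IsOpen V := (hφc.mul continuousOn_const).isOpen_inter_preimage hU isOpen_Ioi
  have huV : u ∈ V := ⟨hu, mul_self_pos.2 (ht u hu)⟩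
  have hVU : V ⊆ U := Set.inter_subset_left
  have hsign : ∀ v ∈ V, Real.sign (φ v) = Real.sign (φ u) := by
    rintro v ⟨_, hv⟩
    rcases mul_pos_iff.1 (show 0 < φ v * φ u from hv) with ⟨h1, h2⟩ | ⟨h1, h2⟩
    · rw [Real.sign_of_pos h1, Real.sign_of_pos h2]
    · rw [Real.sign_of_neg h1, Real.sign_of_neg h2]
  have hfV := hf.mono hVU
  have hhs : ∀ i j, ContDiffOn ℝ ∞ (fun v => hForm e f η v i j) V := by
    intro i j
    refine ContDiffOn.congr (f := fun v => Real.sign (φ u) * frameDet e (frame f v (pd i (pd j f) v)))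
      (contDiffOn_const.mul (contDiffOn_frameDet e
        (contDiffOn_frame hVo hfV (contDiffOn_pd hVo (contDiffOn_pd hVo hfV j) i)))) ?_
    intro v hv
    rw [← hsign v hv]
    rfl
  have hHs : ContDiffOn ℝ ∞ (absH e f η) V :=
    (contDiffOn_det hhs).abs fun v hv => hnd v (hVU hv)
  have hHpos : ∀ v ∈ U, 0 < absH e f η v := fun v hv => abs_pos.2 (hnd v hv)
  set p : ℝ := -(1 : ℝ) / ((Fintype.card ι : ℝ) + 2) with hp
  have hgs : ∀ i j, ContDiffOn ℝ ∞ (fun v => affineMetric e f η v i j) V := fun i j =>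
    (hHs.rpow_const_of_ne fun v hv => (hHpos v (hVU hv)).ne').mul (hhs i j)
  have hdet : ∀ v ∈ V, (affineMetric e f η v).det ≠ 0 := fun v hv => by
    rw [affineMetric, Matrix.det_smul]
    exact mul_ne_zero (pow_ne_zero _ (Real.rpow_pos_of_pos (hHpos v (hVU hv)) _).ne')
      (hnd v (hVU hv))
  have hn : (Fintype.card ι : ℝ) ≠ 0 := by exact_mod_cast Fintype.card_ne_zero
  have hinv : (affineMetric e f η u)⁻¹ * affineMetric e f η u = 1 :=
    Matrix.nonsing_inv_mul _ (isUnit_iff_ne_zero.2 (hdet u huV))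
  have htu : frameDet e (frame f u (η u)) ≠ 0 := ht u hu
  have h1 : ∀ i j, frameCoord e (frame f u (η u)) (pd i (pd j f) u) none
      = absH e f η u ^ (-p) / |φ u| * affineMetric e f η u j i := by
    intro i j
    have h2 : hForm e f η u i j
        = |φ u| * frameCoord e (frame f u (η u)) (pd i (pd j f) u) none := by
      rw [← sign_mul_self_eq_abs, mul_assoc, ← frameDet_frame e htu]
      rfl
    have h3 : affineMetric e f η u j i = absH e f η u ^ p * hForm e f η u i j := by
      rw [hForm_comm hU hf hu i j]; rfl
    have h4 : absH e f η u ^ (-p) * absH e f η u ^ p = 1 := by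
      rw [← Real.rpow_add (hHpos u hu)]; simp
    have h5 : |φ u| ≠ 0 := abs_ne_zero.2 htu
    rw [h3, h2]
    field_simp
    linear_combination (-frameCoord e (frame f u (η u)) (pd i (pd j f) u) none) * h4
  have h6 : frameCoord e (frame f u (η u)) (affineNormal e f η u) none
      = absH e f η u ^ (-p) / |φ u| := by
    rw [affineNormal, laplacian_eq hVo huV hgs hdet hfV]
    simp only [frameCoord_smul, frameCoord_add, frameCoord_sum, frameCoord_pd e htu, h1]
    have h7 : ∑ i, ∑ j, (affineMetric e f η u)⁻¹ i j * affineMetric e f η u j i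
        = Fintype.card ι := by
      simp only [← Matrix.mul_apply, hinv]
      simp
    have h8 : ∀ i j, (affineMetric e f η u)⁻¹ i j
        * (absH e f η u ^ (-p) / |φ u| * affineMetric e f η u j i)
        = absH e f η u ^ (-p) / |φ u|
          * ((affineMetric e f η u)⁻¹ i j * affineMetric e f η u j i) := fun i j => by ring
    simp only [h8, ← Finset.mul_sum, h7]
    simp
    field_simp
  rw [frameDet_frame e htu, h6, hp, neg_div, neg_neg]
  have h9 := sign_mul_self_eq_abs (φ u)
  have h10 : |φ u| ≠ 0 := abs_ne_zero.2 htu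
  have h11 : |φ u| * |φ u| = φ u * φ u := abs_mul_abs_self _
  change φ u * _ = Real.sign (φ u) * _
  have h12 : φ u / |φ u| = Real.sign (φ u) := by
    rw [div_eq_iff h10]
    apply mul_left_cancel₀ htu
    linear_combination (-1 : ℝ) * h11 + (-|φ u|) * h9
  rw [← h12]
  ring

/-- An affine hypersphere with affine center at the origin has the affine normal `-L f`. -/
theorem affineNormal_of_shape [Nonempty ι] {L : ℝ} (hL : L ≠ 0) (hU : IsOpen U)
    (hf : ContDiffOn ℝ ∞ f U)
    (ht : ∀ v ∈ U, frameDet e (frame f v (affineNormal e f η v)) ≠ 0)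
    (hshape : ∀ v ∈ U, shapeOperator e f η v = L • (1 : Matrix ι ι ℝ))
    (hcenter : ∀ v ∈ U, ∃ s : ℝ, f v + s • affineNormal e f η v = 0) (hu : u ∈ U) :
    affineNormal e f η u = (-L) • f u := by
  obtain ⟨i⟩ := ‹Nonempty ι›
  set ξ := affineNormal e f η with hξ
  have hii : frameCoord e (frame f u (ξ u)) (pd i ξ u) (some i) = -L := by
    have h1 := congrFun (congrFun (hshape u hu) i) i
    simp only [shapeOperator, Matrix.of_apply, Matrix.smul_apply, Matrix.one_apply_eq,
      smul_eq_mul, mul_one] at h1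
    linarith
  have hξd : DifferentiableAt ℝ ξ u := by
    by_contra hnd
    have : pd i ξ u = 0 := by
      unfold pd
      rw [fderiv_zero_of_not_differentiableAt hnd]; rfl
    rw [this] at hii
    simp [frameCoord_apply] at hii
    exact hL hii
  have hξ0 : ∀ v ∈ U, ∑ k, ξ v k * ξ v k ≠ 0 := by
    intro v hv h0
    apply frame_ne_zero e (ht v hv)
    funext k
    have := (Finset.sum_eq_zero_iff_of_nonneg fun k _ => mul_self_nonneg (ξ v k)).1 h0 k
      (Finset.mem_univ k)
    simpa using this
  set s : (ι → ℝ) → ℝ := fun v => -(∑ k, f v k * ξ v k) / ∑ k, ξ v k * ξ v k with hs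
  have hfs : ∀ v ∈ U, f v = (-s v) • ξ v := by
    intro v hv
    obtain ⟨c, hc⟩ := hcenter v hv
    have h1 : f v = (-c) • ξ v := by rw [neg_smul]; exact eq_neg_of_add_eq_zero_left hc
    have h2 : s v = c := by
      rw [hs]
      simp only [h1, Pi.smul_apply, smul_eq_mul, mul_assoc, ← Finset.mul_sum]
      rw [neg_mul, neg_neg, mul_div_cancel_right₀ _ (hξ0 v hv)]
    rw [h2]; exact h1
  have hfd := differentiableAt_of_contDiffOn hU hu hf
  have hsd : DifferentiableAt ℝ (fun v => -s v) u := by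
    refine DifferentiableAt.fun_neg ?_
    rw [hs]
    simp only [div_eq_mul_inv]
    refine DifferentiableAt.fun_mul (DifferentiableAt.fun_neg ?_)
      (DifferentiableAt.fun_inv (h := fun v => ∑ k, ξ v k * ξ v k) ?_ (hξ0 u hu))
    · exact DifferentiableAt.fun_sum fun k _ =>
        (differentiableAt_pi.1 hfd k).fun_mul (differentiableAt_pi.1 hξd k)
    · exact DifferentiableAt.fun_sum fun k _ =>
        (differentiableAt_pi.1 hξd k).fun_mul (differentiableAt_pi.1 hξd k)
  have h3 := frameCoord_pd e (ht u hu) i (some i)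
  rw [pd_congr_on hU hu hfs, pd_smul hsd hξd, frameCoord_add, frameCoord_smul, frameCoord_smul] at h3
  change (-s u) * frameCoord e (frame f u (ξ u)) (pd i ξ u) (some i)
    + _ * frameCoord e (frame f u (ξ u)) (ξ u) (some i) = _ at h3
  rw [hii, frameCoord_last e (ht u hu)] at h3
  simp only [reduceCtorEq, if_false, mul_zero, add_zero, if_true] at h3
  rw [hfs u hu, smul_smul]
  have : -L * -s u = 1 := by linarith
  rw [this, one_smul]

theorem isCentroSphere_of_shape [Nonempty ι] {L : ℝ} (hL : L < 0) (hU : IsOpen U)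
    (hf : ContDiffOn ℝ ∞ f U) (hη : ContinuousOn η U)
    (ht : ∀ v ∈ U, frameDet e (frame f v (η v)) ≠ 0)
    (hnd : ∀ v ∈ U, (hForm e f η v).det ≠ 0)
    (hshape : ∀ v ∈ U, shapeOperator e f η v = L • (1 : Matrix ι ι ℝ))
    (hcenter : ∀ v ∈ U, ∃ s : ℝ, f v + s • affineNormal e f η v = 0) :
    IsCentroSphere e f η U (-1 / L) := by
  have hξ := fun v (hv : v ∈ U) => frameDet_affineNormal hU hf hη ht hnd hv
  have hHpos : ∀ v ∈ U, 0 < absH e f η v := fun v hv => abs_pos.2 (hnd v hv)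
  have hξ0 : ∀ v ∈ U, frameDet e (frame f v (affineNormal e f η v)) ≠ 0 := fun v hv => by
    rw [hξ v hv]
    exact mul_ne_zero (by simpa using Real.sign_eq_zero_iff.not.2 (ht v hv))
      (Real.rpow_pos_of_pos (hHpos v hv) _).ne'
  have hD : ∀ v ∈ U, (-L) * centroDet e f v = Real.sign (frameDet e (frame f v (η v)))
        * absH e f η v ^ ((1 : ℝ) / ((Fintype.card ι : ℝ) + 2)) := by
    intro v hv
    rw [← hξ v hv, affineNormal_of_shape hL.ne hU hf hξ0 hshape hcenter hv,
      frameDet_frame e (ht v hv), frameCoord_smul, centroDet, frameDet_frame e (ht v hv)]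
    ring
  have hD0 : ∀ v ∈ U, centroDet e f v ≠ 0 := by
    intro v hv h0
    have := hD v hv
    rw [h0, mul_zero, ← hξ v hv] at this
    exact hξ0 v hv this.symm
  have hsign : ∀ v ∈ U, Real.sign (frameDet e (frame f v (η v))) = Real.sign (centroDet e f v) := by
    intro v hv
    have h1 := hD v hv
    have h2 := Real.rpow_pos_of_pos (hHpos v hv) ((1 : ℝ) / ((Fintype.card ι : ℝ) + 2))
    rcases lt_or_gt_of_ne (ht v hv) with h | h
    · rw [Real.sign_of_neg h] at h1 ⊢
      rw [Real.sign_of_neg]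
      nlinarith
    · rw [Real.sign_of_pos h] at h1 ⊢
      rw [Real.sign_of_pos]
      nlinarith
  refine ⟨hU, hf, div_pos_of_neg_of_neg (by norm_num) hL, hD0, hsign, fun v hv => ?_⟩
  have h1 : (-L) * |centroDet e f v|
      = absH e f η v ^ ((1 : ℝ) / ((Fintype.card ι : ℝ) + 2)) := by
    have := congrArg abs (hD v hv)
    rwa [abs_mul, abs_mul, abs_sign (ht v hv), one_mul,
      abs_of_pos (Real.rpow_pos_of_pos (hHpos v hv) _), abs_of_pos (by linarith : 0 < -L)] at this
  have h2 : ((-L) * |centroDet e f v|) ^ (Fintype.card ι + 2) = absH e f η v := by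
    rw [h1, ← Real.rpow_natCast, ← Real.rpow_mul (hHpos v hv).le]
    push_cast
    rw [one_div_mul_cancel (by positivity), Real.rpow_one]
  have h3 : 0 < |centroDet e f v| := abs_pos.2 (hD0 v hv)
  rw [absH_eq_centro (hD0 v hv) (hsign v hv), mul_pow, pow_add |centroDet e f v|, sq_abs] at h2
  have h4 : (-L) ^ (Fintype.card ι + 2) * centroDet e f v ^ 2 = |(centroMetric e f v).det| := by
    apply mul_left_cancel₀ (pow_pos h3 (Fintype.card ι)).ne'
    linarith
  rw [← h4, ← mul_assoc, ← mul_pow]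
  have : -1 / L * -L = 1 := by
    have := hL.ne
    field_simp
  rw [this, one_pow, one_mul]

end HypersphereWithCenter

section Weights

variable {r s : ℕ} (n : Fin s → ℕ)

/-- The (one-based) number of a factor of the composition. -/
def compPos : Fin r ⊕ Fin s → ℕ
  | Sum.inl i => (i : ℕ) + 1
  | Sum.inr α => r + (α : ℕ) + 1

/-- The dimension of a factor of the composition, plus one. -/
def compWeight : Fin r ⊕ Fin s → ℝ
  | Sum.inl _ => 1
  | Sum.inr α => (n α : ℝ) + 1

/-- The coefficient of `t_{i+1}` in the exponent `log e_a`. -/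
def compExp (a : Fin r ⊕ Fin s) (i : Fin (r + s - 1)) : ℝ :=
  if (i : ℕ) + 2 = compPos a then -(1 / compWeight n a)
  else if compPos a ≤ (i : ℕ) + 1 then 1 / (fNum r n ((i : ℕ) + 1) : ℝ) else 0

theorem compWeight_pos (a : Fin r ⊕ Fin s) : 0 < compWeight n a := by
  cases a <;> simp only [compWeight] <;> positivity

theorem compPos_eq (a : Fin r ⊕ Fin s) : compPos a = (finSumFinEquiv a : ℕ) + 1 := by
  cases a <;> simp [compPos]

theorem compPos_le (a : Fin r ⊕ Fin s) : compPos a ≤ r + s := by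
  rw [compPos_eq]; omega

theorem compPos_injective : Function.Injective (compPos : Fin r ⊕ Fin s → ℕ) := by
  intro a b h
  rw [compPos_eq, compPos_eq] at h
  exact finSumFinEquiv.injective (Fin.ext (by omega))

/-- The factor number `i + 2`. -/
def compTop (i : Fin (r + s - 1)) : Fin r ⊕ Fin s :=
  finSumFinEquiv.symm ⟨(i : ℕ) + 1, by omega⟩

theorem compPos_compTop (i : Fin (r + s - 1)) : compPos (compTop i : Fin r ⊕ Fin s) = (i : ℕ) + 2 := by
  rw [compPos_eq, compTop, Equiv.apply_symm_apply]

theorem compTop_eq {i : Fin (r + s - 1)} {a : Fin r ⊕ Fin s} (h : (i : ℕ) + 2 = compPos a) :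
    compTop i = a :=
  compPos_injective (by rw [compPos_compTop, h])

theorem sum_compWeight_le {m : ℕ} (hm : m ≤ r + s) :
    ∑ a : Fin r ⊕ Fin s, (if compPos a ≤ m then compWeight n a else 0) = (fNum r n m : ℝ) := by
  have h1 : ∑ a : Fin r ⊕ Fin s, (if compPos a ≤ m then (1 : ℝ) else 0) = m := by
    simp only [compPos_eq]
    rw [Equiv.sum_comp finSumFinEquiv (fun b : Fin (r + s) => if (b : ℕ) + 1 ≤ m then (1 : ℝ) else 0),
      Fin.sum_univ_eq_sum_range (fun b => if b + 1 ≤ m then (1 : ℝ) else 0) (r + s),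
      Finset.sum_ite, Finset.sum_const_zero, add_zero, Finset.sum_const, nsmul_one]
    congr 1
    have : (Finset.range (r + s)).filter (fun b => b + 1 ≤ m) = Finset.range m := by
      ext b; simp; omega
    rw [this, Finset.card_range]
  have h2 : ∀ a : Fin r ⊕ Fin s, (if compPos a ≤ m then compWeight n a else 0)
      = (if compPos a ≤ m then (1 : ℝ) else 0)
        + Sum.elim (fun _ : Fin r => (0 : ℝ)) (fun β : Fin s => if r + (β : ℕ) + 1 ≤ m then (n β : ℝ) else 0) a := by
    intro a
    cases a with
    | inl i => simp [compWeight]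
    | inr α =>
      by_cases h : r + (α : ℕ) + 1 ≤ m
      · have h' : compPos (Sum.inr α : Fin r ⊕ Fin s) ≤ m := h
        simp only [compWeight, Sum.elim_inr, if_pos h, if_pos h']; ring
      · have h' : ¬ compPos (Sum.inr α : Fin r ⊕ Fin s) ≤ m := h
        simp only [Sum.elim_inr, if_neg h, if_neg h']; ring
  simp only [h2, Finset.sum_add_distrib, h1]
  simp [fNum]

theorem sum_compWeight : ∑ a : Fin r ⊕ Fin s, compWeight n a = (fNum r n (r + s) : ℝ) := by
  rw [← sum_compWeight_le n le_rfl]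
  simp [compPos_le]

theorem fNum_top (hK : 2 ≤ r + s) : (fNum r n (r + s) : ℝ) = (compDim r n : ℝ) + 1 := by
  have h : ∀ β : Fin s, r + (β : ℕ) + 1 ≤ r + s := fun β => by omega
  have : fNum r n (r + s) = compDim r n + 1 := by
    simp only [fNum, compDim, h, if_true]
    omega
  rw [this]; push_cast; ring

theorem fNum_pos {m : ℕ} (hm : 0 < m) : 0 < (fNum r n m : ℝ) := by
  have : 0 < fNum r n m := by unfold fNum; omega
  exact_mod_cast this

theorem compExp_of_le {a : Fin r ⊕ Fin s} {i : Fin (r + s - 1)} (h : compPos a ≤ (i : ℕ) + 1) :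
    compExp n a i = 1 / (fNum r n ((i : ℕ) + 1) : ℝ) := by
  rw [compExp, if_neg (by omega), if_pos h]

theorem compExp_of_eq {a : Fin r ⊕ Fin s} {i : Fin (r + s - 1)} (h : (i : ℕ) + 2 = compPos a) :
    compExp n a i = -(1 / compWeight n a) := by
  rw [compExp, if_pos h]

theorem compExp_of_lt {a : Fin r ⊕ Fin s} {i : Fin (r + s - 1)} (h : (i : ℕ) + 2 < compPos a) :
    compExp n a i = 0 := by
  rw [compExp, if_neg (by omega), if_neg (by omega)]

theorem compExp_compTop (i : Fin (r + s - 1)) :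
    compExp n (compTop i) i = -(1 / compWeight n (compTop i)) :=
  compExp_of_eq n (compPos_compTop i).symm

theorem compExp_compTop_of_lt {i j : Fin (r + s - 1)} (h : i < j) :
    compExp n (compTop i) j = 1 / (fNum r n ((j : ℕ) + 1) : ℝ) :=
  compExp_of_le n (by rw [compPos_compTop]; have : (i : ℕ) < j := h; omega)

/-- Pairing `log e_i` with a function which is constant on the factors number `1, …, i + 1`. -/
theorem sum_compExp_mul (i : Fin (r + s - 1)) {F : Fin r ⊕ Fin s → ℝ} {c : ℝ}
    (hF : ∀ a, compPos a ≤ (i : ℕ) + 1 → F a = c) :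
    ∑ a, compWeight n a * compExp n a i * F a = c - F (compTop i) := by
  have hf := (fNum_pos (r := r) n (Nat.succ_pos (i : ℕ))).ne'
  have h1 : ∀ a : Fin r ⊕ Fin s, compWeight n a * compExp n a i * F a
      = (if compPos a ≤ (i : ℕ) + 1 then compWeight n a else 0)
          * (c / (fNum r n ((i : ℕ) + 1) : ℝ)) + (if a = compTop i then -F a else 0) := by
    intro a
    have hw := (compWeight_pos n a).ne'
    rcases lt_trichotomy (compPos a) ((i : ℕ) + 2) with h | h | h
    · have hne : a ≠ compTop i := by rintro rfl; rw [compPos_compTop] at h; omega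
      rw [compExp_of_le n (by omega), if_pos (by omega), if_neg hne, hF a (by omega)]
      ring
    · rw [compExp_of_eq n h.symm, if_neg (by omega), if_pos (compTop_eq h.symm).symm]
      field_simp
      ring
    · have hne : a ≠ compTop i := by rintro rfl; rw [compPos_compTop] at h; omega
      rw [compExp_of_lt n h, if_neg (by omega), if_neg hne]
      ring
  simp only [h1, Finset.sum_add_distrib, ← Finset.sum_mul,
    sum_compWeight_le n (show (i : ℕ) + 1 ≤ r + s by omega)]
  rw [Finset.sum_ite_eq' Finset.univ (compTop i), if_pos (Finset.mem_univ _),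
    mul_div_cancel₀ _ hf]
  ring

theorem sum_compExp (i : Fin (r + s - 1)) : ∑ a, compWeight n a * compExp n a i = 0 := by
  have := sum_compExp_mul n i (F := fun _ => 1) (c := 1) (fun _ _ => rfl)
  simpa using this

theorem sum_compExp_mul_of_lt {i j : Fin (r + s - 1)} (h : i < j) :
    ∑ a, compWeight n a * compExp n a i * compExp n a j = 0 := by
  rw [sum_compExp_mul n i (c := 1 / (fNum r n ((j : ℕ) + 1) : ℝ)), compExp_compTop_of_lt n h,
    sub_self]
  intro a ha
  have : (i : ℕ) < j := h
  exact compExp_of_le n (by omega)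

theorem sum_compExp_mul_of_ne {i j : Fin (r + s - 1)} (h : i ≠ j) :
    ∑ a, compWeight n a * compExp n a i * compExp n a j = 0 := by
  rcases lt_or_gt_of_ne h with h | h
  · exact sum_compExp_mul_of_lt n h
  · rw [← sum_compExp_mul_of_lt n h]
    exact Finset.sum_congr rfl fun a _ => by ring

/-- The square of the norm of `log e_i` with respect to the weights. -/
def compNorm (i : Fin (r + s - 1)) : ℝ :=
  1 / (fNum r n ((i : ℕ) + 1) : ℝ) + 1 / compWeight n (compTop i)

theorem compNorm_pos (i : Fin (r + s - 1)) : 0 < compNorm n i := by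
  have h1 := fNum_pos (r := r) n (Nat.succ_pos (i : ℕ))
  have h2 := compWeight_pos n (compTop i)
  unfold compNorm
  positivity

theorem sum_compExp_mul_self (i : Fin (r + s - 1)) :
    ∑ a, compWeight n a * compExp n a i * compExp n a i = compNorm n i := by
  rw [sum_compExp_mul n i (c := 1 / (fNum r n ((i : ℕ) + 1) : ℝ)) fun a ha => compExp_of_le n ha,
    compExp_compTop, compNorm]
  ring

/-- The symmetric trilinear form `∑ w ℓ_i ℓ_j ℓ_k`. -/
def compTriple (i j k : Fin (r + s - 1)) : ℝ :=
  ∑ a, compWeight n a * compExp n a i * (compExp n a j * compExp n a k)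

theorem compTriple_comm (i j k : Fin (r + s - 1)) : compTriple n i j k = compTriple n j i k :=
  Finset.sum_congr rfl fun a _ => by ring

theorem compTriple_comm' (i j k : Fin (r + s - 1)) : compTriple n i j k = compTriple n i k j :=
  Finset.sum_congr rfl fun a _ => by ring

theorem compTriple_self (i : Fin (r + s - 1)) :
    compTriple n i i i
      = 1 / (fNum r n ((i : ℕ) + 1) : ℝ) ^ 2 - 1 / compWeight n (compTop i) ^ 2 := by
  rw [compTriple, sum_compExp_mul n i (F := fun a => compExp n a i * compExp n a i)
    (c := 1 / (fNum r n ((i : ℕ) + 1) : ℝ) ^ 2), compExp_compTop]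
  · ring
  · intro a ha
    rw [compExp_of_le n ha]
    ring

theorem compTriple_of_lt {i j : Fin (r + s - 1)} (h : i < j) :
    compTriple n i i j = compNorm n i / (fNum r n ((j : ℕ) + 1) : ℝ) := by
  rw [compTriple, sum_compExp_mul n i (F := fun a => compExp n a i * compExp n a j)
    (c := 1 / (fNum r n ((i : ℕ) + 1) : ℝ) * (1 / (fNum r n ((j : ℕ) + 1) : ℝ))), compExp_compTop,
    compExp_compTop_of_lt n h, compNorm]
  · ring
  · intro a ha
    have : (i : ℕ) < j := h
    rw [compExp_of_le n ha, compExp_of_le n (by omega)]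

theorem compTriple_eq_zero {i j k : Fin (r + s - 1)} (hj : i < j) (hk : i < k) :
    compTriple n i j k = 0 := by
  rw [compTriple, sum_compExp_mul n i (F := fun a => compExp n a j * compExp n a k)
    (c := 1 / (fNum r n ((j : ℕ) + 1) : ℝ) * (1 / (fNum r n ((k : ℕ) + 1) : ℝ))),
    compExp_compTop_of_lt n hj, compExp_compTop_of_lt n hk, sub_self]
  intro a ha
  have h1 : (i : ℕ) < j := hj
  have h2 : (i : ℕ) < k := hk
  rw [compExp_of_le n (by omega), compExp_of_le n (by omega)]

theorem compTriple_of_ne {i j k : Fin (r + s - 1)} (hij : i ≠ j) (hjk : j ≠ k) (hik : i ≠ k) :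
    compTriple n i j k = 0 := by
  rcases lt_or_gt_of_ne hij with h1 | h1 <;> rcases lt_or_gt_of_ne hjk with h2 | h2
  · exact compTriple_eq_zero n h1 (h1.trans h2)
  · rcases lt_or_gt_of_ne hik with h3 | h3
    · exact compTriple_eq_zero n h1 h3
    · rw [compTriple_comm', compTriple_comm]
      exact compTriple_eq_zero n h3 h2
  · rw [compTriple_comm]
    exact compTriple_eq_zero n h1 h2
  · rw [compTriple_comm', compTriple_comm]
    exact compTriple_eq_zero n (h2.trans h1) h2

/-- The orthogonal expansion of a function on the set of factors. -/
theorem sum_compExp_expansion (hK : 2 ≤ r + s) (v : Fin r ⊕ Fin s → ℝ) (a : Fin r ⊕ Fin s) :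
    v a = ∑ i, (∑ b, compWeight n b * compExp n b i * v b) / compNorm n i * compExp n a i
      + (∑ b, compWeight n b * v b) / ((compDim r n : ℝ) + 1) := by
  have hN := sum_compWeight (r := r) n
  rw [fNum_top n hK] at hN
  have hN0 : (compDim r n : ℝ) + 1 ≠ 0 := by positivity
  let A : Matrix (Option (Fin (r + s - 1))) (Fin r ⊕ Fin s) ℝ := Matrix.of fun x b =>
    x.elim (compWeight n b / ((compDim r n : ℝ) + 1))
      fun i => compWeight n b * compExp n b i / compNorm n i
  let B : Matrix (Fin r ⊕ Fin s) (Option (Fin (r + s - 1))) ℝ := Matrix.of fun b x =>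
    x.elim 1 fun i => compExp n b i
  have hAB : A * B = 1 := by
    ext x y
    rw [Matrix.mul_apply]
    cases x with
    | none =>
      cases y with
      | none =>
        simp only [A, B, Matrix.of_apply, Option.elim, mul_one, ← Finset.sum_div, hN,
          Matrix.one_apply_eq, div_self hN0]
      | some j =>
        simp only [A, B, Matrix.of_apply, Option.elim, div_mul_eq_mul_div, ← Finset.sum_div,
          sum_compExp, zero_div]
        simp
    | some i =>
      cases y with
      | none =>
        simp only [A, B, Matrix.of_apply, Option.elim, mul_one, ← Finset.sum_div,
          sum_compExp, zero_div]
        simp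
      | some j =>
        simp only [A, B, Matrix.of_apply, Option.elim, div_mul_eq_mul_div, ← Finset.sum_div]
        by_cases hij : i = j
        · subst hij
          rw [sum_compExp_mul_self, div_self (compNorm_pos n i).ne', Matrix.one_apply_eq]
        · rw [sum_compExp_mul_of_ne n hij, zero_div, Matrix.one_apply_ne (by simpa using hij)]
  have hBA : B * A = 1 := by
    refine (Matrix.mul_eq_one_comm_of_card_eq _ _ _ ?_).1 hAB
    simp only [Fintype.card_option, Fintype.card_fin, Fintype.card_sum]
    omega
  have h1 : B.mulVec (A.mulVec v) = v := by rw [Matrix.mulVec_mulVec, hBA, Matrix.one_mulVec]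
  have h2 := congrFun h1 a
  rw [← h2]
  simp only [Matrix.mulVec, dotProduct, Fintype.sum_option]
  simp only [A, B, Matrix.of_apply, Option.elim, Finset.sum_div]
  rw [one_mul, add_comm]
  congr 1
  · refine Finset.sum_congr rfl fun i _ => ?_
    rw [mul_comm]
    congr 1
    exact Finset.sum_congr rfl fun b _ => by ring
  · exact Finset.sum_congr rfl fun b _ => by ring

theorem fNum_partialSum (α : Fin s) : (fNum r n (r + (α : ℕ) + 1) : ℝ) = partialSum r n α := by
  simp only [fNum, partialSum]
  push_cast
  rw [add_comm, ← Finset.sum_filter]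
  congr 2
  ext β
  simp only [Finset.mem_filter, Finset.mem_univ, true_and, Finset.mem_Iic, Fin.le_def]
  omega

theorem fNum_of_le {m : ℕ} (hm : m ≤ r) : fNum r n m = m := by
  have h : ∀ β : Fin s, ¬ (r + (β : ℕ) + 1 ≤ m) := fun β => by omega
  simp [fNum, h]

theorem partialSum_succ {α β : Fin s} (h : (β : ℕ) = (α : ℕ) + 1) :
    partialSum r n β = partialSum r n α + ((n β : ℝ) + 1) := by
  have : Finset.Iic β = insert β (Finset.Iic α) := by
    ext γ
    simp only [Finset.mem_insert, Finset.mem_Iic, Fin.le_def, Fin.ext_iff]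
    omega
  have hβ : β ∉ Finset.Iic α := by
    simp only [Finset.mem_Iic, Fin.le_def]
    omega
  rw [partialSum, partialSum, this, Finset.sum_insert hβ, h]
  push_cast
  ring

end Weights

section BlockDeterminant

theorem det_sigma {s : ℕ} {m : Fin s → Type*} [∀ α, Fintype (m α)] [∀ α, DecidableEq (m α)]
    (M : Matrix (Σ α, m α) (Σ α, m α) ℝ)
    (hM : ∀ α β (i : m α) (j : m β), α ≠ β → M ⟨α, i⟩ ⟨β, j⟩ = 0) :
    M.det = ∏ α, (Matrix.of fun i j => M ⟨α, i⟩ ⟨α, j⟩).det := by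
  have hb : M.BlockTriangular Sigma.fst := by
    rintro ⟨α, i⟩ ⟨β, j⟩ h
    exact hM α β i j (ne_of_gt h)
  rw [hb.det_fintype]
  refine Finset.prod_congr rfl fun α _ => ?_
  let E : m α ≃ {x : Σ α, m α // x.1 = α} :=
    { toFun := fun i => ⟨⟨α, i⟩, rfl⟩
      invFun := fun x => x.2 ▸ x.1.2
      left_inv := fun _ => rfl
      right_inv := by rintro ⟨⟨β, i⟩, rfl⟩; rfl }
  rw [← Matrix.det_submatrix_equiv_self E]
  rfl

theorem det_sum_sigma {l : Type*} [Fintype l] [DecidableEq l] {s : ℕ} {m : Fin s → Type*}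
    [∀ α, Fintype (m α)] [∀ α, DecidableEq (m α)]
    (M : Matrix (l ⊕ Σ α, m α) (l ⊕ Σ α, m α) ℝ) (d : l → ℝ)
    (hl : ∀ i j, M (Sum.inl i) (Sum.inl j) = if i = j then d i else 0)
    (hrl : ∀ x i, M (Sum.inr x) (Sum.inl i) = 0)
    (hM : ∀ α β (i : m α) (j : m β), α ≠ β → M (Sum.inr ⟨α, i⟩) (Sum.inr ⟨β, j⟩) = 0) :
    M.det = (∏ i, d i)
      * ∏ α, (Matrix.of fun i j => M (Sum.inr ⟨α, i⟩) (Sum.inr ⟨α, j⟩)).det := by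
  have h0 : M.toBlocks₂₁ = 0 := by
    ext x i
    exact hrl x i
  have h1 : M.toBlocks₁₁ = Matrix.diagonal d := by
    ext i j
    rw [Matrix.diagonal_apply]
    exact hl i j
  rw [← Matrix.fromBlocks_toBlocks M, h0, h1, Matrix.det_fromBlocks_zero₂₁, Matrix.det_diagonal,
    det_sigma _ (fun α β i j h => hM α β i j h)]
  rfl

end BlockDeterminant

section LocalComposition

variable {r s : ℕ} (n : Fin s → ℕ) (c : Fin r ⊕ Fin s → ℝ)

/-- The embedding of the ambient space of a factor. -/
def blockEmb (α : Fin s) : (Fin (n α + 1) → ℝ) →L[ℝ] (AmbIdx r n → ℝ) :=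
  ∑ k, (ContinuousLinearMap.proj (R := ℝ) (φ := fun _ : Fin (n α + 1) => ℝ) k).smulRight
    (Pi.single (Sum.inr ⟨α, k⟩) 1)

/-- The projection of the coordinate space to that of a factor. -/
def blockCoord (α : Fin s) : (CompIdx r n → ℝ) →L[ℝ] (Fin (n α) → ℝ) :=
  ContinuousLinearMap.pi fun k => ContinuousLinearMap.proj (Sum.inr ⟨α, k⟩)

/-- The function `c_a e_a`. -/
def compScale (a : Fin r ⊕ Fin s) (u : CompIdx r n → ℝ) : ℝ :=
  c a * Real.exp (∑ i, compExp n a i * u (Sum.inl i))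

/-- The vector field `c_α e_α Y(v_α)` in the ambient space of a factor. -/
def blockLift (α : Fin s) (Y : (Fin (n α) → ℝ) → Fin (n α + 1) → ℝ) (u : CompIdx r n → ℝ) :
    AmbIdx r n → ℝ :=
  compScale n c (Sum.inr α) u • blockEmb n α (Y (blockCoord n α u))

/-- The component of the composition in the ambient space of a factor. -/
def compPart (y : ∀ α, (Fin (n α) → ℝ) → Fin (n α + 1) → ℝ) (u : CompIdx r n → ℝ) :
    Fin r ⊕ Fin s → AmbIdx r n → ℝ
  | Sum.inl i => compScale n c (Sum.inl i) u • Pi.single (Sum.inl i) 1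
  | Sum.inr α => blockLift n c α (y α) u

/-- The composition in local coordinates. -/
def localComp (y : ∀ α, (Fin (n α) → ℝ) → Fin (n α + 1) → ℝ) (u : CompIdx r n → ℝ) :
    AmbIdx r n → ℝ :=
  ∑ a, compPart n c y u a

variable {n c} {y : ∀ α, (Fin (n α) → ℝ) → Fin (n α + 1) → ℝ} {u : CompIdx r n → ℝ}

theorem blockEmb_apply (α : Fin s) (v : Fin (n α + 1) → ℝ) (m : AmbIdx r n) :
    blockEmb n α v m = ∑ k, if m = Sum.inr ⟨α, k⟩ then v k else 0 := by
  simp [blockEmb, Pi.single_apply]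

theorem blockEmb_inl (α : Fin s) (v : Fin (n α + 1) → ℝ) (i : Fin r) :
    blockEmb n α v (Sum.inl i) = 0 := by
  simp [blockEmb_apply]

theorem blockEmb_inr_self (α : Fin s) (v : Fin (n α + 1) → ℝ) (k : Fin (n α + 1)) :
    blockEmb n α v (Sum.inr ⟨α, k⟩ : AmbIdx r n) = v k := by
  simp [blockEmb_apply]

theorem blockEmb_inr_of_ne {α β : Fin s} (h : α ≠ β) (v : Fin (n α + 1) → ℝ)
    (k : Fin (n β + 1)) : blockEmb n α v (Sum.inr ⟨β, k⟩ : AmbIdx r n) = 0 := by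
  simp [blockEmb_apply, Ne.symm h]

theorem contDiff_compScale (a : Fin r ⊕ Fin s) : ContDiff ℝ ∞ (compScale n c a) := by
  unfold compScale
  fun_prop

theorem pd_compScale (a : Fin r ⊕ Fin s) (x : CompIdx r n) :
    pd x (compScale n c a) u
      = Sum.elim (fun i => compExp n a i) (fun _ => 0) x * compScale n c a u := by
  have h1 : ∀ i, DifferentiableAt ℝ (fun v : CompIdx r n → ℝ => compExp n a i * v (Sum.inl i)) u :=
    fun i => by fun_prop
  have h2 : ∀ z : CompIdx r n, pd x (fun v : CompIdx r n → ℝ => v z) u = if z = x then 1 else 0 := by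
    intro z
    unfold pd
    rw [fderiv_apply differentiableAt_fun_id]
    simp [Pi.single_apply]
  have h3 : pd x (fun v : CompIdx r n → ℝ => ∑ i, compExp n a i * v (Sum.inl i)) u
      = Sum.elim (fun i => compExp n a i) (fun _ => 0) x := by
    rw [pd_sum _ fun i _ => h1 i]
    simp only [fun i => pd_const_mul (u := u) (F := fun v : CompIdx r n → ℝ => v (Sum.inl i))
      (by fun_prop) (compExp n a i) x, h2]
    cases x <;> simp
  unfold compScale
  rw [pd_const_mul (by fun_prop), pd_comp_real (DifferentiableAt.fun_sum fun i _ => h1 i)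
    (Real.hasDerivAt_exp _), h3]
  ring

theorem blockCoord_single_inl (α : Fin s) (i : Fin (r + s - 1)) :
    blockCoord n α (Pi.single (Sum.inl i) 1) = 0 := by
  ext k; simp [blockCoord]

theorem blockCoord_single_inr_self (α : Fin s) (j : Fin (n α)) :
    blockCoord (r := r) n α (Pi.single (Sum.inr ⟨α, j⟩) 1) = Pi.single j 1 := by
  ext k; simp [blockCoord, Pi.single_apply]

theorem blockCoord_single_inr_of_ne {α β : Fin s} (h : α ≠ β) (j : Fin (n β)) :
    blockCoord (r := r) n α (Pi.single (Sum.inr ⟨β, j⟩) 1) = 0 := by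
  ext k; simp [blockCoord, h]

theorem pd_comp_blockCoord {E : Type*} [NormedAddCommGroup E] [NormedSpace ℝ E] {α : Fin s}
    {Y : (Fin (n α) → ℝ) → E} (hY : DifferentiableAt ℝ Y (blockCoord n α u)) (x : CompIdx r n) :
    pd x (fun v => Y (blockCoord n α v)) u
      = fderiv ℝ Y (blockCoord n α u) (blockCoord n α (Pi.single x 1)) := by
  unfold pd
  have := (hY.hasFDerivAt.comp u (blockCoord n α).hasFDerivAt).fderiv
  rw [Function.comp_def] at this
  rw [this]; rfl

theorem differentiableAt_comp_blockCoord {E : Type*} [NormedAddCommGroup E] [NormedSpace ℝ E]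
    {α : Fin s} {Y : (Fin (n α) → ℝ) → E} (hY : DifferentiableAt ℝ Y (blockCoord n α u)) :
    DifferentiableAt ℝ (fun v => Y (blockCoord n α v)) u :=
  hY.comp u (blockCoord n α).differentiableAt

variable {α : Fin s} {Y : (Fin (n α) → ℝ) → Fin (n α + 1) → ℝ}

theorem pd_blockLift (hY : DifferentiableAt ℝ Y (blockCoord n α u)) (x : CompIdx r n) :
    pd x (blockLift n c α Y) u = compScale n c (Sum.inr α) u • blockEmb n α
        (fderiv ℝ Y (blockCoord n α u) (blockCoord n α (Pi.single x 1)))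
      + Sum.elim (fun i => compExp n (Sum.inr α) i) (fun _ => 0) x • blockLift n c α Y u := by
  have h0 := differentiableAt_comp_blockCoord hY
  have h1 : DifferentiableAt ℝ (fun v => blockEmb (r := r) n α (Y (blockCoord n α v))) u :=
    (blockEmb n α).differentiableAt.comp u h0
  have h2 : pd x (fun v => blockEmb (r := r) n α (Y (blockCoord n α v))) u
      = blockEmb n α (pd x (fun v => Y (blockCoord n α v)) u) := by
    unfold pd
    have := ((blockEmb (r := r) n α).hasFDerivAt.comp u h0.hasFDerivAt).fderiv
    rw [Function.comp_def] at this
    rw [this]; rfl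
  unfold blockLift
  rw [pd_smul ((contDiff_compScale _).differentiable (by simp) u) h1, h2, pd_comp_blockCoord hY,
    pd_compScale, smul_smul]

theorem pd_blockLift_inl (hY : DifferentiableAt ℝ Y (blockCoord n α u)) (i : Fin (r + s - 1)) :
    pd (Sum.inl i) (blockLift n c α Y) u = compExp n (Sum.inr α) i • blockLift n c α Y u := by
  rw [pd_blockLift hY, blockCoord_single_inl]
  simp

theorem pd_blockLift_inr_self (hY : DifferentiableAt ℝ Y (blockCoord n α u)) (j : Fin (n α)) :
    pd (Sum.inr ⟨α, j⟩) (blockLift n c α Y) u = blockLift n c α (pd j Y) u := by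
  rw [pd_blockLift hY, blockCoord_single_inr_self]
  simp [blockLift, pd]

theorem pd_blockLift_inr_of_ne (hY : DifferentiableAt ℝ Y (blockCoord n α u)) {β : Fin s}
    (h : α ≠ β) (j : Fin (n β)) : pd (Sum.inr ⟨β, j⟩) (blockLift n c α Y) u = 0 := by
  rw [pd_blockLift hY, blockCoord_single_inr_of_ne h]
  simp

theorem contDiffOn_blockLift {V : Set (Fin (n α) → ℝ)} (hY : ContDiffOn ℝ ∞ Y V)
    {W : Set (CompIdx r n → ℝ)} (hW : ∀ u ∈ W, blockCoord n α u ∈ V) :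
    ContDiffOn ℝ ∞ (blockLift n c α Y) W :=
  (contDiff_compScale _).contDiffOn.smul ((blockEmb n α).contDiff.comp_contDiffOn
    (hY.comp (blockCoord n α).contDiff.contDiffOn hW))

end LocalComposition

section LocalCompositionDerivatives

variable {r s : ℕ} {n : Fin s → ℕ} {c : Fin r ⊕ Fin s → ℝ}
variable {y : ∀ α, (Fin (n α) → ℝ) → Fin (n α + 1) → ℝ} {u : CompIdx r n → ℝ}
variable {U : ∀ α, Set (Fin (n α) → ℝ)}

/-- The domain of the composition in local coordinates. -/
def compDomain (r : ℕ) {s : ℕ} {n : Fin s → ℕ} (U : ∀ α, Set (Fin (n α) → ℝ)) :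
    Set (CompIdx r n → ℝ) :=
  {u | ∀ α, blockCoord n α u ∈ U α}

theorem isOpen_compDomain (hU : ∀ α, IsOpen (U α)) : IsOpen (compDomain r U) := by
  simp only [compDomain, Set.ofPred_forall]
  exact isOpen_iInter_of_finite fun α => (hU α).preimage (blockCoord n α).continuous

theorem contDiffOn_compPart (hy : ∀ α, ContDiffOn ℝ ∞ (y α) (U α)) (a : Fin r ⊕ Fin s) :
    ContDiffOn ℝ ∞ (fun v => compPart n c y v a) (compDomain r U) := by
  cases a with
  | inl i => exact (contDiff_compScale _).contDiffOn.smul contDiffOn_const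
  | inr α => exact contDiffOn_blockLift (hy α) fun u hu => hu α

theorem contDiffOn_localComp (hy : ∀ α, ContDiffOn ℝ ∞ (y α) (U α)) :
    ContDiffOn ℝ ∞ (localComp n c y) (compDomain r U) :=
  ContDiffOn.sum fun a _ => contDiffOn_compPart hy a

variable (hU : ∀ α, IsOpen (U α)) (hy : ∀ α, ContDiffOn ℝ ∞ (y α) (U α)) (hu : u ∈ compDomain r U)
include hU hy hu

theorem differentiableAt_compPart (a : Fin r ⊕ Fin s) :
    DifferentiableAt ℝ (fun v => compPart n c y v a) u :=
  differentiableAt_of_contDiffOn (isOpen_compDomain hU) hu (contDiffOn_compPart hy a)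

theorem pd_compPart_inl (a : Fin r ⊕ Fin s) (i : Fin (r + s - 1)) :
    pd (Sum.inl i) (fun v => compPart n c y v a) u = compExp n a i • compPart n c y u a := by
  cases a with
  | inl j =>
    simp only [compPart]
    rw [pd_smul ((contDiff_compScale _).differentiable (by simp) u) (differentiableAt_const _),
      pd_const, pd_compScale]
    simp [smul_smul]
  | inr α => exact pd_blockLift_inl (differentiableAt_of_contDiffOn (hU α) (hu α) (hy α)) i

theorem pd_compPart_inr (a : Fin r ⊕ Fin s) (α : Fin s) (j : Fin (n α)) :
    pd (Sum.inr ⟨α, j⟩) (fun v => compPart n c y v a) u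
      = if a = Sum.inr α then blockLift n c α (pd j (y α)) u else 0 := by
  cases a with
  | inl k =>
    simp only [compPart]
    rw [pd_smul ((contDiff_compScale _).differentiable (by simp) u) (differentiableAt_const _),
      pd_const, pd_compScale]
    simp
  | inr β =>
    have hd := differentiableAt_of_contDiffOn (hU β) (hu β) (hy β)
    by_cases h : β = α
    · subst h
      rw [if_pos rfl]
      exact pd_blockLift_inr_self hd j
    · rw [if_neg (by simpa using h)]
      exact pd_blockLift_inr_of_ne hd h j

theorem pd_localComp_inl (i : Fin (r + s - 1)) :
    pd (Sum.inl i) (localComp n c y) u = ∑ a, compExp n a i • compPart n c y u a := by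
  unfold localComp
  rw [pd_sum _ fun a _ => differentiableAt_compPart hU hy hu a]
  exact Finset.sum_congr rfl fun a _ => pd_compPart_inl hU hy hu a i

theorem pd_localComp_inr (α : Fin s) (j : Fin (n α)) :
    pd (Sum.inr ⟨α, j⟩) (localComp n c y) u = blockLift n c α (pd j (y α)) u := by
  unfold localComp
  rw [pd_sum _ fun a _ => differentiableAt_compPart hU hy hu a]
  simp only [pd_compPart_inr hU hy hu]
  simp

theorem pd_pd_localComp_inl_inl (i j : Fin (r + s - 1)) :
    pd (Sum.inl i) (pd (Sum.inl j) (localComp n c y)) u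
      = ∑ a, (compExp n a i * compExp n a j) • compPart n c y u a := by
  rw [pd_congr_on (isOpen_compDomain hU) hu (fun v hv => pd_localComp_inl hU hy hv j),
    pd_sum Finset.univ (F := fun a v => compExp n a j • compPart n c y v a)
      fun a _ => (differentiableAt_compPart hU hy hu a).fun_const_smul _]
  refine Finset.sum_congr rfl fun a _ => ?_
  rw [pd_const_smul (differentiableAt_compPart hU hy hu a), pd_compPart_inl hU hy hu, smul_smul,
    mul_comm]

theorem pd_pd_localComp_inl_inr (i : Fin (r + s - 1)) (α : Fin s) (k : Fin (n α)) :
    pd (Sum.inl i) (pd (Sum.inr ⟨α, k⟩) (localComp n c y)) u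
      = compExp n (Sum.inr α) i • pd (Sum.inr ⟨α, k⟩) (localComp n c y) u := by
  rw [pd_congr_on (isOpen_compDomain hU) hu (fun v hv => pd_localComp_inr hU hy hv α k),
    pd_localComp_inr hU hy hu]
  exact pd_blockLift_inl
    (differentiableAt_of_contDiffOn (hU α) (hu α) (contDiffOn_pd (hU α) (hy α) k)) i

theorem pd_pd_localComp_inr_of_ne {α β : Fin s} (h : α ≠ β) (k : Fin (n α)) (l : Fin (n β)) :
    pd (Sum.inr ⟨α, k⟩) (pd (Sum.inr ⟨β, l⟩) (localComp n c y)) u = 0 := by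
  rw [pd_congr_on (isOpen_compDomain hU) hu (fun v hv => pd_localComp_inr hU hy hv β l)]
  exact pd_blockLift_inr_of_ne
    (differentiableAt_of_contDiffOn (hU β) (hu β) (contDiffOn_pd (hU β) (hy β) l)) h.symm k

theorem pd_pd_localComp_inr_self {α : Fin s} 
    (hD : centroDet finSuccEquivLast (y α) (blockCoord n α u) ≠ 0) (k l : Fin (n α)) :
    pd (Sum.inr ⟨α, k⟩) (pd (Sum.inr ⟨α, l⟩) (localComp n c y)) u
      = ∑ m, centroConn finSuccEquivLast (y α) (blockCoord n α u) m k l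
            • pd (Sum.inr ⟨α, m⟩) (localComp n c y) u
        + centroMetric finSuccEquivLast (y α) (blockCoord n α u) k l
            • compPart n c y u (Sum.inr α) := by
  rw [pd_congr_on (isOpen_compDomain hU) hu (fun v hv => pd_localComp_inr hU hy hv α l)]
  refine (pd_blockLift_inr_self
    (differentiableAt_of_contDiffOn (hU α) (hu α) (contDiffOn_pd (hU α) (hy α) l)) k).trans ?_
  simp only [pd_localComp_inr hU hy hu]
  simp only [blockLift, compPart, centro_gauss hD k l, map_add, map_sum, map_smul, smul_add,
    Finset.smul_sum]
  congr 1
  · exact Finset.sum_congr rfl fun m _ => smul_comm _ _ _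
  · exact smul_comm _ _ _

theorem sum_smul_compPart (hK : 2 ≤ r + s) (v : Fin r ⊕ Fin s → ℝ) :
    ∑ a, v a • compPart n c y u a
      = ∑ i, ((∑ b, compWeight n b * compExp n b i * v b) / compNorm n i)
            • pd (Sum.inl i) (localComp n c y) u
        + ((∑ b, compWeight n b * v b) / ((compDim r n : ℝ) + 1)) • localComp n c y u := by
  simp only [pd_localComp_inl hU hy hu, localComp, Finset.smul_sum, smul_smul]
  rw [Finset.sum_comm, ← Finset.sum_add_distrib]
  refine Finset.sum_congr rfl fun a _ => ?_
  rw [← Finset.sum_smul, ← add_smul, ← sum_compExp_expansion n hK v a]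

end LocalCompositionDerivatives

section LocalCompositionInvariants

variable {r s : ℕ} {n : Fin s → ℕ} {c : Fin r ⊕ Fin s → ℝ}
variable {y : ∀ α, (Fin (n α) → ℝ) → Fin (n α + 1) → ℝ} {u : CompIdx r n → ℝ}
variable {U : ∀ α, Set (Fin (n α) → ℝ)} {e : AmbIdx r n ≃ Option (CompIdx r n)}
variable (hU : ∀ α, IsOpen (U α)) (hy : ∀ α, ContDiffOn ℝ ∞ (y α) (U α)) (hu : u ∈ compDomain r U)
variable (hK : 2 ≤ r + s) (hX : centroDet e (localComp n c y) u ≠ 0)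
include hU hy hu hK hX

theorem centroMetric_localComp_inl_inl (i j : Fin (r + s - 1)) :
    centroMetric e (localComp n c y) u (Sum.inl i) (Sum.inl j)
      = if i = j then compNorm n i / ((compDim r n : ℝ) + 1) else 0 := by
  have h := (centro_unique hX (w := pd (Sum.inl i) (pd (Sum.inl j) (localComp n c y)) u)
    (c := Sum.elim (fun k => (∑ b, compWeight n b * compExp n b k *
      (compExp n b i * compExp n b j)) / compNorm n k) 0)
    (b := (∑ b, compWeight n b * (compExp n b i * compExp n b j)) / ((compDim r n : ℝ) + 1)) (by
      rw [pd_pd_localComp_inl_inl hU hy hu, sum_smul_compPart hU hy hu hK, Fintype.sum_sum_type]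
      simp)).2
  refine h.trans ?_
  simp only [← mul_assoc]
  split_ifs with hij
  · subst hij
    rw [sum_compExp_mul_self]
  · rw [sum_compExp_mul_of_ne n hij, zero_div]

theorem centroConn_localComp_inl_inl (i j : Fin (r + s - 1)) (x : CompIdx r n) :
    centroConn e (localComp n c y) u x (Sum.inl i) (Sum.inl j)
      = Sum.elim (fun k => compTriple n k i j / compNorm n k) 0 x := 
  (centro_unique hX (w := pd (Sum.inl i) (pd (Sum.inl j) (localComp n c y)) u)
    (c := Sum.elim (fun k => (∑ b, compWeight n b * compExp n b k *
      (compExp n b i * compExp n b j)) / compNorm n k) 0)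
    (b := (∑ b, compWeight n b * (compExp n b i * compExp n b j)) / ((compDim r n : ℝ) + 1)) (by
      rw [pd_pd_localComp_inl_inl hU hy hu, sum_smul_compPart hU hy hu hK, Fintype.sum_sum_type]
      simp)).1 x

theorem centro_localComp_inl_inr (i : Fin (r + s - 1)) (α : Fin s) (k : Fin (n α)) :
    (∀ x, centroConn e (localComp n c y) u x (Sum.inl i) (Sum.inr ⟨α, k⟩)
      = if x = Sum.inr ⟨α, k⟩ then compExp n (Sum.inr α) i else 0) ∧
    centroMetric e (localComp n c y) u (Sum.inl i) (Sum.inr ⟨α, k⟩) = 0 :=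
  centro_unique hX (by
    rw [pd_pd_localComp_inl_inr hU hy hu]
    simp [ite_smul])

theorem centro_localComp_inr_of_ne {α β : Fin s} (h : α ≠ β) (k : Fin (n α)) (l : Fin (n β)) :
    (∀ x, centroConn e (localComp n c y) u x (Sum.inr ⟨α, k⟩) (Sum.inr ⟨β, l⟩) = 0) ∧
    centroMetric e (localComp n c y) u (Sum.inr ⟨α, k⟩) (Sum.inr ⟨β, l⟩) = 0 :=
  centro_unique hX (by
    rw [pd_pd_localComp_inr_of_ne hU hy hu h]
    simp)

theorem centro_localComp_inr_self {α : Fin s}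
    (hD : centroDet finSuccEquivLast (y α) (blockCoord n α u) ≠ 0) (k l : Fin (n α)) :
    (∀ x, centroConn e (localComp n c y) u x (Sum.inr ⟨α, k⟩) (Sum.inr ⟨α, l⟩)
      = Sum.elim (fun i => ((n α : ℝ) + 1) * compExp n (Sum.inr α) i
            * centroMetric finSuccEquivLast (y α) (blockCoord n α u) k l / compNorm n i)
          (fun z => ∑ m, if z = ⟨α, m⟩
            then centroConn finSuccEquivLast (y α) (blockCoord n α u) m k l else 0) x) ∧
    centroMetric e (localComp n c y) u (Sum.inr ⟨α, k⟩) (Sum.inr ⟨α, l⟩)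
      = ((n α : ℝ) + 1) / ((compDim r n : ℝ) + 1)
        * centroMetric finSuccEquivLast (y α) (blockCoord n α u) k l := by
  refine centro_unique hX ?_
  set G := centroMetric finSuccEquivLast (y α) (blockCoord n α u) k l
  have h1 : G • compPart n c y u (Sum.inr α)
      = ∑ a, (if a = Sum.inr α then G else 0) • compPart n c y u a := by simp [ite_smul]
  rw [pd_pd_localComp_inr_self hU hy hu hD, h1, sum_smul_compPart hU hy hu hK,
    Fintype.sum_sum_type (α₁ := Fin (r + s - 1)) (α₂ := Σ α : Fin s, Fin (n α)), ← add_assoc,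
    add_comm (∑ m, _)]
  congr 1
  · congr 1
    · refine Finset.sum_congr rfl fun i _ => ?_
      simp [-Fintype.sum_sum_type, compWeight]
    · simp only [Sum.elim_inr, Finset.sum_smul, ite_smul, zero_smul]
      rw [Finset.sum_comm]
      simp
  · congr 1
    simp [-Fintype.sum_sum_type, compWeight]
    ring

end LocalCompositionInvariants

section FrameFactorization

variable {r s : ℕ} (n : Fin s → ℕ) (c : Fin r ⊕ Fin s → ℝ)
variable (y : ∀ α, (Fin (n α) → ℝ) → Fin (n α + 1) → ℝ) (u : CompIdx r n → ℝ)

/-- The index of the position vector of a factor in the product of the frames of the factors. -/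
def lastIdx : Fin r ⊕ Fin s → AmbIdx r n
  | Sum.inl i => Sum.inl i
  | Sum.inr α => Sum.inr ⟨α, Fin.last (n α)⟩

/-- The product of the frames of the factors. -/
def baseFrame : AmbIdx r n → AmbIdx r n → ℝ
  | Sum.inl i => compPart n c y u (Sum.inl i)
  | Sum.inr ⟨α, k⟩ => blockLift n c α (fun v => frame (y α) v (y α v) (finSuccEquivLast k)) u

/-- The coefficients of the frame of the composition in the product of the frames of the factors. -/
def transition : Option (CompIdx r n) → AmbIdx r n → ℝ
  | none => Sum.elim (fun _ => 1) fun z => if z.2 = Fin.last (n z.1) then 1 else 0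
  | some (Sum.inl i) => Sum.elim (fun j => compExp n (Sum.inl j) i)
      fun z => if z.2 = Fin.last (n z.1) then compExp n (Sum.inr z.1) i else 0
  | some (Sum.inr ⟨α, j⟩) => fun m => if m = Sum.inr ⟨α, j.castSucc⟩ then 1 else 0

/-- Weights on the product of the frames of the factors. -/
def ambWeight (r : ℕ) : AmbIdx r n → ℝ :=
  Sum.elim (fun _ => 1) fun z => if z.2 = Fin.last (n z.1) then (n z.1 : ℝ) + 1 else 1

variable {n}

theorem sum_ambIdx {E : Type*} [AddCommMonoid E] (F : AmbIdx r n → E)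
    (hF : ∀ α (j : Fin (n α)), F (Sum.inr ⟨α, j.castSucc⟩) = 0) :
    ∑ m, F m = ∑ a, F (lastIdx n a) := by
  rw [Fintype.sum_sum_type, Fintype.sum_sum_type, Fintype.sum_sigma]
  simp only [Fin.sum_univ_castSucc, hF]
  simp [lastIdx]

theorem ambWeight_lastIdx (a : Fin r ⊕ Fin s) : ambWeight n r (lastIdx n a) = compWeight n a := by
  cases a <;> simp [ambWeight, lastIdx, compWeight]

theorem transition_none_lastIdx (a : Fin r ⊕ Fin s) : transition n none (lastIdx n a) = 1 := by
  cases a <;> simp [transition, lastIdx]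

theorem transition_inl_lastIdx (i : Fin (r + s - 1)) (a : Fin r ⊕ Fin s) :
    transition n (some (Sum.inl i)) (lastIdx n a) = compExp n a i := by
  cases a <;> simp [transition, lastIdx]

theorem transition_none_castSucc (α : Fin s) (j : Fin (n α)) :
    transition (r := r) n none (Sum.inr ⟨α, j.castSucc⟩) = 0 := by
  simp [transition, Fin.ext_iff, j.2.ne]

theorem transition_inl_castSucc (i : Fin (r + s - 1)) (α : Fin s) (j : Fin (n α)) :
    transition n (some (Sum.inl i)) (Sum.inr ⟨α, j.castSucc⟩) = 0 := by
  simp [transition, Fin.ext_iff, j.2.ne]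

theorem transition_inr (α : Fin s) (j : Fin (n α)) (m : AmbIdx r n) :
    transition n (some (Sum.inr ⟨α, j⟩)) m = if m = Sum.inr ⟨α, j.castSucc⟩ then 1 else 0 := rfl

theorem transition_gram (hK : 2 ≤ r + s) (x x' : Option (CompIdx r n)) :
    ∑ m, transition n x m * ambWeight n r m * transition n x' m
      = if x = x' then x.elim ((compDim r n : ℝ) + 1) (Sum.elim (compNorm n) fun _ => 1)
        else 0 := by
  have hN : ∑ a : Fin r ⊕ Fin s, compWeight n a = (compDim r n : ℝ) + 1 := by
    rw [sum_compWeight, fNum_top n hK]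
  have hw : ∀ (α : Fin s) (j : Fin (n α)), ambWeight n r (Sum.inr ⟨α, j.castSucc⟩) = 1 := by
    intro α j; simp [ambWeight, Fin.ext_iff, j.2.ne]
  rcases x with _ | i | ⟨α, j⟩
  · rcases x' with _ | i' | ⟨β, k⟩
    · rw [sum_ambIdx _ fun α j => by rw [transition_none_castSucc]; ring]
      simp only [transition_none_lastIdx, ambWeight_lastIdx, one_mul, mul_one, hN]
      simp
    · rw [sum_ambIdx _ fun α j => by rw [transition_none_castSucc]; ring]
      simp only [transition_none_lastIdx, transition_inl_lastIdx, ambWeight_lastIdx, one_mul,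
        sum_compExp]
      simp
    · simp only [transition_inr, mul_ite, mul_one, mul_zero]
      rw [Finset.sum_ite_eq' Finset.univ, if_pos (Finset.mem_univ _), transition_none_castSucc]
      simp
  · rcases x' with _ | i' | ⟨β, k⟩
    · rw [sum_ambIdx _ fun α j => by rw [transition_none_castSucc]; ring]
      simp only [transition_none_lastIdx, transition_inl_lastIdx, ambWeight_lastIdx, mul_one]
      rw [Finset.sum_congr rfl fun a _ => mul_comm (compExp n a i) (compWeight n a), sum_compExp]
      simp
    · rw [sum_ambIdx _ fun α j => by rw [transition_inl_castSucc]; ring]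
      simp only [transition_inl_lastIdx, ambWeight_lastIdx, mul_comm (compExp n _ i)]
      by_cases h : i = i'
      · subst h
        rw [sum_compExp_mul_self]
        simp
      · rw [sum_compExp_mul_of_ne n h]
        simp [h]
    · simp only [transition_inr, mul_ite, mul_one, mul_zero]
      rw [Finset.sum_ite_eq' Finset.univ, if_pos (Finset.mem_univ _), transition_inl_castSucc]
      simp
  · have h1 : ∀ m, transition n (some (Sum.inr ⟨α, j⟩)) m * ambWeight n r m * transition n x' m
        = if m = Sum.inr ⟨α, j.castSucc⟩ then ambWeight n r m * transition n x' m else 0 := by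
      intro m
      rw [transition_inr]
      split_ifs <;> ring
    simp only [h1]
    rw [Finset.sum_ite_eq' Finset.univ, if_pos (Finset.mem_univ _), hw, one_mul]
    rcases x' with _ | i' | ⟨β, k⟩
    · rw [transition_none_castSucc]; simp
    · rw [transition_inl_castSucc]; simp
    · rw [transition_inr]
      by_cases h : (⟨α, j⟩ : Σ α : Fin s, Fin (n α)) = ⟨β, k⟩
      · cases h; simp
      · have h' : ¬ (Sum.inr ⟨α, j.castSucc⟩ : AmbIdx r n) = Sum.inr ⟨β, k.castSucc⟩ := by
          intro h2
          apply h
          have h3 := Sum.inr.inj h2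
          have h4 : α = β := congrArg Sigma.fst h3
          subst h4
          have h5 := eq_of_heq (Sigma.mk.inj h3).2
          rw [Fin.castSucc_injective _ h5]
        rw [if_neg h', if_neg (by simpa using h)]

theorem prod_ambWeight : ∏ m, ambWeight n r m = ∏ α, ((n α : ℝ) + 1) := by
  rw [Fintype.prod_sum_type, Fintype.prod_sigma]
  have h : ∀ (α : Fin s) (j : Fin (n α)), (j : ℕ) ≠ n α := fun α j => j.2.ne
  simp [ambWeight, Fin.prod_univ_castSucc, Fin.ext_iff, h]

variable {c y u} {U : ∀ α, Set (Fin (n α) → ℝ)}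

theorem localComp_frame (hU : ∀ α, IsOpen (U α)) (hy : ∀ α, ContDiffOn ℝ ∞ (y α) (U α))
    (hu : u ∈ compDomain r U) (x : Option (CompIdx r n)) :
    frame (localComp n c y) u (localComp n c y u) x
      = ∑ m, transition n x m • baseFrame n c y u m := by
  have hl : ∀ a, baseFrame n c y u (lastIdx n a) = compPart n c y u a := by
    intro a
    cases a with
    | inl i => rfl
    | inr α => simp [lastIdx, baseFrame, compPart, frame]
  rcases x with _ | i | ⟨α, j⟩
  · rw [sum_ambIdx _ fun α j => by rw [transition_none_castSucc, zero_smul]]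
    simp only [transition_none_lastIdx, hl, one_smul]
    rfl
  · rw [sum_ambIdx _ fun α j => by rw [transition_inl_castSucc, zero_smul]]
    simp only [transition_inl_lastIdx, hl]
    exact pd_localComp_inl hU hy hu i
  · simp only [transition_inr, ite_smul, one_smul, zero_smul]
    rw [Finset.sum_ite_eq' Finset.univ, if_pos (Finset.mem_univ _)]
    refine (pd_localComp_inr hU hy hu α j).trans ?_
    simp only [baseFrame, finSuccEquivLast_castSucc]
    rfl

theorem det_baseFrame : (Matrix.of (baseFrame n c y u)).det
    = (∏ i, compScale n c (Sum.inl i) u) * ∏ α, compScale n c (Sum.inr α) u ^ (n α + 1)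
      * centroDet finSuccEquivLast (y α) (blockCoord n α u) := by
  rw [det_sum_sigma _ fun i => compScale n c (Sum.inl i) u]
  · congr 1
    refine Finset.prod_congr rfl fun α _ => ?_
    have : (Matrix.of fun i j => (Matrix.of (baseFrame n c y u)) (Sum.inr ⟨α, i⟩) (Sum.inr ⟨α, j⟩))
        = compScale n c (Sum.inr α) u • (frameMatrix finSuccEquivLast (frame (y α)
          (blockCoord n α u) (y α (blockCoord n α u)))).submatrix finSuccEquivLast
            finSuccEquivLast := by
      ext i j
      simp [baseFrame, blockLift, blockEmb_inr_self, frameMatrix]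
    rw [this, Matrix.det_smul, Matrix.det_submatrix_equiv_self, Fintype.card_fin]
    rfl
  · intro i j
    simp [baseFrame, compPart, Pi.single_apply, eq_comm]
  · rintro ⟨α, k⟩ i
    simp [baseFrame, blockLift, blockEmb_inl]
  · intro α β i j h
    simp [baseFrame, blockLift, blockEmb_inr_of_ne h]

theorem prod_compScale : (∏ i, compScale n c (Sum.inl i) u)
      * ∏ α, compScale n c (Sum.inr α) u ^ (n α + 1)
    = (∏ i : Fin r, c (Sum.inl i)) * ∏ α, c (Sum.inr α) ^ (n α + 1) := by
  have h : (∏ i : Fin r, Real.exp (∑ l, compExp n (Sum.inl i) l * u (Sum.inl l)))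
      * ∏ α : Fin s, Real.exp (∑ l, compExp n (Sum.inr α) l * u (Sum.inl l)) ^ (n α + 1) = 1 := by
    have h0 : ∑ a : Fin r ⊕ Fin s, compWeight n a * ∑ l, compExp n a l * u (Sum.inl l) = 0 := by
      simp only [Finset.mul_sum, ← mul_assoc]
      rw [Finset.sum_comm]
      simp only [← Finset.sum_mul, sum_compExp, zero_mul, Finset.sum_const_zero]
    rw [Fintype.sum_sum_type] at h0
    simp only [compWeight, one_mul] at h0
    simp only [← Real.exp_nat_mul]
    rw [← Real.exp_sum, ← Real.exp_sum, ← Real.exp_add, Real.exp_eq_one_iff, ← h0]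
    push_cast
    rfl
  simp only [compScale, mul_pow, Finset.prod_mul_distrib]
  linear_combination ((∏ i : Fin r, c (Sum.inl i)) * ∏ α, c (Sum.inr α) ^ (n α + 1)) * h

theorem centroDet_localComp_sq (hK : 2 ≤ r + s) (hU : ∀ α, IsOpen (U α))
    (hy : ∀ α, ContDiffOn ℝ ∞ (y α) (U α)) (hu : u ∈ compDomain r U)
    (e : AmbIdx r n ≃ Option (CompIdx r n)) :
    centroDet e (localComp n c y) u ^ 2 * ∏ α, ((n α : ℝ) + 1)
      = ((compDim r n : ℝ) + 1) * (∏ i : Fin (r + s - 1), compNorm n i)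
        * ((∏ i : Fin r, c (Sum.inl i)) * (∏ α, c (Sum.inr α) ^ (n α + 1))
          * ∏ α, centroDet finSuccEquivLast (y α) (blockCoord n α u)) ^ 2 := by
  set T : Matrix (Option (CompIdx r n)) (Option (CompIdx r n)) ℝ :=
    Matrix.of fun x b => transition n x (e.symm b) with hT
  have h1 : frameMatrix e (frame (localComp n c y) u (localComp n c y u))
      = T * (Matrix.of (baseFrame n c y u)).submatrix e.symm e.symm := by
    ext x b
    rw [Matrix.mul_apply]
    simp only [frameMatrix, Matrix.of_apply, localComp_frame hU hy hu, hT, Matrix.submatrix_apply,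
      Finset.sum_apply, Pi.smul_apply, smul_eq_mul]
    exact (Equiv.sum_comp e.symm fun m => transition n x m * baseFrame n c y u m (e.symm b)).symm
  have h2 : T * Matrix.diagonal (fun b => ambWeight n r (e.symm b)) * T.transpose
      = Matrix.diagonal fun x : Option (CompIdx r n) =>
        x.elim ((compDim r n : ℝ) + 1) (Sum.elim (compNorm n) fun _ => 1) := by
    ext x x'
    rw [Matrix.mul_apply, Matrix.diagonal_apply, ← transition_gram hK x x']
    simp only [Matrix.mul_diagonal, Matrix.transpose_apply, hT, Matrix.of_apply]
    exact Equiv.sum_comp e.symm fun m => transition n x m * ambWeight n r m * transition n x' m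
  have h3 := congrArg Matrix.det h2
  rw [Matrix.det_mul, Matrix.det_mul, Matrix.det_transpose, Matrix.det_diagonal,
    Matrix.det_diagonal, Equiv.prod_comp e.symm, prod_ambWeight, Fintype.prod_option,
    Fintype.prod_sum_type] at h3
  simp only [Option.elim, Sum.elim_inl, Sum.elim_inr, Finset.prod_const_one, mul_one] at h3
  rw [centroDet, frameDet, h1, Matrix.det_mul, Matrix.det_submatrix_equiv_self, det_baseFrame,
    Finset.prod_mul_distrib, ← mul_assoc (∏ i, compScale n c (Sum.inl i) u), prod_compScale]
  linear_combination ((∏ i : Fin r, c (Sum.inl i)) * (∏ α, c (Sum.inr α) ^ (n α + 1))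
          * ∏ α, centroDet finSuccEquivLast (y α) (blockCoord n α u)) ^ 2 * h3

end FrameFactorization

section LocalCompositionSphere

variable {r s : ℕ} {n : Fin s → ℕ} {c : Fin r ⊕ Fin s → ℝ}
variable {y η : ∀ α, (Fin (n α) → ℝ) → Fin (n α + 1) → ℝ} {u : CompIdx r n → ℝ}
variable {U : ∀ α, Set (Fin (n α) → ℝ)} {ρ L : Fin s → ℝ}

theorem card_compIdx (r : ℕ) {s : ℕ} (n : Fin s → ℕ) :
    Fintype.card (CompIdx r n) = compDim r n := by
  simp [CompIdx, compDim, add_comm]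

variable (h : ∀ α, IsCentroSphere finSuccEquivLast (y α) (η α) (U α) (ρ α))
variable (hK : 2 ≤ r + s) (hc : ∀ a, 0 < c a)
variable (e : AmbIdx r n ≃ Option (CompIdx r n))
include h hK hc

theorem centroDet_localComp_ne (hu : u ∈ compDomain r U) :
    centroDet e (localComp n c y) u ≠ 0 := by
  intro h0
  have h1 := centroDet_localComp_sq (c := c) hK (fun α => (h α).isOpen) (fun α => (h α).smooth) hu e
  rw [h0] at h1
  have h2 : ∏ i : Fin (r + s - 1), compNorm n i ≠ 0 :=
    Finset.prod_ne_zero_iff.2 fun i _ => (compNorm_pos n i).ne'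
  have h3 : ∏ i : Fin r, c (Sum.inl i) ≠ 0 := Finset.prod_ne_zero_iff.2 fun i _ => (hc _).ne'
  have h4 : ∏ α : Fin s, c (Sum.inr α) ^ (n α + 1) ≠ 0 :=
    Finset.prod_ne_zero_iff.2 fun α _ => pow_ne_zero _ (hc _).ne'
  have h5 : ∏ α, centroDet finSuccEquivLast (y α) (blockCoord n α u) ≠ 0 :=
    Finset.prod_ne_zero_iff.2 fun α _ => (h α).centroDet_ne _ (hu α)
  have h6 : (compDim r n : ℝ) + 1 ≠ 0 := by positivity
  have h7 := mul_ne_zero (mul_ne_zero h6 h2) (pow_ne_zero 2 (mul_ne_zero (mul_ne_zero h3 h4) h5))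
  apply h7
  rw [← h1]
  ring

theorem centroMetric_localComp_det (hu : u ∈ compDomain r U) :
    (centroMetric e (localComp n c y) u).det
      = (∏ i : Fin (r + s - 1), compNorm n i / ((compDim r n : ℝ) + 1))
        * ∏ α, (((n α : ℝ) + 1) / ((compDim r n : ℝ) + 1)) ^ n α
          * (centroMetric finSuccEquivLast (y α) (blockCoord n α u)).det := by
  have hU := fun α => (h α).isOpen
  have hy := fun α => (h α).smooth
  have hX := centroDet_localComp_ne h hK hc e hu
  rw [det_sum_sigma _ fun i => compNorm n i / ((compDim r n : ℝ) + 1)]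
  · congr 1
    refine Finset.prod_congr rfl fun α _ => ?_
    have : (Matrix.of fun i j =>
        centroMetric e (localComp n c y) u (Sum.inr ⟨α, i⟩) (Sum.inr ⟨α, j⟩))
        = (((n α : ℝ) + 1) / ((compDim r n : ℝ) + 1)) •
          centroMetric finSuccEquivLast (y α) (blockCoord n α u) := by
      ext i j
      exact (centro_localComp_inr_self hU hy hu hK hX ((h α).centroDet_ne _ (hu α)) i j).2
    rw [this, Matrix.det_smul, Fintype.card_fin]
  · exact centroMetric_localComp_inl_inl hU hy hu hK hX
  · rintro ⟨α, k⟩ i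
    rw [centroMetric_comm (isOpen_compDomain hU) (contDiffOn_localComp hy) hu]
    exact (centro_localComp_inl_inr hU hy hu hK hX i α k).2
  · intro α β i j hαβ
    exact (centro_localComp_inr_of_ne hU hy hu hK hX hαβ i j).2

omit h hK in
theorem calabiC_base_pos (hL : ∀ α, L α < 0) :
    0 < 1 / ((compDim r n : ℝ) + 1) * (∏ a : Fin r, c (Sum.inl a) ^ 2) *
      ∏ α : Fin s, c (Sum.inr α) ^ (2 * (n α + 1)) /
        (((n α : ℝ) + 1) ^ (n α + 1) * (-L α) ^ (n α + 2)) := by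
  have h1 : 0 < ∏ a : Fin r, c (Sum.inl a) ^ 2 := Finset.prod_pos fun a _ => pow_pos (hc _) _
  have h2 : 0 < ∏ α : Fin s, c (Sum.inr α) ^ (2 * (n α + 1)) /
        (((n α : ℝ) + 1) ^ (n α + 1) * (-L α) ^ (n α + 2)) :=
    Finset.prod_pos fun α _ => div_pos (pow_pos (hc _) _)
      (mul_pos (by positivity) (pow_pos (neg_pos.2 (hL α)) _))
  positivity

omit h hK in
theorem calabiC_pos (hL : ∀ α, L α < 0) : 0 < calabiC n L c :=
  Real.rpow_pos_of_pos (calabiC_base_pos hc hL) _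

omit h hK in
theorem calabiC_pow (hL : ∀ α, L α < 0) :
    calabiC n L c ^ (compDim r n + 2)
      = 1 / ((compDim r n : ℝ) + 1) * (∏ a : Fin r, c (Sum.inl a) ^ 2) *
        ∏ α : Fin s, c (Sum.inr α) ^ (2 * (n α + 1)) /
          (((n α : ℝ) + 1) ^ (n α + 1) * (-L α) ^ (n α + 2)) := by
  have h1 := calabiC_base_pos (n := n) hc hL
  rw [calabiC, ← Real.rpow_natCast, ← Real.rpow_mul h1.le]
  push_cast
  rw [one_div_mul_cancel (by positivity), Real.rpow_one]

omit h in
/-- The Calabi composition of centroaffine models of hyperbolic affine hyperspheres. -/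
theorem isCentroSphere_localComp (hL : ∀ α, L α < 0)
    (h : ∀ α, IsCentroSphere finSuccEquivLast (y α) (η α) (U α) (-1 / L α)) :
    IsCentroSphere e (localComp n c y) (localComp n c y) (compDomain r U)
      (((compDim r n : ℝ) + 1) * calabiC n L c) := by
  have hU := fun α => (h α).isOpen
  have hy := fun α => (h α).smooth
  have hN : 0 < (compDim r n : ℝ) + 1 := by positivity
  refine ⟨isOpen_compDomain hU, contDiffOn_localComp hy, mul_pos hN (calabiC_pos hc hL),
    fun v hv => centroDet_localComp_ne h hK hc e hv, fun _ _ => rfl, fun v hv => ?_⟩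
  have hsq := centroDet_localComp_sq (c := c) hK hU hy hv e
  rw [card_compIdx, mul_pow, calabiC_pow hc hL, centroMetric_localComp_det h hK hc e hv]
  set N : ℝ := (compDim r n : ℝ) + 1
  have hw : ∏ α, ((n α : ℝ) + 1) ≠ 0 := Finset.prod_ne_zero_iff.2 fun α _ => by positivity
  have hP : 0 < ∏ i : Fin (r + s - 1), compNorm n i / N :=
    Finset.prod_pos fun i _ => div_pos (compNorm_pos n i) hN
  rw [abs_mul, abs_of_pos hP, Finset.abs_prod]
  apply mul_right_cancel₀ hw
  have hPeq : ∏ i : Fin (r + s - 1), compNorm n i / N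
      = (∏ i : Fin (r + s - 1), compNorm n i) / N ^ (r + s - 1) := by
    rw [Finset.prod_div_distrib, Finset.prod_const, Finset.card_univ, Fintype.card_fin]
  rw [hsq, hPeq]
  have hNpow : N ^ (compDim r n + 2)
      = N ^ 2 * N ^ (r + s - 1) * ∏ α, N ^ n α := by
    rw [Finset.prod_pow_eq_pow_sum, compDim]
    ring
  have hα : ∀ α, (c (Sum.inr α) ^ (n α + 1)) ^ 2
        * centroDet finSuccEquivLast (y α) (blockCoord n α v) ^ 2
      = N ^ n α * (c (Sum.inr α) ^ (2 * (n α + 1)) /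
          (((n α : ℝ) + 1) ^ (n α + 1) * (-L α) ^ (n α + 2)))
        * |(((n α : ℝ) + 1) / N) ^ n α
          * (centroMetric finSuccEquivLast (y α) (blockCoord n α v)).det| * ((n α : ℝ) + 1) := by
    intro α
    have hLα : -L α ≠ 0 := (neg_pos.2 (hL α)).ne'
    have hw : (n α : ℝ) + 1 ≠ 0 := by positivity
    have hN' := hN.ne'
    have hp : 0 < (((n α : ℝ) + 1) / N) ^ n α := by positivity
    rw [(h α).ratio _ (hv α), Fintype.card_fin, abs_mul, abs_of_pos hp, ← neg_div_neg_eq,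
      neg_neg, div_pow, div_pow, one_pow, ← pow_mul, mul_comm (n α + 1) 2, pow_succ ((n α : ℝ) + 1)]
    field_simp
  have hprod := Finset.prod_congr (rfl : (Finset.univ : Finset (Fin s)) = Finset.univ)
    fun α _ => hα α
  simp only [Finset.prod_mul_distrib, Finset.prod_pow] at hprod
  rw [hNpow, mul_pow, mul_pow, Finset.prod_pow]
  have hN' := hN.ne'
  rw [mul_assoc ((∏ i : Fin r, c (Sum.inl i)) ^ 2), hprod]
  field_simp

end LocalCompositionSphere

section LocalCompositionCubic

variable {r s : ℕ} {n : Fin s → ℕ} {c : Fin r ⊕ Fin s → ℝ}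
variable {y η : ∀ α, (Fin (n α) → ℝ) → Fin (n α + 1) → ℝ} {u : CompIdx r n → ℝ}
variable {U : ∀ α, Set (Fin (n α) → ℝ)} {ρ : Fin s → ℝ}
variable (h : ∀ α, IsCentroSphere finSuccEquivLast (y α) (η α) (U α) (ρ α))
variable (hK : 2 ≤ r + s) (hc : ∀ a, 0 < c a)
variable (e : AmbIdx r n ≃ Option (CompIdx r n)) (hu : u ∈ compDomain r U)
include h hK hc hu

theorem centroCubic_localComp_inl_inl_inl (i j k : Fin (r + s - 1)) :
    centroCubic e (localComp n c y) u (Sum.inl i) (Sum.inl j) (Sum.inl k)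
      = -(2 / ((compDim r n : ℝ) + 1)) * compTriple n i j k := by
  have hU := fun α => (h α).isOpen
  have hy := fun α => (h α).smooth
  have hX := fun v (hv : v ∈ compDomain r U) => centroDet_localComp_ne h hK hc e hv
  have hG := fun v (hv : v ∈ compDomain r U) =>
    centroMetric_localComp_inl_inl hU hy hv hK (hX v hv)
  have hΓ := centroConn_localComp_inl_inl hU hy hu hK (hX u hu)
  have hN := fun i => (compNorm_pos (r := r) n i).ne'
  unfold centroCubic
  rw [pd_congr_on (isOpen_compDomain hU) hu (fun v hv => hG v hv i j), pd_const,
    Fintype.sum_sum_type, Fintype.sum_sum_type]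
  simp only [hΓ, hG u hu, Sum.elim_inl, Sum.elim_inr, Pi.zero_apply, mul_zero,
    Finset.sum_const_zero, add_zero, ite_mul, zero_mul, Finset.sum_ite_eq, Finset.sum_ite_eq',
    Finset.mem_univ, if_true]
  rw [compTriple_comm n j i k]
  have h1 := hN i
  have h2 := hN j
  field_simp
  ring

theorem centroCubic_localComp_inl_inl_inr (i j : Fin (r + s - 1)) (α : Fin s) (k : Fin (n α)) :
    centroCubic e (localComp n c y) u (Sum.inl i) (Sum.inl j) (Sum.inr ⟨α, k⟩) = 0 := by
  have hU := fun α => (h α).isOpen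
  have hy := fun α => (h α).smooth
  have hX := fun v (hv : v ∈ compDomain r U) => centroDet_localComp_ne h hK hc e hv
  have hG := fun v (hv : v ∈ compDomain r U) =>
    centroMetric_localComp_inl_inl hU hy hv hK (hX v hv)
  have hΓ := fun i α k => (centro_localComp_inl_inr hU hy hu hK (hX u hu) i α k).1
  have hG0 := fun i α k => (centro_localComp_inl_inr hU hy hu hK (hX u hu) i α k).2
  have hG0' : ∀ i α k, centroMetric e (localComp n c y) u (Sum.inr ⟨α, k⟩) (Sum.inl i) = 0 :=
    fun i α k => by
      rw [centroMetric_comm (isOpen_compDomain hU) (contDiffOn_localComp hy) hu, hG0]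
  unfold centroCubic
  rw [pd_congr_on (isOpen_compDomain hU) hu (fun v hv => hG v hv i j), pd_const]
  simp only [hΓ, mul_ite, mul_zero, Finset.sum_ite_eq', Finset.mem_univ, if_true, hG0, hG0',
    zero_mul]
  simp

theorem centroCubic_localComp_inr_inr_inl (α : Fin s) (k l : Fin (n α)) (i : Fin (r + s - 1)) :
    centroCubic e (localComp n c y) u (Sum.inr ⟨α, k⟩) (Sum.inr ⟨α, l⟩) (Sum.inl i)
      = -2 * compExp n (Sum.inr α) i
        * centroMetric e (localComp n c y) u (Sum.inr ⟨α, k⟩) (Sum.inr ⟨α, l⟩) := by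
  have hU := fun α => (h α).isOpen
  have hy := fun α => (h α).smooth
  have hX := fun v (hv : v ∈ compDomain r U) => centroDet_localComp_ne h hK hc e hv
  have hG := fun v (hv : v ∈ compDomain r U) => (centro_localComp_inr_self hU hy hv hK (hX v hv)
    ((h α).centroDet_ne _ (hv α)) k l).2
  have hΓ : ∀ x α k i, centroConn e (localComp n c y) u x (Sum.inr ⟨α, k⟩) (Sum.inl i)
      = if x = Sum.inr ⟨α, k⟩ then compExp n (Sum.inr α) i else 0 := by
    intro x α k i
    rw [centroConn_comm (isOpen_compDomain hU) (contDiffOn_localComp hy) hu]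
    exact (centro_localComp_inl_inr hU hy hu hK (hX u hu) i α k).1 x
  have hd : DifferentiableAt ℝ
      (fun v => centroMetric finSuccEquivLast (y α) v k l) (blockCoord n α u) :=
    differentiableAt_of_contDiffOn (hU α) (hu α)
      (contDiffOn_centroMetric (hU α) (hy α) (h α).centroDet_ne k l)
  unfold centroCubic
  rw [pd_congr_on (isOpen_compDomain hU) hu hG,
    pd_const_mul (differentiableAt_comp_blockCoord hd), pd_comp_blockCoord hd,
    blockCoord_single_inl]
  simp only [hΓ, mul_ite, mul_zero, Finset.sum_ite_eq', Finset.mem_univ, if_true, map_zero]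
  ring

theorem centroCubic_localComp_inr_of_ne {α β : Fin s} (hαβ : α ≠ β) (k : Fin (n α))
    (l : Fin (n β)) (x : CompIdx r n) :
    centroCubic e (localComp n c y) u (Sum.inr ⟨α, k⟩) (Sum.inr ⟨β, l⟩) x = 0 := by
  have hU := fun α => (h α).isOpen
  have hy := fun α => (h α).smooth
  have hX := fun v (hv : v ∈ compDomain r U) => centroDet_localComp_ne h hK hc e hv
  have hG := fun v (hv : v ∈ compDomain r U) α β (hab : α ≠ β) k l =>
    (centro_localComp_inr_of_ne hU hy hv hK (hX v hv) (α := α) (β := β) hab k l).2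
  have hG0 := fun i α k => (centro_localComp_inl_inr hU hy hu hK (hX u hu) i α k).2
  have key : ∀ α β (k : Fin (n α)) (l : Fin (n β)), α ≠ β → ∀ z,
      centroMetric e (localComp n c y) u z (Sum.inr ⟨β, l⟩)
        * centroConn e (localComp n c y) u z (Sum.inr ⟨α, k⟩) x = 0 := by
    intro α β k l hab z
    rcases z with i | ⟨γ, m⟩
    · rw [hG0, zero_mul]
    · by_cases hγ : γ = β
      · subst hγ
        rcases x with i | ⟨δ, p⟩
        · rw [centroConn_comm (isOpen_compDomain hU) (contDiffOn_localComp hy) hu,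
            (centro_localComp_inl_inr hU hy hu hK (hX u hu) i α k).1, if_neg, mul_zero]
          intro h0
          exact hab (congrArg Sigma.fst (Sum.inr.inj h0)).symm
        · by_cases hδ : α = δ
          · subst hδ
            rw [(centro_localComp_inr_self hU hy hu hK (hX u hu)
              ((h α).centroDet_ne _ (hu α)) k p).1]
            rw [Sum.elim_inr, Finset.sum_eq_zero, mul_zero]
            intro q _
            rw [if_neg]
            intro h0
            exact hab (congrArg Sigma.fst h0).symm
          · rw [(centro_localComp_inr_of_ne hU hy hu hK (hX u hu) hδ k p).1, mul_zero]
      · rw [hG u hu γ β hγ, zero_mul]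
  unfold centroCubic
  rw [pd_congr_on (isOpen_compDomain hU) hu (fun v hv => hG v hv α β hαβ k l), pd_const,
    Finset.sum_eq_zero fun z _ => key α β k l hαβ z, Finset.sum_eq_zero, sub_zero, sub_zero]
  intro z _
  rw [centroMetric_comm (isOpen_compDomain hU) (contDiffOn_localComp hy) hu]
  exact key β α l k hαβ.symm z

theorem centroCubic_localComp_inr_inr_inr (α : Fin s) (k l m : Fin (n α)) :
    centroCubic e (localComp n c y) u (Sum.inr ⟨α, k⟩) (Sum.inr ⟨α, l⟩) (Sum.inr ⟨α, m⟩)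
      = ((n α : ℝ) + 1) / ((compDim r n : ℝ) + 1)
        * centroCubic finSuccEquivLast (y α) (blockCoord n α u) k l m := by
  have hU := fun α => (h α).isOpen
  have hy := fun α => (h α).smooth
  have hX := fun v (hv : v ∈ compDomain r U) => centroDet_localComp_ne h hK hc e hv
  have hG := fun v (hv : v ∈ compDomain r U) k l => (centro_localComp_inr_self hU hy hv hK (hX v hv)
    ((h α).centroDet_ne _ (hv α)) k l).2
  have hΓ := fun k l => (centro_localComp_inr_self hU hy hu hK (hX u hu)
    ((h α).centroDet_ne _ (hu α)) k l).1
  have hG0 := fun i k => (centro_localComp_inl_inr hU hy hu hK (hX u hu) i α k).2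
  have hd : DifferentiableAt ℝ
      (fun v => centroMetric finSuccEquivLast (y α) v k l) (blockCoord n α u) :=
    differentiableAt_of_contDiffOn (hU α) (hu α)
      (contDiffOn_centroMetric (hU α) (hy α) (h α).centroDet_ne k l)
  have key : ∀ k l : Fin (n α), ∑ z, centroMetric e (localComp n c y) u z (Sum.inr ⟨α, l⟩)
        * centroConn e (localComp n c y) u z (Sum.inr ⟨α, k⟩) (Sum.inr ⟨α, m⟩)
      = ((n α : ℝ) + 1) / ((compDim r n : ℝ) + 1)
        * ∑ p, centroMetric finSuccEquivLast (y α) (blockCoord n α u) p l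
          * centroConn finSuccEquivLast (y α) (blockCoord n α u) p k m := by
    intro k l
    rw [Fintype.sum_sum_type (α₁ := Fin (r + s - 1)) (α₂ := Σ α : Fin s, Fin (n α))]
    simp only [hG0, zero_mul, Finset.sum_const_zero, zero_add, hΓ, Sum.elim_inr, Finset.mul_sum,
      mul_ite, mul_zero]
    rw [Finset.sum_comm]
    simp only [Finset.sum_ite_eq', Finset.mem_univ, if_true, hG u hu, mul_assoc]
  have key' : ∑ z, centroMetric e (localComp n c y) u (Sum.inr ⟨α, k⟩) z
        * centroConn e (localComp n c y) u z (Sum.inr ⟨α, l⟩) (Sum.inr ⟨α, m⟩)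
      = ((n α : ℝ) + 1) / ((compDim r n : ℝ) + 1)
        * ∑ p, centroMetric finSuccEquivLast (y α) (blockCoord n α u) k p
          * centroConn finSuccEquivLast (y α) (blockCoord n α u) p l m := by
    simp only [centroMetric_comm (isOpen_compDomain hU) (contDiffOn_localComp hy) hu
      (Sum.inr ⟨α, k⟩), centroMetric_comm (hU α) (hy α) (hu α) k]
    exact key l k
  unfold centroCubic
  rw [pd_congr_on (isOpen_compDomain hU) hu (fun v hv => hG v hv k l),
    pd_const_mul (differentiableAt_comp_blockCoord hd), pd_comp_blockCoord hd,
    blockCoord_single_inr_self, key, key']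
  simp only [pd]
  ring

end LocalCompositionCubic

section WeightValues

variable {r s : ℕ} (n : Fin s → ℕ)

theorem compTop_of_lt {i : Fin (r + s - 1)} (hi : (i : ℕ) + 1 < r) :
    (compTop i : Fin r ⊕ Fin s) = Sum.inl ⟨(i : ℕ) + 1, hi⟩ :=
  compTop_eq rfl

theorem compTop_of_eq {i : Fin (r + s - 1)} {α : Fin s} (hi : (i : ℕ) + 1 = r + (α : ℕ)) :
    (compTop i : Fin r ⊕ Fin s) = Sum.inr α :=
  compTop_eq (by simp only [compPos]; omega)

theorem fNum_cast_of_le {m : ℕ} (hm : m + 1 ≤ r) : (fNum r n (m + 1) : ℝ) = (m : ℝ) + 1 := by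
  rw [fNum_of_le n hm]
  push_cast
  rfl

theorem compNorm_of_lt {i : Fin (r + s - 1)} (hi : (i : ℕ) + 1 < r) :
    compNorm n i = (((i : ℕ) : ℝ) + 2) / (((i : ℕ) : ℝ) + 1) := by
  rw [compNorm, compTop_of_lt hi, fNum_cast_of_le n hi.le, compWeight]
  have : ((i : ℕ) : ℝ) + 1 ≠ 0 := by positivity
  field_simp
  ring

theorem compNorm_of_eq {i : Fin (r + s - 1)} {α : Fin s} (hα : (α : ℕ) = 0)
    (hi : (i : ℕ) + 1 = r) :
    compNorm n i = ((n α : ℝ) + r + 1) / ((r : ℝ) * ((n α : ℝ) + 1)) := by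
  rw [compNorm, compTop_of_eq (α := α) (by omega), hi, fNum_of_le n le_rfl, compWeight]
  have h1 : (n α : ℝ) + 1 ≠ 0 := by positivity
  have h2 : (r : ℝ) ≠ 0 := by
    have : r ≠ 0 := by omega
    exact_mod_cast this
  field_simp
  ring

theorem partialSum_pos (α : Fin s) : 0 < partialSum r n α := by
  unfold partialSum
  positivity

theorem fNum_of_eq {i : Fin (r + s - 1)} {α : Fin s} (hi : (i : ℕ) = r + (α : ℕ)) :
    (fNum r n ((i : ℕ) + 1) : ℝ) = partialSum r n α := by
  rw [hi, fNum_partialSum]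

theorem compNorm_of_gt {i : Fin (r + s - 1)} {α β : Fin s} (hβ : (β : ℕ) = (α : ℕ) + 1)
    (hi : (i : ℕ) = r + (α : ℕ)) :
    compNorm n i = partialSum r n β / (((n β : ℝ) + 1) * partialSum r n α) := by
  rw [compNorm, compTop_of_eq (α := β) (by omega), fNum_of_eq n hi, compWeight,
    partialSum_succ n hβ]
  have h1 : (n β : ℝ) + 1 ≠ 0 := by positivity
  have h2 := (partialSum_pos (r := r) n α).ne'
  field_simp
  ring

end WeightValues

section Charts

theorem IsHyperbolicAffineHypersphere.isCentroSphere {m : ℕ} (hm : 0 < m) {M : Type*}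
    [TopologicalSpace M] {𝒜 : Set (OpenPartialHomeomorph M (Fin m → ℝ))}
    {x η : M → Fin (m + 1) → ℝ} {L : ℝ}
    (hx : IsHyperbolicAffineHypersphere finSuccEquivLast 𝒜 x η L)
    (hcenter : IsAffineCenter finSuccEquivLast 𝒜 x η 0)
    {φ : OpenPartialHomeomorph M (Fin m → ℝ)} (hφ : φ ∈ 𝒜) :
    IsCentroSphere finSuccEquivLast (x ∘ φ.symm) (η ∘ φ.symm) φ.target (-1 / L) := by
  have : Nonempty (Fin m) := ⟨⟨0, hm⟩⟩
  refine isCentroSphere_of_shape hx.neg φ.open_target (hx.smooth φ hφ)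
    (hx.continuous_coorientation.comp_continuousOn φ.continuousOn_symm) ?_ ?_ ?_ ?_ <;>
    intro v hv
  · have := hx.transversal φ hφ _ (φ.map_target hv)
    rwa [φ.right_inv hv] at this
  · have := hx.nondegenerate φ hφ _ (φ.map_target hv)
    rwa [φ.right_inv hv] at this
  · have := hx.shape φ hφ _ (φ.map_target hv)
    rwa [shapeAt, φ.right_inv hv] at this
  · have := hcenter φ hφ _ (φ.map_target hv)
    simp only [normalAt, φ.right_inv hv] at this
    exact this

theorem IsNondegenerateHypersurface.continuous {m : ℕ} {M : Type*} [TopologicalSpace M]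
    [ChartedSpace (Fin m → ℝ) M] [IsManifold (modelWithCornersSelf ℝ (Fin m → ℝ)) ∞ M]
    {κ : Type*} [Fintype κ] [DecidableEq κ] {e : κ ≃ Option (Fin m)} {x η : M → κ → ℝ}
    (hx : IsNondegenerateHypersurface e (smoothCharts m M) x η) : Continuous x := by
  refine continuous_iff_continuousAt.2 fun p => ?_
  set φ := chartAt (Fin m → ℝ) p
  have hφ : φ ∈ smoothCharts m M := IsManifold.chart_mem_maximalAtlas p
  have hp : p ∈ φ.source := mem_chart_source _ p
  have h1 : ContinuousAt (x ∘ φ.symm) (φ p) :=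
    (hx.smooth φ hφ).continuousOn.continuousAt (φ.open_target.mem_nhds (φ.map_source hp))
  have h2 : ContinuousAt ((x ∘ φ.symm) ∘ φ) p := h1.comp (φ.continuousAt hp)
  refine h2.congr (Filter.eventuallyEq_of_mem (φ.open_source.mem_nhds hp) fun q hq => ?_)
  simp [φ.left_inv hq]

variable {r s : ℕ} {n : Fin s → ℕ} {M : Fin s → Type*} [∀ α, TopologicalSpace (M α)]
variable (x : ∀ α, M α → Fin (n α + 1) → ℝ) (c : Fin r ⊕ Fin s → ℝ)
variable (φ : ∀ α, OpenPartialHomeomorph (M α) (Fin (n α) → ℝ))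

theorem eFun_eq_compExp (t : Fin (r + s - 1) → ℝ) (a : Fin r ⊕ Fin s) (d : ℕ)
    (hd : (d : ℝ) + 1 = compWeight n a) :
    eFun r n t (compPos a) d = Real.exp (∑ i, compExp n a i * t i) := by
  unfold eFun
  congr 1
  refine Finset.sum_congr rfl fun i _ => ?_
  rw [compExp, hd]
  split_ifs <;> ring

theorem calabiComp_prodChart :
    calabiComp n x c ∘ (prodChart r n φ).symm = localComp n c fun α => x α ∘ (φ α).symm := by
  funext u m
  simp only [localComp, Fintype.sum_sum_type, Finset.sum_apply, Function.comp]
  rcases m with i | ⟨α, k⟩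
  · have h1 := eFun_eq_compExp (n := n) (fun j => u (Sum.inl j)) (Sum.inl i) 0
      (by simp [compWeight])
    simp only [compPart, blockLift, Pi.smul_apply, blockEmb_inl, Finset.sum_const_zero,
      add_zero, Pi.single_apply, smul_eq_mul, mul_ite, mul_one, mul_zero, Sum.inl.injEq]
    rw [Finset.sum_ite_eq Finset.univ, if_pos (Finset.mem_univ _), compScale, ← h1]
    rfl
  · have h1 := eFun_eq_compExp (n := n) (fun j => u (Sum.inl j)) (Sum.inr α) (n α) rfl
    rw [Finset.sum_eq_zero, zero_add, Finset.sum_eq_single α]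
    · simp only [compPart, blockLift, Pi.smul_apply, blockEmb_inr_self, smul_eq_mul]
      rw [compScale, ← h1]
      rfl
    · intro β _ hβ
      simp [compPart, blockLift, blockEmb_inr_of_ne hβ]
    · intro hα
      exact absurd (Finset.mem_univ _) hα
    · intro i _
      simp [compPart]

theorem prodChart_target :
    (prodChart r n φ).target = compDomain r fun α => (φ α).target := by
  ext u
  constructor
  · rintro ⟨_, h⟩ α
    exact h α (Set.mem_univ α)
  · intro h
    exact ⟨Set.mem_univ _, fun α _ => h α⟩

theorem prodChart_mem {t : Fin (r + s - 1) → ℝ} {p : ∀ α, M α} (hp : ∀ α, p α ∈ (φ α).source) :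
    prodChart r n φ (t, p) ∈ compDomain r fun α => (φ α).target :=
  fun α => (φ α).map_source (hp α)

theorem continuous_eFun (a d : ℕ) : Continuous fun t => eFun r n t a d := by
  unfold eFun
  refine Real.continuous_exp.comp (continuous_finsetSum _ fun i _ => ?_)
  split_ifs <;> fun_prop

theorem continuous_calabiComp (hx : ∀ α, Continuous (x α)) : Continuous (calabiComp n x c) := by
  refine continuous_pi fun m => ?_
  rcases m with i | ⟨α, k⟩
  · exact continuous_const.mul ((continuous_eFun _ _).comp continuous_fst)
  · exact (continuous_const.mul ((continuous_eFun _ _).comp continuous_fst)).mul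
      ((continuous_apply k).comp ((hx α).comp ((continuous_apply α).comp continuous_snd)))

end Charts

section ProductCoordinates

variable {r s : ℕ} {n : Fin s → ℕ} {c : Fin r ⊕ Fin s → ℝ}
variable {y η : ∀ α, (Fin (n α) → ℝ) → Fin (n α + 1) → ℝ} {u : CompIdx r n → ℝ}
variable {U : ∀ α, Set (Fin (n α) → ℝ)} {L : Fin s → ℝ}
variable (hK : 2 ≤ r + s) (hc : ∀ a, 0 < c a) (hL : ∀ α, L α < 0)
variable (h : ∀ α, IsCentroSphere finSuccEquivLast (y α) (η α) (U α) (-1 / L α))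
variable (e : AmbIdx r n ≃ Option (CompIdx r n)) (hu : u ∈ compDomain r U)
include hK hc hL h hu

theorem affineMetric_localComp_inl_inl (i j : Fin (r + s - 1)) :
    affineMetric e (localComp n c y) (localComp n c y) u (Sum.inl i) (Sum.inl j)
      = if i = j then compNorm n i * calabiC n L c else 0 := by
  have hN : (compDim r n : ℝ) + 1 ≠ 0 := by positivity
  rw [(isCentroSphere_localComp hK hc e hL h).affineMetric_eq hu, Matrix.smul_apply,
    centroMetric_localComp_inl_inl (fun α => (h α).isOpen) (fun α => (h α).smooth) hu hK
      (centroDet_localComp_ne h hK hc e hu)]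
  split_ifs
  · rw [smul_eq_mul]; field_simp
  · simp

theorem affineMetric_localComp_inl_inr (i : Fin (r + s - 1)) (α : Fin s) (k : Fin (n α)) :
    affineMetric e (localComp n c y) (localComp n c y) u (Sum.inl i) (Sum.inr ⟨α, k⟩) = 0 := by
  rw [(isCentroSphere_localComp hK hc e hL h).affineMetric_eq hu, Matrix.smul_apply,
    (centro_localComp_inl_inr (fun α => (h α).isOpen) (fun α => (h α).smooth) hu hK
      (centroDet_localComp_ne h hK hc e hu) i α k).2, smul_zero]

theorem affineMetric_localComp_comm (a b : CompIdx r n) :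
    affineMetric e (localComp n c y) (localComp n c y) u a b
      = affineMetric e (localComp n c y) (localComp n c y) u b a := by
  have h' := isCentroSphere_localComp hK hc e hL h
  rw [h'.affineMetric_eq hu, Matrix.smul_apply, Matrix.smul_apply,
    centroMetric_comm h'.isOpen h'.smooth hu]

theorem affineMetric_localComp_inr_of_ne {α β : Fin s} (hαβ : α ≠ β) (k : Fin (n α))
    (l : Fin (n β)) :
    affineMetric e (localComp n c y) (localComp n c y) u (Sum.inr ⟨α, k⟩) (Sum.inr ⟨β, l⟩) = 0 := by
  rw [(isCentroSphere_localComp hK hc e hL h).affineMetric_eq hu, Matrix.smul_apply,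
    (centro_localComp_inr_of_ne (fun α => (h α).isOpen) (fun α => (h α).smooth) hu hK
      (centroDet_localComp_ne h hK hc e hu) hαβ k l).2, smul_zero]

theorem affineMetric_localComp_inr_self (α : Fin s) (k l : Fin (n α)) :
    affineMetric e (localComp n c y) (localComp n c y) u (Sum.inr ⟨α, k⟩) (Sum.inr ⟨α, l⟩)
      = ((n α : ℝ) + 1) * (-L α) * calabiC n L c
        * affineMetric finSuccEquivLast (y α) (η α) (blockCoord n α u) k l := by
  have hN : (compDim r n : ℝ) + 1 ≠ 0 := by positivity
  have hLα := (hL α).ne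
  rw [(isCentroSphere_localComp hK hc e hL h).affineMetric_eq hu, Matrix.smul_apply,
    (centro_localComp_inr_self (fun α => (h α).isOpen) (fun α => (h α).smooth) hu hK
      (centroDet_localComp_ne h hK hc e hu) ((h α).centroDet_ne _ (hu α)) k l).2,
    (h α).affineMetric_eq (hu α), Matrix.smul_apply, smul_eq_mul, smul_eq_mul]
  field_simp

variable [Nonempty (CompIdx r n)]

theorem fubiniPick_localComp_symm (a b d : CompIdx r n) :
    fubiniPick e (localComp n c y) (localComp n c y) u a b d
        = fubiniPick e (localComp n c y) (localComp n c y) u b a d ∧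
      fubiniPick e (localComp n c y) (localComp n c y) u a b d
        = fubiniPick e (localComp n c y) (localComp n c y) u a d b := by
  have h' := isCentroSphere_localComp hK hc e hL h
  simp only [h'.fubiniPick_eq hu]
  exact ⟨by rw [centroCubic_symm_left h'.isOpen h'.smooth hu],
    by rw [centroCubic_symm_right h'.isOpen h'.smooth hu h'.centroDet_ne]⟩

theorem fubiniPick_localComp_inl_inl_inl (i j k : Fin (r + s - 1)) :
    fubiniPick e (localComp n c y) (localComp n c y) u (Sum.inl i) (Sum.inl j) (Sum.inl k)
      = calabiC n L c * compTriple n i j k := by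
  have hN : (compDim r n : ℝ) + 1 ≠ 0 := by positivity
  rw [(isCentroSphere_localComp hK hc e hL h).fubiniPick_eq hu,
    centroCubic_localComp_inl_inl_inl h hK hc e hu]
  field_simp

theorem fubiniPick_localComp_inl_inl_inr (i j : Fin (r + s - 1)) (α : Fin s) (k : Fin (n α)) :
    fubiniPick e (localComp n c y) (localComp n c y) u (Sum.inl i) (Sum.inl j) (Sum.inr ⟨α, k⟩)
      = 0 := by
  rw [(isCentroSphere_localComp hK hc e hL h).fubiniPick_eq hu,
    centroCubic_localComp_inl_inl_inr h hK hc e hu, mul_zero]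

theorem fubiniPick_localComp_inr_inr_inl (α : Fin s) (k l : Fin (n α)) (i : Fin (r + s - 1)) :
    fubiniPick e (localComp n c y) (localComp n c y) u (Sum.inr ⟨α, k⟩) (Sum.inr ⟨α, l⟩)
        (Sum.inl i)
      = compExp n (Sum.inr α) i * affineMetric e (localComp n c y) (localComp n c y) u
          (Sum.inr ⟨α, k⟩) (Sum.inr ⟨α, l⟩) := by
  have h' := isCentroSphere_localComp hK hc e hL h
  rw [h'.fubiniPick_eq hu, centroCubic_localComp_inr_inr_inl h hK hc e hu, h'.affineMetric_eq hu,
    Matrix.smul_apply, smul_eq_mul]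
  ring

theorem fubiniPick_localComp_inr_of_ne {α β : Fin s} (hαβ : α ≠ β) (k : Fin (n α))
    (l : Fin (n β)) (x : CompIdx r n) :
    fubiniPick e (localComp n c y) (localComp n c y) u (Sum.inr ⟨α, k⟩) (Sum.inr ⟨β, l⟩) x
      = 0 := by
  rw [(isCentroSphere_localComp hK hc e hL h).fubiniPick_eq hu,
    centroCubic_localComp_inr_of_ne h hK hc e hu hαβ, mul_zero]

theorem fubiniPick_localComp_inr_inr_inr (α : Fin s) (k l m : Fin (n α)) :
    fubiniPick e (localComp n c y) (localComp n c y) u (Sum.inr ⟨α, k⟩) (Sum.inr ⟨α, l⟩)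
        (Sum.inr ⟨α, m⟩)
      = ((n α : ℝ) + 1) * (-L α) * calabiC n L c
        * fubiniPick finSuccEquivLast (y α) (η α) (blockCoord n α u) k l m := by
  have hN : (compDim r n : ℝ) + 1 ≠ 0 := by positivity
  have hLα := (hL α).ne
  have : Nonempty (Fin (n α)) := ⟨k⟩
  rw [(isCentroSphere_localComp hK hc e hL h).fubiniPick_eq hu,
    centroCubic_localComp_inr_inr_inr h hK hc e hu, (h α).fubiniPick_eq (hu α)]
  field_simp

end ProductCoordinates

section CalabiComposition

variable {r s : ℕ} {n : Fin s → ℕ} {M : Fin s → Type*} [∀ α, TopologicalSpace (M α)]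
variable [∀ α, ChartedSpace (Fin (n α) → ℝ) (M α)]
variable [∀ α, IsManifold (modelWithCornersSelf ℝ (Fin (n α) → ℝ)) ∞ (M α)]
variable {x η : ∀ α, M α → Fin (n α + 1) → ℝ} {L : Fin s → ℝ} {c : Fin r ⊕ Fin s → ℝ}

/-- The Calabi composition is a hyperbolic affine hypersphere. -/
theorem isHyperbolicAffineHypersphere_calabiComp (hK : 2 ≤ r + s) (hn : ∀ α, 0 < n α)
    (hx : ∀ α, IsHyperbolicAffineHypersphere finSuccEquivLast (smoothCharts (n α) (M α))
      (x α) (η α) (L α))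
    (hcenter : ∀ α, IsAffineCenter finSuccEquivLast (smoothCharts (n α) (M α)) (x α) (η α) 0)
    (hc : ∀ a, 0 < c a) (e : AmbIdx r n ≃ Option (CompIdx r n)) :
    IsHyperbolicAffineHypersphere e (prodCharts r n M) (calabiComp n x c) (calabiComp n x c)
      (-1 / (((compDim r n : ℝ) + 1) * calabiC n L c)) := by
  have hL : ∀ α, L α < 0 := fun α => (hx α).neg
  have : Nonempty (CompIdx r n) := ⟨Sum.inl ⟨0, by omega⟩⟩
  have hN : 0 < (compDim r n : ℝ) + 1 := by positivity
  have hC := calabiC_pos (n := n) hc hL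
  have key : ∀ ψ ∈ prodCharts r n M, IsCentroSphere e (calabiComp n x c ∘ ψ.symm)
      (calabiComp n x c ∘ ψ.symm) ψ.target (((compDim r n : ℝ) + 1) * calabiC n L c) := by
    rintro _ ⟨φ, hφ, rfl⟩
    rw [calabiComp_prodChart, prodChart_target]
    exact isCentroSphere_localComp hK hc e hL
      fun α => (hx α).isCentroSphere (hn α) (hcenter α) (hφ α)
  have hq : ∀ (ψ : OpenPartialHomeomorph ((Fin (r + s - 1) → ℝ) × (∀ α, M α)) (CompIdx r n → ℝ)),
      ∀ q ∈ ψ.source, calabiComp n x c q = (calabiComp n x c ∘ ψ.symm) (ψ q) := fun ψ q hq => by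
    rw [Function.comp_apply, ψ.left_inv hq]
  refine ⟨⟨fun ψ hψ => (key ψ hψ).smooth, continuous_calabiComp x c fun α => (hx α).continuous,
    fun ψ hψ q hqs => ?_, fun ψ hψ q hqs => (key ψ hψ).hForm_det_ne (ψ.map_source hqs), ?_⟩, ?_,
    fun ψ hψ q hqs => ?_⟩
  · rw [hq ψ q hqs]
    exact (key ψ hψ).centroDet_ne _ (ψ.map_source hqs)
  · rintro _ ⟨φ, hφ, rfl⟩ q hqs hneg
    have hu := (prodChart r n φ).map_source hqs
    rw [prodChart_target] at hu
    have h1 := hneg.diag_pos (i := Sum.inl ⟨0, by omega⟩)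
    rw [Matrix.neg_apply, metricAt, calabiComp_prodChart, affineMetric_localComp_inl_inl hK hc hL
      (fun α => (hx α).isCentroSphere (hn α) (hcenter α) (hφ α)) e hu, if_pos rfl] at h1
    have h2 := mul_pos (compNorm_pos n (⟨0, by omega⟩ : Fin (r + s - 1))) hC
    linarith
  · exact div_neg_of_neg_of_pos (by norm_num) (mul_pos hN hC)
  · rw [shapeAt, (key ψ hψ).shapeOperator_eq (ψ.map_source hqs), neg_div, one_div]

end CalabiComposition

end AffineHypersurface

end

theorem mainTheorem5 {r s : ℕ} (hK : 2 ≤ r + s)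
    (n : Fin s → ℕ) (hn : ∀ α, 0 < n α)
    (M : Fin s → Type*) [∀ α, TopologicalSpace (M α)]
    [∀ α, ChartedSpace (Fin (n α) → ℝ) (M α)]
    [∀ α, IsManifold (modelWithCornersSelf ℝ (Fin (n α) → ℝ)) ∞ (M α)]
    -- the factors `x α : M α → ℝ^{n α + 1}`, with co-orientations `η α`
    (x η : ∀ α, M α → Fin (n α + 1) → ℝ) (L : Fin s → ℝ)
    (hx : ∀ α, AffineHypersurface.IsHyperbolicAffineHypersphere finSuccEquivLast
      (AffineHypersurface.smoothCharts (n α) (M α)) (x α) (η α) (L α))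
    (hcenter : ∀ α, AffineHypersurface.IsAffineCenter finSuccEquivLast
      (AffineHypersurface.smoothCharts (n α) (M α)) (x α) (η α) 0)
    (c : Fin r ⊕ Fin s → ℝ) (hc : ∀ a, 0 < c a)
    -- any labelling of the coordinates of the ambient space
    (e : AffineHypersurface.AmbIdx r n ≃ Option (AffineHypersurface.CompIdx r n)) :
    let C : ℝ := AffineHypersurface.calabiC n L c
    let X := AffineHypersurface.calabiComp n x c
    let S : Fin s → ℝ := AffineHypersurface.partialSum r n
    -- `X`, co-oriented by its position vector, is a hyperbolic affine hypersphere
    AffineHypersurface.IsHyperbolicAffineHypersphere e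
      (AffineHypersurface.prodCharts r n M) X X
      (-1 / (((AffineHypersurface.compDim r n : ℝ) + 1) * C)) ∧
    -- its invariants in product coordinates at any point
    ∀ φ : ∀ α, OpenPartialHomeomorph (M α) (Fin (n α) → ℝ),
      (∀ α, φ α ∈ AffineHypersurface.smoothCharts (n α) (M α)) →
    ∀ (t : Fin (r + s - 1) → ℝ) (p : ∀ α, M α), (∀ α, p α ∈ (φ α).source) →
      let ψ := AffineHypersurface.prodChart r n φ
      let g := AffineHypersurface.metricAt e ψ X X (t, p)
      let A := AffineHypersurface.fubiniPickAt e ψ X X (t, p)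
      let g' := fun α => AffineHypersurface.metricAt finSuccEquivLast (φ α) (x α) (η α) (p α)
      let A' := fun α => AffineHypersurface.fubiniPickAt finSuccEquivLast (φ α) (x α) (η α) (p α)
      -- the affine mean curvature
      (AffineHypersurface.meanCurvatureAt e ψ X X (t, p)
        = -1 / (((AffineHypersurface.compDim r n : ℝ) + 1) * C)) ∧
      -- the affine metric; the index `i` stands for `λ = i + 1`
      (∀ i j : Fin (r + s - 1), (i : ℕ) + 1 < r →
        g (Sum.inl i) (Sum.inl j)
          = if i = j then (((i : ℕ) : ℝ) + 2) / (((i : ℕ) : ℝ) + 1) * C else 0) ∧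
      (∀ (i j : Fin (r + s - 1)) (α : Fin s), (α : ℕ) = 0 → (i : ℕ) + 1 = r →
        g (Sum.inl i) (Sum.inl j)
          = if i = j then ((n α : ℝ) + r + 1) / ((r : ℝ) * ((n α : ℝ) + 1)) * C else 0) ∧
      (∀ (i j : Fin (r + s - 1)) (α β : Fin s), (β : ℕ) = (α : ℕ) + 1 → (i : ℕ) = r + (α : ℕ) →
        g (Sum.inl i) (Sum.inl j)
          = if i = j then S β / (((n β : ℝ) + 1) * S α) * C else 0) ∧
      (∀ (α : Fin s) (k l : Fin (n α)),
        g (Sum.inr ⟨α, k⟩) (Sum.inr ⟨α, l⟩) = ((n α : ℝ) + 1) * (-L α) * C * g' α k l) ∧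
      (∀ (α β : Fin s) (k : Fin (n α)) (l : Fin (n β)), α ≠ β →
        g (Sum.inr ⟨α, k⟩) (Sum.inr ⟨β, l⟩) = 0) ∧
      (∀ (i : Fin (r + s - 1)) (α : Fin s) (k : Fin (n α)),
        g (Sum.inl i) (Sum.inr ⟨α, k⟩) = 0 ∧ g (Sum.inr ⟨α, k⟩) (Sum.inl i) = 0) ∧
      -- the Fubini-Pick form is totally symmetric
      (∀ a b d, A a b d = A b a d ∧ A a b d = A a d b) ∧
      -- `A_{λλλ}`
      (∀ i : Fin (r + s - 1), (i : ℕ) + 1 < r →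
        A (Sum.inl i) (Sum.inl i) (Sum.inl i)
          = (1 - (((i : ℕ) : ℝ) + 1) ^ 2) / (((i : ℕ) : ℝ) + 1) ^ 2 * C) ∧
      (∀ (i : Fin (r + s - 1)) (α : Fin s), (α : ℕ) = 0 → (i : ℕ) + 1 = r →
        A (Sum.inl i) (Sum.inl i) (Sum.inl i)
          = (1 / (r : ℝ) ^ 2 - 1 / ((n α : ℝ) + 1) ^ 2) * C) ∧
      (∀ (i : Fin (r + s - 1)) (α β : Fin s), (β : ℕ) = (α : ℕ) + 1 → (i : ℕ) = r + (α : ℕ) →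
        A (Sum.inl i) (Sum.inl i) (Sum.inl i)
          = S β * C / (((n β : ℝ) + 1) * S α) * (1 / S α - 1 / ((n β : ℝ) + 1))) ∧
      -- `A_{λλμ}`, `λ < μ`
      (∀ i j : Fin (r + s - 1), i < j → (j : ℕ) + 1 ≤ r →
        A (Sum.inl i) (Sum.inl i) (Sum.inl j)
          = (((i : ℕ) : ℝ) + 2) / ((((i : ℕ) : ℝ) + 1) * (((j : ℕ) : ℝ) + 1)) * C) ∧
      (∀ (i j : Fin (r + s - 1)) (α : Fin s), (i : ℕ) + 1 < r → (j : ℕ) = r + (α : ℕ) →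
        A (Sum.inl i) (Sum.inl i) (Sum.inl j)
          = (((i : ℕ) : ℝ) + 2) * C / ((((i : ℕ) : ℝ) + 1) * S α)) ∧
      (∀ (i j : Fin (r + s - 1)) (α₁ α : Fin s), (α₁ : ℕ) = 0 → (i : ℕ) + 1 = r →
        (j : ℕ) = r + (α : ℕ) →
        A (Sum.inl i) (Sum.inl i) (Sum.inl j)
          = ((n α₁ : ℝ) + r + 1) * C / ((r : ℝ) * ((n α₁ : ℝ) + 1) * S α)) ∧
      (∀ (i j : Fin (r + s - 1)) (α α' β : Fin s), (α' : ℕ) = (α : ℕ) + 1 → i < j →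
        (i : ℕ) = r + (α : ℕ) → (j : ℕ) = r + (β : ℕ) →
        A (Sum.inl i) (Sum.inl i) (Sum.inl j)
          = S α' * C / (((n α' : ℝ) + 1) * S α * S β)) ∧
      -- components with two indices in `M α`
      (∀ (α : Fin s) (k l : Fin (n α)) (i : Fin (r + s - 1)), (i : ℕ) + 1 = r + (α : ℕ) →
        A (Sum.inr ⟨α, k⟩) (Sum.inr ⟨α, l⟩) (Sum.inl i)
            = -(1 / ((n α : ℝ) + 1)) * g (Sum.inr ⟨α, k⟩) (Sum.inr ⟨α, l⟩) ∧
        A (Sum.inr ⟨α, k⟩) (Sum.inr ⟨α, l⟩) (Sum.inl i) = L α * C * g' α k l) ∧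
      (∀ (α β : Fin s) (k l : Fin (n α)) (i : Fin (r + s - 1)), α ≤ β → (i : ℕ) = r + (β : ℕ) →
        A (Sum.inr ⟨α, k⟩) (Sum.inr ⟨α, l⟩) (Sum.inl i)
            = 1 / S β * g (Sum.inr ⟨α, k⟩) (Sum.inr ⟨α, l⟩) ∧
        A (Sum.inr ⟨α, k⟩) (Sum.inr ⟨α, l⟩) (Sum.inl i)
            = ((n α : ℝ) + 1) * (-L α) * C / S β * g' α k l) ∧
      (∀ (α : Fin s) (k l m : Fin (n α)),
        A (Sum.inr ⟨α, k⟩) (Sum.inr ⟨α, l⟩) (Sum.inr ⟨α, m⟩)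
          = ((n α : ℝ) + 1) * (-L α) * C * A' α k l m) ∧
      -- all the remaining components vanish
      (∀ i j : Fin (r + s - 1), j < i → A (Sum.inl i) (Sum.inl i) (Sum.inl j) = 0) ∧
      (∀ i j k : Fin (r + s - 1), i ≠ j → j ≠ k → i ≠ k →
        A (Sum.inl i) (Sum.inl j) (Sum.inl k) = 0) ∧
      (∀ (i j : Fin (r + s - 1)) (α : Fin s) (k : Fin (n α)),
        A (Sum.inl i) (Sum.inl j) (Sum.inr ⟨α, k⟩) = 0) ∧
      (∀ (α : Fin s) (k l : Fin (n α)) (i : Fin (r + s - 1)), (i : ℕ) + 1 < r + (α : ℕ) →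
        A (Sum.inr ⟨α, k⟩) (Sum.inr ⟨α, l⟩) (Sum.inl i) = 0) ∧
      (∀ (α β : Fin s) (k : Fin (n α)) (l : Fin (n β)), α ≠ β →
        ∀ a, A (Sum.inr ⟨α, k⟩) (Sum.inr ⟨β, l⟩) a = 0) := by
  intro C X S
  refine ⟨AffineHypersurface.isHyperbolicAffineHypersphere_calabiComp hK hn hx hcenter hc e,
    fun φ hφ t p hp => ?_⟩
  intro ψ g A g' A'
  open AffineHypersurface in
  have hL : ∀ α, L α < 0 := fun α => (hx α).neg
  open AffineHypersurface in
  have h := fun α => (hx α).isCentroSphere (hn α) (hcenter α) (hφ α)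
  have : Nonempty (AffineHypersurface.CompIdx r n) := ⟨Sum.inl ⟨0, by omega⟩⟩
  have hu := AffineHypersurface.prodChart_mem φ (t := t) hp
  have hX : X ∘ ψ.symm = AffineHypersurface.localComp n c fun α => x α ∘ (φ α).symm :=
    AffineHypersurface.calabiComp_prodChart x c φ
  have hg : g = AffineHypersurface.affineMetric e (X ∘ ψ.symm) (X ∘ ψ.symm) (ψ (t, p)) := rfl
  have hA : A = AffineHypersurface.fubiniPick e (X ∘ ψ.symm) (X ∘ ψ.symm) (ψ (t, p)) := rfl
  rw [hX] at hg hA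
  have hS : ∀ α, S α ≠ 0 := fun α => (AffineHypersurface.partialSum_pos n α).ne'
  have hw : ∀ α, (n α : ℝ) + 1 ≠ 0 := fun α => by positivity
  have gll := AffineHypersurface.affineMetric_localComp_inl_inl hK hc hL h e hu
  have glr := AffineHypersurface.affineMetric_localComp_inl_inr hK hc hL h e hu
  have gcomm := AffineHypersurface.affineMetric_localComp_comm hK hc hL h e hu
  have gne := fun α β hαβ => AffineHypersurface.affineMetric_localComp_inr_of_ne hK hc hL h e hu
    (α := α) (β := β) hαβ
  have grr := AffineHypersurface.affineMetric_localComp_inr_self hK hc hL h e hu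
  have Asymm := AffineHypersurface.fubiniPick_localComp_symm hK hc hL h e hu
  have Alll := AffineHypersurface.fubiniPick_localComp_inl_inl_inl hK hc hL h e hu
  have Allr := AffineHypersurface.fubiniPick_localComp_inl_inl_inr hK hc hL h e hu
  have Arrl := AffineHypersurface.fubiniPick_localComp_inr_inr_inl hK hc hL h e hu
  have Ane := fun α β hαβ => AffineHypersurface.fubiniPick_localComp_inr_of_ne hK hc hL h e hu
    (α := α) (β := β) hαβ
  have Arrr := AffineHypersurface.fubiniPick_localComp_inr_inr_inr hK hc hL h e hu
  have hmean : AffineHypersurface.meanCurvatureAt e ψ X X (t, p)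
      = -1 / (((AffineHypersurface.compDim r n : ℝ) + 1) * C) := by
    rw [AffineHypersurface.meanCurvatureAt, hX]
    rw [(AffineHypersurface.isCentroSphere_localComp hK hc e hL h).affineMeanCurvature_eq hu,
      neg_div, one_div]
  rw [← hg] at gll glr gcomm gne grr Arrl
  rw [← hA] at Asymm Alll Allr Arrl Ane Arrr
  change ∀ i j, g (Sum.inl i) (Sum.inl j) = _ at gll
  change ∀ i j k, A (Sum.inl i) (Sum.inl j) (Sum.inl k) = C * _ at Alll
  clear_value g A
  clear hg hA
  refine ⟨hmean, ?_, ?_, ?_, grr, (fun α β k l hαβ => gne α β hαβ k l), ?_, Asymm, ?_, ?_, ?_,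
    ?_, ?_, ?_, ?_, ?_, ?_, Arrr, ?_, ?_,
    Allr, ?_,
    fun α β k l hαβ a => Ane α β hαβ k l a⟩
  · intro i j hi
    rw [gll, AffineHypersurface.compNorm_of_lt n hi]
  · intro i j α hα hi
    rw [gll, AffineHypersurface.compNorm_of_eq n hα hi]
  · intro i j α β hβ hi
    rw [gll, AffineHypersurface.compNorm_of_gt n hβ hi]
  · exact fun i α k => ⟨glr i α k, by rw [gcomm, glr]⟩
  · intro i hi
    rw [Alll, AffineHypersurface.compTriple_self, AffineHypersurface.fNum_cast_of_le n hi.le,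
      AffineHypersurface.compTop_of_lt hi, AffineHypersurface.compWeight]
    have : ((i : ℕ) : ℝ) + 1 ≠ 0 := by positivity
    field_simp
  · intro i α hα hi
    rw [Alll, AffineHypersurface.compTriple_self, hi, AffineHypersurface.fNum_of_le n le_rfl,
      AffineHypersurface.compTop_of_eq (α := α) (by omega), AffineHypersurface.compWeight, mul_comm]
  · intro i α β hβ hi
    rw [Alll, AffineHypersurface.compTriple_self, AffineHypersurface.fNum_of_eq n hi,
      AffineHypersurface.compTop_of_eq (α := β) (by omega), AffineHypersurface.compWeight]
    change _ * (1 / S α ^ 2 - _) = _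
    have hSβ : S β = S α + ((n β : ℝ) + 1) := AffineHypersurface.partialSum_succ n hβ
    have h1 := hS α
    have h2 := hw β
    rw [hSβ]
    field_simp
    ring
  · intro i j hij hj
    have hi : (i : ℕ) + 1 < r := by
      have : (i : ℕ) < j := hij
      omega
    rw [Alll, AffineHypersurface.compTriple_of_lt n hij, AffineHypersurface.compNorm_of_lt n hi,
      AffineHypersurface.fNum_cast_of_le n hj]
    have h1 : ((i : ℕ) : ℝ) + 1 ≠ 0 := by positivity
    have h2 : ((j : ℕ) : ℝ) + 1 ≠ 0 := by positivity
    field_simp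
  · intro i j α hi hj
    have hij : i < j := by
      change (i : ℕ) < j
      omega
    rw [Alll, AffineHypersurface.compTriple_of_lt n hij, AffineHypersurface.compNorm_of_lt n hi,
      AffineHypersurface.fNum_of_eq n hj]
    change _ * (_ / S α) = _
    have h1 : ((i : ℕ) : ℝ) + 1 ≠ 0 := by positivity
    have h2 := hS α
    field_simp
  · intro i j α₁ α hα hi hj
    have hij : i < j := by
      change (i : ℕ) < j
      omega
    rw [Alll, AffineHypersurface.compTriple_of_lt n hij, AffineHypersurface.compNorm_of_eq n hα hi,
      AffineHypersurface.fNum_of_eq n hj]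
    change _ * (_ / S α) = _
    have h1 : (r : ℝ) ≠ 0 := by
      have : r ≠ 0 := by omega
      exact_mod_cast this
    have h2 := hS α
    have h3 := hw α₁
    field_simp
  · intro i j α α' β hα hij hi hj
    rw [Alll, AffineHypersurface.compTriple_of_lt n hij, AffineHypersurface.compNorm_of_gt n hα hi,
      AffineHypersurface.fNum_of_eq n hj]
    change _ * (S α' / (_ * S α) / S β) = _
    have h1 := hS α
    have h2 := hS β
    have h3 := hw α'
    field_simp
  · intro α k l i hi
    have h1 : A (Sum.inr ⟨α, k⟩) (Sum.inr ⟨α, l⟩) (Sum.inl i)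
        = -(1 / ((n α : ℝ) + 1)) * g (Sum.inr ⟨α, k⟩) (Sum.inr ⟨α, l⟩) := by
      rw [Arrl, AffineHypersurface.compExp_of_eq n (by simp only [AffineHypersurface.compPos]; omega)]
      rfl
    refine ⟨h1, ?_⟩
    rw [h1, grr]
    change _ * (_ * C * g' α k l) = _
    have h2 := hw α
    field_simp
  · intro α β k l i hαβ hi
    have h1 : A (Sum.inr ⟨α, k⟩) (Sum.inr ⟨α, l⟩) (Sum.inl i)
        = 1 / S β * g (Sum.inr ⟨α, k⟩) (Sum.inr ⟨α, l⟩) := by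
      have : (α : ℕ) ≤ β := hαβ
      rw [Arrl, AffineHypersurface.compExp_of_le n (by simp only [AffineHypersurface.compPos]; omega),
        AffineHypersurface.fNum_of_eq n hi]
    refine ⟨h1, ?_⟩
    rw [h1, grr]
    change _ * (_ * C * g' α k l) = _
    ring
  · intro i j hij
    rw [Alll, AffineHypersurface.compTriple_comm', AffineHypersurface.compTriple_comm,
      AffineHypersurface.compTriple_eq_zero n hij hij, mul_zero]
  · intro i j k hij hjk hik
    rw [Alll, AffineHypersurface.compTriple_of_ne n hij hjk hik, mul_zero]
  · intro α k l i hi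
    rw [Arrl, AffineHypersurface.compExp_of_lt n (by simp only [AffineHypersurface.compPos]; omega),
      zero_mul]
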